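/- Let $G=(V,E)$ be the complete graph on a finite vertex set $V$ with root $r\in V$. For $S\subseteq V$ let $\delta(S)$ be the set of edges with exactly one endpoint in $S$, and write $\delta(v)=\delta(\{v\})$ and $x(F)=\sum_{e\in F}x_e$. Let $(x,y)\in\mathbb{R}^E\times\mathbb{R}^V$ be a feasible solution of the PCTSP LP relaxation, i.e., $x(\delta(v))=2y_v$ for all $v\in V\setminus\{r\}$, $x(\delta(r))\le 2$, $x(\delta(S))\ge 2y_v$ for all $S\subseteq V\setminus\{r\}$ and $v\in S$, $y_r=1$, $x_e\ge 0$ for all $e\in E$, and $y_v\in[0,1]$ for all $v\in V$. Then there are a finite set $\mathcal{T}$ of trees in $G$, each containing the root $r$, and weights $\mu\in[0,1]^{\mathcal{T}}$ such that $\sum_{T\in\mathcal{T}}\mu_T=1$, $$\sum_{T\in\mathcal{T}}\mu_T\chi^{E[T]}\le x,\qquad\text{and}\qquad \sum_{T\in\mathcal{T}\colon v\in V[T]}\mu_T=y_v\quad\text{for all } v\in V,$$ where $V[T]$ and $E[T]$ are the vertex set and the edge set of $T$, and $\chi^{F}\in\{0,1\}^E$ is the characteristic vector of $F\subseteq E$.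 Moreover, there is a deterministic algorithm that, given $V$, $r$ and a rational feasible solution $(x,y)$, computes such a set $\mathcal{T}$ and such rational weights $\mu$ in time polynomial in the encoding length (number of bits) of the input. -/

import Mathlib

/-! ### Feasible solutions of the LP relaxation and fractional tree partitions -/

namespace PCTSP

/-- The cut `δ(S)` in the complete graph on `V`: all edges with exactly one endpoint in `S`. -/
def cut {V : Type*} [Fintype V] [DecidableEq V] (S : Finset V) : Finset (Sym2 V) :=
  Finset.univ.filter fun e => ∃ u ∈ S, ∃ v, v ∉ S ∧ e = s(u, v)

/-- Feasibility of `(x, y)` for the LP relaxation of prize-collecting TSP on the complete graph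
with vertex set `V` and root `r`. The edges are the elements of `Sym2 V` that are not loops; the
values of `x` on loops play no role. -/
structure IsFeasible {V K : Type*} [Fintype V] [DecidableEq V]
    [Field K] [LinearOrder K] [IsStrictOrderedRing K]
    (r : V) (x : Sym2 V → K) (y : V → K) : Prop where
  degree_eq : ∀ v, v ≠ r → ∑ e ∈ cut {v}, x e = 2 * y v
  degree_root_le : ∑ e ∈ cut {r}, x e ≤ 2
  cut_ge : ∀ S : Finset V, r ∉ S → ∀ v ∈ S, 2 * y v ≤ ∑ e ∈ cut S, x e
  root_eq : y r = 1
  edge_nonneg : ∀ e ∈ (⊤ : SimpleGraph V).edgeSet, 0 ≤ x e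
  vertex_mem : ∀ v, y v ∈ Set.Icc (0 : K) 1

open Classical in
/-- A finite set `𝒯` of trees (subgraphs of the complete graph on `V`) that contain the root `r`,
with weights `μ` in `[0, 1]` of total weight `1`, such that the weighted trees are dominated by `x`
on every edge and cover every vertex `v` with total weight exactly `y v`. -/
structure IsTreePartition {V K : Type*}
    [Field K] [LinearOrder K] [IsStrictOrderedRing K]
    (r : V) (x : Sym2 V → K) (y : V → K)
    (𝒯 : Finset (⊤ : SimpleGraph V).Subgraph) (μ : (⊤ : SimpleGraph V).Subgraph → K) : Prop where
  isTree : ∀ T ∈ 𝒯, T.coe.IsTree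
  root_mem : ∀ T ∈ 𝒯, r ∈ T.verts
  weight_mem : ∀ T ∈ 𝒯, μ T ∈ Set.Icc (0 : K) 1
  weight_sum : ∑ T ∈ 𝒯, μ T = 1
  edge_le : ∀ e ∈ (⊤ : SimpleGraph V).edgeSet,
    ∑ T ∈ 𝒯, μ T * T.edgeSet.indicator (fun _ => (1 : K)) e ≤ x e
  cover_eq : ∀ v, ∑ T ∈ 𝒯 with v ∈ T.verts, μ T = y v

end PCTSP

/-! ### A programming language with a bit-cost measure

Programs of a while language manipulate binary trees (S-expressions) whose leaves are rational
numbers. Every elementary operation is charged the bit sizes of its argument and of its result, so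
polynomial cost in this model is the same as polynomial time on a Turing machine. -/

namespace Machine

/-- The values that programs work on: binary trees with rational leaves. -/
inductive Data where
  | atom (q : ℚ)
  | pair (a b : Data)

namespace Data

/-- The number of bits needed to write down a value, up to a constant factor. -/
def size : Data → ℕ
  | atom q => 1 + q.num.natAbs.size + q.den.size
  | pair a b => 1 + a.size + b.size

/-- A list of values; the empty list is the leaf `0`. -/
def ofList : List Data → Data
  | [] => atom 0
  | a :: l => pair a (ofList l)

/-- A vector of rational numbers as a list. -/
def ofVector {n : ℕ} (y : Fin n → ℚ) : Data :=
  ofList (List.ofFn fun i => atom (y i))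

/-- A square matrix of rational numbers as the list of its rows. -/
def ofMatrix {n : ℕ} (a : Fin n → Fin n → ℚ) : Data :=
  ofList (List.ofFn fun i => ofVector (a i))

end Data

/-- The elementary operations. -/
inductive Op where
  | id
  | const (q : ℚ)
  | fst
  | snd
  | isPair
  | add
  | sub
  | mul
  | div
  | le

/-- The effect of an elementary operation; on arguments of the wrong shape the result is `0`. -/
def Op.apply : Op → Data → Data
  | .id, d => d
  | .const q, _ => .atom q
  | .fst, .pair a _ => a
  | .snd, .pair _ b => b
  | .isPair, .pair _ _ => .atom 1
  | .add, .pair (.atom p) (.atom q) => .atom (p + q)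
  | .sub, .pair (.atom p) (.atom q) => .atom (p - q)
  | .mul, .pair (.atom p) (.atom q) => .atom (p * q)
  | .div, .pair (.atom p) (.atom q) => .atom (p / q)
  | .le, .pair (.atom p) (.atom q) => .atom (if p ≤ q then 1 else 0)
  | _, _ => .atom 0

/-- Programs. `pair f g` runs `f` and `g` on the same input and pairs the results, `comp f g` runs
`g` and then `f`, `cond c f g` is "if `c` then `f` else `g`" and `loop c f` is "while `c` do `f`",
where the result `0` of a test means false and every other result means true. -/
inductive Code where
  | op (o : Op)
  | pair (f g : Code)
  | comp (f g : Code)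
  | cond (c f g : Code)
  | loop (c f : Code)

/-- `Runs f d e t`: the program `f` halts on input `d` with output `e` at total cost `t`. -/
inductive Runs : Code → Data → Data → ℕ → Prop where
  | op (o : Op) (d : Data) :
      Runs (.op o) d (o.apply d) (d.size + (o.apply d).size)
  | pair {f g : Code} {d a b : Data} {s t : ℕ} :
      Runs f d a s → Runs g d b t → Runs (.pair f g) d (.pair a b) (s + t + 1)
  | comp {f g : Code} {d a b : Data} {s t : ℕ} :
      Runs g d a s → Runs f a b t → Runs (.comp f g) d b (s + t + 1)
  | condTrue {c f g : Code} {d a b : Data} {s t : ℕ} :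
      Runs c d a s → a ≠ .atom 0 → Runs f d b t → Runs (.cond c f g) d b (s + t + 1)
  | condFalse {c f g : Code} {d b : Data} {s t : ℕ} :
      Runs c d (.atom 0) s → Runs g d b t → Runs (.cond c f g) d b (s + t + 1)
  | loopStop {c f : Code} {d : Data} {s : ℕ} :
      Runs c d (.atom 0) s → Runs (.loop c f) d d (s + 1)
  | loopStep {c f : Code} {d a b e : Data} {s t w : ℕ} :
      Runs c d a s → a ≠ .atom 0 → Runs f d b t → Runs (.loop c f) b e w →
      Runs (.loop c f) d e (s + t + w + 1)

/-- Programs are deterministic: output and cost are determined by the input. -/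
theorem Runs.deterministic {f : Code} {d e : Data} {t : ℕ} (h : Runs f d e t) :
    ∀ {e' : Data} {t' : ℕ}, Runs f d e' t' → e = e' ∧ t = t' := by
  induction h with
  | op o d => intro e' t' h'; cases h'; exact ⟨rfl, rfl⟩
  | pair _ _ ih₁ ih₂ =>
    intro e' t' h'
    cases h' with
    | pair k₁ k₂ =>
      obtain ⟨rfl, rfl⟩ := ih₁ k₁
      obtain ⟨rfl, rfl⟩ := ih₂ k₂
      exact ⟨rfl, rfl⟩
  | comp _ _ ih₁ ih₂ =>
    intro e' t' h'
    cases h' with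
    | comp k₁ k₂ =>
      obtain ⟨rfl, rfl⟩ := ih₁ k₁
      obtain ⟨rfl, rfl⟩ := ih₂ k₂
      exact ⟨rfl, rfl⟩
  | condTrue _ hne _ ih₁ ih₂ =>
    intro e' t' h'
    cases h' with
    | condTrue k₁ _ k₂ =>
      obtain ⟨rfl, rfl⟩ := ih₁ k₁
      obtain ⟨rfl, rfl⟩ := ih₂ k₂
      exact ⟨rfl, rfl⟩
    | condFalse k₁ k₂ => exact absurd (ih₁ k₁).1 hne
  | condFalse _ _ ih₁ ih₂ =>
    intro e' t' h'
    cases h' with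
    | condTrue k₁ hne k₂ => exact absurd (ih₁ k₁).1.symm hne
    | condFalse k₁ k₂ =>
      obtain ⟨-, rfl⟩ := ih₁ k₁
      obtain ⟨rfl, rfl⟩ := ih₂ k₂
      exact ⟨rfl, rfl⟩
  | loopStop _ ih₁ =>
    intro e' t' h'
    cases h' with
    | loopStop k₁ =>
      obtain ⟨-, rfl⟩ := ih₁ k₁
      exact ⟨rfl, rfl⟩
    | loopStep k₁ hne _ _ => exact absurd (ih₁ k₁).1.symm hne
  | loopStep _ hne _ _ ih₁ ih₂ ih₃ =>
    intro e' t' h'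
    cases h' with
    | loopStop k₁ => exact absurd (ih₁ k₁).1 hne
    | loopStep k₁ _ k₂ k₃ =>
      obtain ⟨rfl, rfl⟩ := ih₁ k₁
      obtain ⟨rfl, rfl⟩ := ih₂ k₂
      obtain ⟨rfl, rfl⟩ := ih₃ k₃
      exact ⟨rfl, rfl⟩

end Machine

/-! ### Encoding of inputs and outputs -/

namespace PCTSP

open Machine

/-- The input: the number of vertices, the root, the symmetric matrix of the edge values `x` (with
zeros on the diagonal) and the vector `y`. -/
def encodeInput {n : ℕ} (r : Fin n) (x : Sym2 (Fin n) → ℚ) (y : Fin n → ℚ) : Data :=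
  .pair (.atom n) (.pair (.atom (r : ℕ)) (.pair
    (Data.ofMatrix fun u v => if u = v then 0 else x s(u, v)) (Data.ofVector y)))

open Classical in
/-- A subgraph: the 0/1-vector of its vertices and its 0/1-adjacency matrix. -/
noncomputable def encodeTree {n : ℕ} (T : (⊤ : SimpleGraph (Fin n)).Subgraph) : Data :=
  .pair (Data.ofVector fun v => if v ∈ T.verts then 1 else 0)
    (Data.ofMatrix fun u v => if T.Adj u v then 1 else 0)

/-- `EncodesWeightedTrees out 𝒯 μ`: the value `out` is a list, in some order and without
repetition, of all trees `T` in `𝒯`, each together with its weight `μ T`. -/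
def EncodesWeightedTrees {n : ℕ} (out : Data) (𝒯 : Finset (⊤ : SimpleGraph (Fin n)).Subgraph)
    (μ : (⊤ : SimpleGraph (Fin n)).Subgraph → ℚ) : Prop :=
  ∃ l : List (⊤ : SimpleGraph (Fin n)).Subgraph, l.Nodup ∧ (∀ T, T ∈ l ↔ T ∈ 𝒯) ∧
    out = Data.ofList (l.map fun T => .pair (encodeTree T) (.atom (μ T)))

end PCTSP

set_option linter.unusedSectionVars false

namespace Machine

open Data

/-! The trees come from splitting off. Among the vertices other than the root let `v` have the
smallest `y v`. Its requirement is dropped (`y v` becomes `-1`) and pairs of edges at `v` are split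
off: weight `α` moves from `uv` and `wv` to `uw`, with `α` as large as the cut requirements of the
other vertices permit. A pair is stuck only if one of its edges is used up or a tight set keeps `u`
and `w` together and apart from `v`. If every pair is stuck and `v` still has a neighbour `u ≠ r`,
the tight sets around `u` uncross to one tight set that contains all neighbours of `v` but not `v`;
adding `v` to it lowers the cut below the requirement, a contradiction (`Feas.tight_union`,
`Feas.eq_zero_of_blocked`). So `v` ends up joined at most to the root, and deleting these edges
keeps feasibility (`Feas.isolate`). When only the root has a requirement left, the one-vertex tree
with weight `1` is a decomposition.

The eliminations are undone in reverse order. Trees that overuse `uw` with respect to its value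
before the splitting have this edge replaced by a path through `v`. A rerouted portion of weight `t`
adds at most `t` to the degree at `v`, plus the growth of the coverage of `v`. Summed up, `v` is
covered at most to the extent of `y v`, and of the `2 * y v` available at `v` at most `y v` plus the
coverage is used (`foldl_undoSplit_spec`). The remaining room suffices to attach `v` as a leaf until
it is covered exactly. Trees for this exist because `y v` was smallest: every neighbour `u` with a
requirement is covered at least to the extent of `y v`, so if `v` is not fully covered, some tree
contains `u` and misses `v` (`attachStep_spec`, `Covering.undoElim`).

This construction is also the algorithm. It is defined over any ordered field with a list
enumerating the vertices, so the same statements serve existence over `ℝ` and computation over `ℚ`.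
The amount of a splitting is found from minimum cuts, which are computed by augmenting along widest
paths; each augmentation takes at least a `1 / n ^ 2` fraction off the residual minimum cut. The bit
sizes stay polynomial because the product `D` of all input denominators remains a common
denominator: edge values, vertex values and half degrees away from the root lie in `(1 / D)ℤ`, hence
so do half cuts (`Integral.den_half_cutv_dvd`), amounts of splittings and weights of trees. The
number of trees stays polynomial because each greedy rearrangement cuts at most one tree in two.

Running times are handled by the relation `Poly F G` between families of values, which is closed
under the usual program constructions. Only loops need more, an a priori bound on the sizes of their
states (`Poly.loop`, `Poly.foldl`); the invariants of the later parts provide it. -/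

/-- The cost of a run bounds the sizes of its input and of its output. -/
theorem Runs.size_le {c : Code} {d e : Data} {t : ℕ} (h : Runs c d e t) :
    d.size ≤ t ∧ e.size ≤ t := by
  induction h with
  | op o d => omega
  | pair _ _ ih₁ ih₂ => simp only [Data.size]; omega
  | comp _ _ ih₁ ih₂ => omega
  | condTrue _ _ _ ih₁ ih₂ => omega
  | condFalse _ _ ih₁ ih₂ => omega
  | loopStop _ ih => omega
  | loopStep _ _ _ _ ih₁ ih₂ ih₃ => omega

/-! ### Polynomially bounded quantities -/

/-- `f` is bounded by a polynomial in `g`. -/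
def PB {ι : Type*} (f g : ι → ℕ) : Prop := ∃ k : ℕ, ∀ i, f i ≤ (g i + 2) ^ k

namespace PB

variable {ι κ : Type*} {f f' g h : ι → ℕ}

theorem of_le (h1 : PB f' g) (h2 : ∀ i, f i ≤ f' i) : PB f g := by
  obtain ⟨k, hk⟩ := h1
  exact ⟨k, fun i => (h2 i).trans (hk i)⟩

theorem refl (g : ι → ℕ) : PB g g := ⟨1, fun i => by simp⟩

/-- The summand `2` in `PB` keeps the base at least `2` where `g` vanishes, so that constants and
sums are absorbed by the exponent. -/
theorem const (c : ℕ) : PB (fun _ => c) g :=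
  ⟨c, fun i => (Nat.lt_two_pow_self).le.trans (Nat.pow_le_pow_left (by omega) c)⟩

theorem add (h1 : PB f g) (h2 : PB f' g) : PB (fun i => f i + f' i) g := by
  obtain ⟨k, hk⟩ := h1
  obtain ⟨l, hl⟩ := h2
  refine ⟨k + l + 1, fun i => ?_⟩
  have h3 : (g i + 2) ^ k ≤ (g i + 2) ^ (k + l) := Nat.pow_le_pow_right (by omega) (by omega)
  have h4 : (g i + 2) ^ l ≤ (g i + 2) ^ (k + l) := Nat.pow_le_pow_right (by omega) (by omega)
  have h5 : 2 * (g i + 2) ^ (k + l) ≤ (g i + 2) ^ (k + l + 1) := by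
    rw [pow_succ, mul_comm]
    exact Nat.mul_le_mul_left _ (by omega)
  have h6 := hk i
  have h7 := hl i
  show f i + f' i ≤ _
  omega

theorem mul (h1 : PB f g) (h2 : PB f' g) : PB (fun i => f i * f' i) g := by
  obtain ⟨k, hk⟩ := h1
  obtain ⟨l, hl⟩ := h2
  refine ⟨k + l, fun i => ?_⟩
  rw [pow_add]
  exact Nat.mul_le_mul (hk i) (hl i)

theorem trans (h1 : PB f g) (h2 : PB g h) : PB f h := by
  obtain ⟨k, hk⟩ := h1
  obtain ⟨l, hl⟩ := h2
  -- The extra `2` in the exponent absorbs the inner summand: `(h + 2) ^ l + 2 ≤ (h + 2) ^ l * (h +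
  -- 2) ^ 2`.
  refine ⟨(l + 2) * k, fun i => ?_⟩
  rw [pow_mul]
  refine (hk i).trans (Nat.pow_le_pow_left ?_ k)
  have h3 : 1 ≤ (h i + 2) ^ l := Nat.one_le_pow _ _ (by omega)
  have h4 : (h i + 2) ^ l * (2 * 2) ≤ (h i + 2) ^ l * ((h i + 2) * (h i + 2)) :=
    Nat.mul_le_mul_left _ (Nat.mul_le_mul (by omega) (by omega))
  have h5 : (h i + 2) ^ (l + 2) = (h i + 2) ^ l * ((h i + 2) * (h i + 2)) := by ring
  have := hl i
  omega

theorem reindex (r : κ → ι) (h1 : PB f g) : PB (fun j => f (r j)) (fun j => g (r j)) := by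
  obtain ⟨k, hk⟩ := h1
  exact ⟨k, fun i => hk _⟩

end PB

theorem PB.exists_polynomial {ι : Type*} {f g : ι → ℕ} (h : PB f g) :
    ∃ p : Polynomial ℕ, ∀ i, f i ≤ p.eval (g i) := by
  obtain ⟨k, hk⟩ := h
  exact ⟨(Polynomial.X + Polynomial.C 2) ^ k, fun i => by simpa using hk i⟩

/-! ### Families of values computable in polynomial time -/

/-- One program computes `G i` from `F i`, for all `i`, in time polynomial in the size of `F i`. -/
def Poly {ι : Type*} (F G : ι → Data) : Prop :=
  ∃ (c : Code) (t : ι → ℕ), (∀ i, Runs c (F i) (G i) (t i)) ∧ PB t fun i => (F i).size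

/-- One program decides `P i` from `F i` in polynomial time. -/
def PolyDec {ι : Type*} (F : ι → Data) (P : ι → Prop) : Prop :=
  open Classical in Poly F fun i => atom (if P i then 1 else 0)

namespace Poly

variable {ι κ : Type*} {F G H : ι → Data}

theorem size_bound (h : Poly F G) : PB (fun i => (G i).size) fun i => (F i).size := by
  obtain ⟨c, t, h1, h2⟩ := h
  exact h2.of_le fun i => (h1 i).size_le.2

theorem of_op (o : Op) (h : ∀ i, o.apply (F i) = G i)
    (hs : PB (fun i => (G i).size) fun i => (F i).size) : Poly F G :=
  ⟨.op o, fun i => (F i).size + (G i).size, fun i => by simpa only [h i] using Runs.op o (F i),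
    (PB.refl _).add hs⟩

theorem id (F : ι → Data) : Poly F F := of_op .id (fun i => by simp [Op.apply]) (PB.refl _)

theorem const (F : ι → Data) (q : ℚ) : Poly F fun _ => atom q :=
  of_op (.const q) (fun i => by simp [Op.apply]) (PB.const _)

theorem trans (h1 : Poly F G) (h2 : Poly G H) : Poly F H := by
  have hb := h1.size_bound
  obtain ⟨c, t, h1, h1'⟩ := h1
  obtain ⟨d, s, h2, h2'⟩ := h2
  exact ⟨.comp d c, fun i => t i + s i + 1, fun i => Runs.comp (h1 i) (h2 i),
    (h1'.add (h2'.trans hb)).add (PB.const 1)⟩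

theorem pair (h1 : Poly F G) (h2 : Poly F H) : Poly F fun i => .pair (G i) (H i) := by
  obtain ⟨c, t, h1, h1'⟩ := h1
  obtain ⟨d, s, h2, h2'⟩ := h2
  exact ⟨.pair c d, fun i => t i + s i + 1, fun i => Runs.pair (h1 i) (h2 i),
    (h1'.add h2').add (PB.const 1)⟩

theorem fst (h : Poly F fun i => .pair (G i) (H i)) : Poly F G :=
  h.trans <| of_op .fst (fun i => by simp [Op.apply]) <|
    (PB.refl _).of_le fun i => by simp only [Data.size]; omega

theorem snd (h : Poly F fun i => .pair (G i) (H i)) : Poly F H :=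
  h.trans <| of_op .snd (fun i => by simp [Op.apply]) <|
    (PB.refl _).of_le fun i => by simp only [Data.size]; omega

theorem reindex (r : κ → ι) (h : Poly F G) : Poly (fun j => F (r j)) fun j => G (r j) := by
  obtain ⟨c, t, h1, h2⟩ := h
  exact ⟨c, fun j => t (r j), fun j => h1 _, h2.reindex r⟩

/-- A result that holds for `F` holds in every environment from which `F` can be computed. -/
theorem weaken (r : κ → ι) {E : κ → Data} (h : Poly F G) (hE : Poly E fun j => F (r j)) :
    Poly E fun j => G (r j) := hE.trans (h.reindex r)

theorem congr (h : Poly F G) (hGH : ∀ i, G i = H i) : Poly F H := by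
  rwa [show H = G from funext fun i => (hGH i).symm]

-- Each branch has to be computed only for the indices that take it. This gives the branches access
-- to the outcome of the test, such as `z ≠ r` before a minimum cut is computed.
open Classical in
theorem ite_of {P : ι → Prop} {X Y : ι → Data} (hP : PolyDec F P)
    (hX : Poly (fun i : {i // P i} => F i) fun i => X i)
    (hY : Poly (fun i : {i // ¬ P i} => F i) fun i => Y i) :
    Poly F fun i => if P i then X i else Y i := by
  obtain ⟨c, t, h1, h1'⟩ := hP
  obtain ⟨d, s, h2, k, hk⟩ := hX
  obtain ⟨e, w, h3, l, hl⟩ := hY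
  refine ⟨.cond c d e,
    fun i => t i + (if h : P i then s ⟨i, h⟩ else w ⟨i, h⟩) + 1, fun i => ?_, ?_⟩
  · by_cases h : P i
    · have := h1 i
      simp only [h, if_true, dif_pos] at this ⊢
      exact Runs.condTrue this (by simp) (h2 ⟨i, h⟩)
    · have := h1 i
      simp only [h, if_false, dif_neg, not_false_eq_true] at this ⊢
      exact Runs.condFalse this (h3 ⟨i, h⟩)
  · refine (h1'.add ?_).add (PB.const 1)
    have a1 : PB (fun i => ((F i).size + 2) ^ k) (fun i => (F i).size) := ⟨k, fun i => le_rfl⟩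
    have a2 : PB (fun i => ((F i).size + 2) ^ l) (fun i => (F i).size) := ⟨l, fun i => le_rfl⟩
    refine (a1.add a2).of_le fun i => ?_
    by_cases h : P i
    · have : s ⟨i, h⟩ ≤ ((F i).size + 2) ^ k := hk ⟨i, h⟩
      simp only [h, dif_pos]
      omega
    · have : w ⟨i, h⟩ ≤ ((F i).size + 2) ^ l := hl ⟨i, h⟩
      simp only [h, dif_neg, not_false_eq_true]
      omega

theorem ite {P : ι → Prop} [∀ i, Decidable (P i)] {X Y : ι → Data} (hP : PolyDec F P)
    (hX : Poly F X) (hY : Poly F Y) : Poly F fun i => if P i then X i else Y i :=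
  (ite_of hP (hX.reindex _) (hY.reindex _)).congr fun i => by congr

/-- A while loop that runs through the states `S i 0, …, S i (N i)`. -/
theorem loop (N : ι → ℕ) (S : ι → ℕ → Data)
    (h0 : Poly F fun i => S i 0)
    (hstep : Poly (fun p : {p : ι × ℕ // p.2 < N p.1} => S p.1.1 p.1.2)
      fun p => S p.1.1 (p.1.2 + 1))
    (htest : PolyDec (fun p : {p : ι × ℕ // p.2 ≤ N p.1} => S p.1.1 p.1.2)
      fun p => p.1.2 < N p.1.1)
    (hN : PB N fun i => (F i).size)
    (hS : PB (fun p : {p : ι × ℕ // p.2 ≤ N p.1} => (S p.1.1 p.1.2).size)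
      fun p => (F p.1.1).size) :
    Poly F fun i => S i (N i) := by
  obtain ⟨c₀, t₀, hr₀, hb₀⟩ := h0
  obtain ⟨c, t, ht, k, hk⟩ := htest
  obtain ⟨d, s, hs, l, hl⟩ := hstep
  obtain ⟨m, hm⟩ := hS
  -- `U i` bounds the cost of one round on any reachable state, whose size is at most `((F i).size +
  -- 2) ^ m`.
  set U : ι → ℕ := fun i => (((F i).size + 2) ^ m + 2) ^ k + (((F i).size + 2) ^ m + 2) ^ l + 1
    with hU
  -- Backward induction: `j` is the number of rounds that remain.
  have key : ∀ i j, j ≤ N i → ∃ w, w ≤ (j + 1) * U i ∧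
      Runs (.loop c d) (S i (N i - j)) (S i (N i)) w := by
    intro i j
    induction j with
    | zero =>
      intro _
      have := ht ⟨(i, N i), le_rfl⟩
      simp only [lt_irrefl, if_false] at this
      refine ⟨_, ?_, Runs.loopStop this⟩
      have h1 := hk ⟨(i, N i), le_rfl⟩
      have h2 := Nat.pow_le_pow_left (Nat.add_le_add_right (hm ⟨(i, N i), le_rfl⟩) 2) k
      simp only [hU] at *
      omega
    | succ j ih =>
      intro hj
      obtain ⟨w, hw, hr⟩ := ih (by omega)
      have h1 := ht ⟨(i, N i - (j + 1)), by simp⟩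
      have hlt : N i - (j + 1) < N i := by omega
      simp only [hlt, if_true] at h1
      have h2 := hs ⟨(i, N i - (j + 1)), hlt⟩
      have e : N i - (j + 1) + 1 = N i - j := by omega
      simp only [e] at h2
      refine ⟨_, ?_, Runs.loopStep h1 (by simp) h2 hr⟩
      have b1 := hk ⟨(i, N i - (j + 1)), by simp⟩
      have b2 := hl ⟨(i, N i - (j + 1)), hlt⟩
      have b3 := Nat.pow_le_pow_left
        (Nat.add_le_add_right (hm ⟨(i, N i - (j + 1)), by simp⟩) 2) k
      have b4 := Nat.pow_le_pow_left
        (Nat.add_le_add_right (hm ⟨(i, N i - (j + 1)), by simp⟩) 2) l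
      have : (j + 1 + 1) * U i = (j + 1) * U i + U i := by ring
      simp only [hU] at *
      omega
  choose w hw hr using fun i => key i (N i) le_rfl
  have h1 : PB w fun i => (F i).size := by
    have a0 : PB (fun i => ((F i).size + 2) ^ m) (fun i => (F i).size) := ⟨m, fun i => le_rfl⟩
    have a1 : PB (fun i => (((F i).size + 2) ^ m + 2) ^ k) (fun i => (F i).size) :=
      PB.trans ⟨k, fun i => le_rfl⟩ a0
    have a2 : PB (fun i => (((F i).size + 2) ^ m + 2) ^ l) (fun i => (F i).size) :=
      PB.trans ⟨l, fun i => le_rfl⟩ a0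
    exact ((hN.add (PB.const 1)).mul ((a1.add a2).add (PB.const 1))).of_le hw
  refine ⟨.comp (.loop c d) c₀, fun i => t₀ i + w i + 1, fun i => ?_, (hb₀.add h1).add (PB.const 1)⟩
  have := hr i
  rw [Nat.sub_self] at this
  exact Runs.comp (hr₀ i) this

end Poly

/-! ### Lists -/

namespace Data

theorem size_ofList_eq (l : List Data) :
    (ofList l).size = 2 + (l.map fun d => 1 + d.size).sum := by
  induction l with
  | nil => simp [ofList, Data.size]
  | cons a l ih => simp only [ofList, Data.size, ih, List.map_cons, List.sum_cons]; omega

theorem size_le_of_mem {l : List Data} {d : Data} (h : d ∈ l) : d.size ≤ (ofList l).size := by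
  rw [size_ofList_eq]
  have := List.single_le_sum (l := l.map fun d => 1 + d.size) (by simp) (1 + d.size)
    (List.mem_map_of_mem h)
  omega

theorem length_le_size (l : List Data) : l.length ≤ (ofList l).size := by
  induction l with
  | nil => simp
  | cons a l ih => simp only [ofList, Data.size, List.length_cons]; omega

theorem size_ofList_le {l : List Data} {M N : ℕ} (hl : l.length ≤ N) (h : ∀ d ∈ l, d.size ≤ M) :
    (ofList l).size ≤ 2 + N * (1 + M) := by
  rw [size_ofList_eq]
  have := List.sum_le_card_nsmul (l.map fun d => 1 + d.size) (1 + M) (by simpa using h)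
  have h2 := Nat.mul_le_mul_right (1 + M) hl
  simp only [List.length_map, smul_eq_mul] at this
  omega

theorem size_ofList_mono {l l' : List Data} (h : l.Sublist l') :
    (ofList l).size ≤ (ofList l').size := by
  rw [size_ofList_eq, size_ofList_eq]
  have := (h.map fun d => 1 + d.size).sum_le_sum (by simp)
  omega

end Data

namespace Poly

variable {ι : Type} {F : ι → Data}

theorem isPair_dec {P : ι → Prop} {X : ι → Data} (hX : Poly F X)
    (h : ∀ i, P i ↔ ∃ a b, X i = .pair a b) : PolyDec F P := by
  classical
  refine hX.trans (of_op .isPair (fun i => ?_) ?_)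
  · by_cases hP : P i
    · obtain ⟨a, b, hab⟩ := (h i).1 hP
      simp [hP, hab, Op.apply]
    · have : ¬ ∃ a b, X i = .pair a b := fun h' => hP ((h i).2 h')
      cases hx : X i with
      | atom q => simp [hP, Op.apply]
      | pair a b => exact absurd ⟨a, b, hx⟩ this
  · refine (PB.const 3).of_le fun i => ?_
    split_ifs <;> simp [Data.size]

theorem foldl {α σ : ι → Type} (l : ∀ i, List (α i)) (f : ∀ i, σ i → α i → σ i) (s : ∀ i, σ i)
    (eα : ∀ i, α i → Data) (eσ : ∀ i, σ i → Data) (I : ∀ i, ℕ → σ i → Prop)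
    (hI0 : ∀ i, I i 0 (s i))
    (hI : ∀ i k s a, k < (l i).length → a ∈ l i → I i k s → I i (k + 1) (f i s a))
    (hl : Poly F fun i => ofList ((l i).map (eα i))) (hs : Poly F fun i => eσ i (s i))
    (B : ι → ℕ) (hB : PB B fun i => (F i).size)
    (hsize : ∀ i k s, k ≤ (l i).length → I i k s → (eσ i s).size ≤ B i)
    (hf : ∀ {κ : Type} (E : κ → Data) (g : κ → ι) (k : κ → ℕ) (s : ∀ j, σ (g j))
      (a : ∀ j, α (g j)), (∀ j, k j < (l (g j)).length) → (∀ j, a j ∈ l (g j)) →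
      (∀ j, I (g j) (k j) (s j)) →
      (∀ {X : ι → Data}, Poly F X → Poly E fun j => X (g j)) →
      Poly E (fun j => eα (g j) (a j)) → Poly E (fun j => eσ (g j) (s j)) →
      Poly E fun j => eσ (g j) (f (g j) (s j) (a j))) :
    Poly F fun i => eσ i ((l i).foldl (f i) (s i)) := by
  set st : ∀ i, ℕ → σ i := fun i k => ((l i).take k).foldl (f i) (s i) with hst
  have st_succ : ∀ i k (h : k < (l i).length), st i (k + 1) = f i (st i k) ((l i)[k]) := by
    intro i k h
    simp only [hst, List.take_succ_eq_append_getElem h, List.foldl_append, List.foldl_cons,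
      List.foldl_nil]
  have st_I : ∀ i k, k ≤ (l i).length → I i k (st i k) := by
    intro i k
    induction k with
    | zero => intro _; simpa [hst] using hI0 i
    | succ k ih =>
      intro h
      rw [st_succ i k h]
      exact hI i k _ _ h (List.getElem_mem _) (ih (by omega))
  set S : ι → ℕ → Data := fun i k =>
    .pair (ofList (((l i).drop k).map (eα i))) (.pair (F i) (eσ i (st i k))) with hS
  have hfin : ∀ i, eσ i ((l i).foldl (f i) (s i)) = eσ i (st i (l i).length) := by
    intro i; simp [hst]
  have main : Poly F fun i => S i (l i).length := by
    refine loop _ S ?_ ?_ ?_ ?_ ?_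
    · have : Poly F fun i => S i 0 := (hl.pair ((id F).pair hs)).congr fun i => by simp [hS, hst]
      exact this
    · have h1 := id (fun p : {p : ι × ℕ // p.2 < (l p.1).length} => S p.1.1 p.1.2)
      have h2 : Poly (fun p : {p : ι × ℕ // p.2 < (l p.1).length} => S p.1.1 p.1.2)
          (fun p => .pair (eα p.1.1 ((l p.1.1)[p.1.2]'p.2))
            (ofList (((l p.1.1).drop (p.1.2 + 1)).map (eα p.1.1)))) :=
        h1.fst.congr fun p => by
          rw [List.drop_eq_getElem_cons p.2]; rfl
      refine (h2.snd.pair (h1.snd.fst.pair (hf _ (fun p => p.1.1) (fun p => p.1.2)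
        (fun p => st p.1.1 p.1.2) (fun p => (l p.1.1)[p.1.2]'p.2) (fun p => p.2)
        (fun p => List.getElem_mem _) (fun p => st_I _ _ (le_of_lt p.2))
        (fun hX => hX.weaken
          (fun p : {p : ι × ℕ // p.2 < (l p.1).length} => p.1.1) h1.snd.fst) h2.fst h1.snd.snd))).congr fun p => ?_
      simp only [hS, st_succ _ _ p.2]
    -- A nonempty list is a pair and the empty list is an atom, so the loop test asks for a pair.
    · refine isPair_dec (id _).fst fun p => ⟨fun h => ?_, fun ⟨a, b, hab⟩ => ?_⟩
      · rw [List.drop_eq_getElem_cons h]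
        exact ⟨_, _, rfl⟩
      · by_contra h
        rw [List.drop_eq_nil_of_le (by omega)] at hab
        simp [ofList] at hab
    · exact hl.size_bound.of_le fun i => by
        simpa using length_le_size ((l i).map (eα i))
    · have h1 := ((hl.size_bound.add (PB.refl _)).add hB).add (PB.const 2)
      refine (h1.reindex (fun p : {p : ι × ℕ // p.2 ≤ (l p.1).length} => p.1.1)).of_le
        fun p => ?_
      have h2 := size_ofList_mono ((List.drop_sublist p.1.2 (l p.1.1)).map (eα p.1.1))
      have h3 := hsize _ _ _ p.2 (st_I _ _ p.2)
      simp only [hS, Data.size]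
      omega
  exact main.snd.snd.congr fun i => (hfin i).symm

end Poly

end Machine

namespace Machine

open Data

/-! ### Sizes of rational numbers -/

theorem nat_size_mul_le (a b : ℕ) : (a * b).size ≤ a.size + b.size := by
  rw [Nat.size_le, pow_add]
  exact Nat.mul_lt_mul'' (Nat.lt_size_self a) (Nat.lt_size_self b)

theorem nat_size_add_le (a b : ℕ) : (a + b).size ≤ a.size + b.size := by
  rcases Nat.eq_zero_or_pos a with rfl | ha
  · simp
  rcases Nat.eq_zero_or_pos b with rfl | hb
  · simp
  rw [Nat.size_le]
  have h1 := Nat.lt_size_self a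
  have h2 := Nat.lt_size_self b
  rw [pow_add]
  nlinarith [Nat.lt_size_self a, Nat.lt_size_self b]

/-- The numerator is at most `B * D`. Sizes are controlled in this way by a common denominator and a
magnitude, not operation by operation, since the latter would accumulate along loops. -/
theorem size_atom_le {q : ℚ} {D B : ℕ} (hD : D ≠ 0) (hq : q.den ∣ D) (hB : |q| ≤ B) :
    (atom q).size ≤ 1 + B.size + 2 * D.size := by
  have h1 : q.den ≤ D := Nat.le_of_dvd (Nat.pos_of_ne_zero hD) hq
  have h2 : q.num.natAbs ≤ B * D := by
    have e : (q.num.natAbs : ℚ) = |q| * q.den := by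
      rw [Nat.cast_natAbs, Int.cast_abs]
      conv_rhs => rw [← abs_of_nonneg (show (0 : ℚ) ≤ q.den by positivity), ← abs_mul]
      rw [Rat.mul_den_eq_num]
    have h3 : (q.den : ℚ) ≤ D := by exact_mod_cast h1
    have : (q.num.natAbs : ℚ) ≤ (B * D : ℕ) := by
      rw [e, Nat.cast_mul]
      exact mul_le_mul hB h3 (by positivity) (by positivity)
    exact_mod_cast this
  have h3 := Nat.size_le_size h1
  have h4 := (Nat.size_le_size h2).trans (nat_size_mul_le B D)
  simp only [Data.size]
  omega

theorem abs_le_natAbs_num (q : ℚ) : |q| ≤ (q.num.natAbs : ℚ) := by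
  rw [Nat.cast_natAbs, Int.cast_abs, ← Rat.mul_den_eq_num, abs_mul]
  have : (1 : ℚ) ≤ |(q.den : ℚ)| := by
    rw [abs_of_nonneg (by positivity)]
    exact_mod_cast q.den_pos
  nlinarith [abs_nonneg q]

/-- A denominator that divides `D` means membership in the group `(1 / D)ℤ`; the closure properties
are those of a group. -/
theorem den_add_dvd {p q : ℚ} {D : ℕ} (hp : p.den ∣ D) (hq : q.den ∣ D) : (p + q).den ∣ D :=
  (Rat.add_den_dvd_lcm p q).trans (Nat.lcm_dvd hp hq)

theorem den_neg_dvd {p : ℚ} {D : ℕ} (hp : p.den ∣ D) : (-p).den ∣ D := by simpa using hp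

theorem den_sub_dvd {p q : ℚ} {D : ℕ} (hp : p.den ∣ D) (hq : q.den ∣ D) : (p - q).den ∣ D := by
  rw [sub_eq_add_neg]; exact den_add_dvd hp (den_neg_dvd hq)

theorem den_sum_dvd {ι : Type*} {s : Finset ι} {f : ι → ℚ} {D : ℕ} (h : ∀ i ∈ s, (f i).den ∣ D) :
    (∑ i ∈ s, f i).den ∣ D :=
  Finset.sum_induction f (fun q => q.den ∣ D) (fun _ _ => den_add_dvd) (by simp) h

namespace Data

/-- A common denominator of all leaves. -/
def dens : Data → ℕ
  | atom q => q.den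
  | pair a b => a.dens * b.dens

/-- A bound for the absolute values of all leaves. -/
def mag : Data → ℕ
  | atom q => q.num.natAbs
  | pair a b => a.mag + b.mag

theorem dens_ne_zero (d : Data) : d.dens ≠ 0 := by
  induction d with
  | atom q => exact q.den_ne_zero
  | pair a b iha ihb => exact mul_ne_zero iha ihb

theorem size_dens_le (d : Data) : d.dens.size ≤ d.size := by
  induction d with
  | atom q => simp only [dens, size]; omega
  | pair a b iha ihb =>
    simp only [dens, size]
    have := nat_size_mul_le a.dens b.dens
    omega

theorem size_mag_le (d : Data) : d.mag.size ≤ d.size := by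
  induction d with
  | atom q => simp only [mag, size]; omega
  | pair a b iha ihb =>
    simp only [mag, size]
    have := nat_size_add_le a.mag b.mag
    omega

theorem dens_dvd_of_mem {l : List Data} {d : Data} (h : d ∈ l) : d.dens ∣ (ofList l).dens := by
  induction l with
  | nil => simp at h
  | cons a l ih =>
    rcases List.mem_cons.1 h with rfl | h
    · exact Dvd.intro _ rfl
    · exact (ih h).trans (Dvd.intro_left _ rfl)

theorem mag_le_of_mem {l : List Data} {d : Data} (h : d ∈ l) : d.mag ≤ (ofList l).mag := by
  induction l with
  | nil => simp at h
  | cons a l ih =>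
    rcases List.mem_cons.1 h with rfl | h
    · simp [ofList, mag]
    · have := ih h
      simp only [ofList, mag]
      omega

/-- A natural number. -/
def nat (k : ℕ) : Data := atom k

/-- The list of the entries of `v`. -/
def vec {n : ℕ} (v : Fin n → Data) : Data := ofList (List.ofFn v)

/-- The list `0, …, n - 1`. -/
def rng (n : ℕ) : Data := vec fun j : Fin n => nat j

/-- The list of the rows of a matrix. -/
def mat {n : ℕ} (x : Fin n → Fin n → ℚ) : Data := vec fun u => vec fun w => atom (x u w)

theorem size_nat (k : ℕ) : (nat k).size = 2 + k.size := by
  simp only [nat, size, Rat.num_natCast, Int.natAbs_natCast, Rat.den_natCast]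
  simp
  omega

theorem size_nat_mono {j k : ℕ} (h : j ≤ k) : (nat j).size ≤ (nat k).size := by
  rw [size_nat, size_nat]
  have := Nat.size_le_size h
  omega

theorem size_nat_fin_le {n : ℕ} (j : Fin n) : (nat j).size ≤ (rng n).size :=
  size_le_of_mem (by simp [List.mem_ofFn])

theorem size_entry_le {n : ℕ} (v : Fin n → Data) (j : Fin n) : (v j).size ≤ (vec v).size :=
  size_le_of_mem (by simp [List.mem_ofFn])

theorem size_vec_le {n M : ℕ} {v : Fin n → Data} (h : ∀ j, (v j).size ≤ M) :
    (vec v).size ≤ 2 + n * (1 + M) :=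
  size_ofList_le (by simp) (by simpa [List.mem_ofFn] using h)

theorem le_size_rng (n : ℕ) : n ≤ (rng n).size :=
  (List.length_ofFn (f := fun j : Fin n => nat j)).ge.trans (length_le_size _)

theorem vec_eq_map {n : ℕ} (v : Fin n → Data) : vec v = ofList ((List.finRange n).map v) := by
  rw [vec, List.ofFn_eq_map]

end Data

/-! ### Arithmetic -/

namespace Poly

variable {ι : Type} {F : ι → Data} {a b : ι → ℚ}

/-- One crude estimate serves sum, difference and product alike. -/
theorem arith {c : ι → ℚ} (o : Op) (ha : Poly F fun i => atom (a i))
    (hb : Poly F fun i => atom (b i))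
    (ho : ∀ i, o.apply (.pair (atom (a i)) (atom (b i))) = atom (c i))
    (hd : ∀ i, (c i).den ∣ (a i).den * (b i).den)
    (hc : ∀ i, |c i| ≤ (((a i).num.natAbs + 1) * ((b i).num.natAbs + 1) : ℕ)) :
    Poly F fun i => atom (c i) := by
  refine (ha.pair hb).trans (of_op o ho ?_)
  refine (((PB.refl _).mul (PB.const 3)).add (PB.const 4)).of_le fun i => ?_
  have h1 := size_atom_le (mul_ne_zero (a i).den_ne_zero (b i).den_ne_zero) (hd i) (hc i)
  have h2 := nat_size_mul_le (a i).den (b i).den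
  have h3 := nat_size_mul_le ((a i).num.natAbs + 1) ((b i).num.natAbs + 1)
  have h4 := nat_size_add_le (a i).num.natAbs 1
  have h5 := nat_size_add_le (b i).num.natAbs 1
  simp only [Nat.size_one] at h4 h5
  simp only [Data.size] at h1 ⊢
  omega

theorem add (ha : Poly F fun i => atom (a i)) (hb : Poly F fun i => atom (b i)) :
    Poly F fun i => atom (a i + b i) := by
  refine arith .add ha hb (fun i => rfl) (fun i => Rat.add_den_dvd _ _) fun i => ?_
  have h1 := abs_add_le (a i) (b i)
  have h2 := abs_le_natAbs_num (a i)
  have h3 := abs_le_natAbs_num (b i)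
  push_cast
  nlinarith [abs_nonneg ((a i).num : ℚ), abs_nonneg ((b i).num : ℚ)]

theorem sub (ha : Poly F fun i => atom (a i)) (hb : Poly F fun i => atom (b i)) :
    Poly F fun i => atom (a i - b i) := by
  refine arith .sub ha hb (fun i => rfl) (fun i => ?_) fun i => ?_
  · rw [sub_eq_add_neg]
    simpa using Rat.add_den_dvd (a i) (-b i)
  have h1 := abs_sub (a i) (b i)
  have h2 := abs_le_natAbs_num (a i)
  have h3 := abs_le_natAbs_num (b i)
  push_cast
  nlinarith [abs_nonneg ((a i).num : ℚ), abs_nonneg ((b i).num : ℚ)]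

theorem mul (ha : Poly F fun i => atom (a i)) (hb : Poly F fun i => atom (b i)) :
    Poly F fun i => atom (a i * b i) := by
  refine arith .mul ha hb (fun i => rfl) (fun i => Rat.mul_den_dvd _ _) fun i => ?_
  have h2 := abs_le_natAbs_num (a i)
  have h3 := abs_le_natAbs_num (b i)
  have := mul_le_mul h2 h3 (abs_nonneg _) (Nat.cast_nonneg _)
  rw [abs_mul]
  push_cast at this ⊢
  nlinarith [abs_nonneg ((a i).num : ℚ), abs_nonneg ((b i).num : ℚ)]

theorem ite_atom {P : ι → Prop} [∀ i, Decidable (P i)] (hP : PolyDec F P)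
    (ha : Poly F fun i => atom (a i)) (hb : Poly F fun i => atom (b i)) :
    Poly F fun i => atom (if P i then a i else b i) :=
  (ite hP ha hb).congr fun i => by split_ifs <;> rfl

end Poly

namespace PolyDec

variable {ι κ : Type} {F : ι → Data} {P Q : ι → Prop}

theorem congr (h : PolyDec F P) (hPQ : ∀ i, P i ↔ Q i) : PolyDec F Q := by
  rwa [show Q = P from funext fun i => (propext (hPQ i)).symm]

theorem toPoly [∀ i, Decidable (P i)] (h : PolyDec F P) :
    Poly F fun i => atom (if P i then 1 else 0) :=
  Poly.congr h fun i => by congr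

theorem ofPoly [∀ i, Decidable (P i)] (h : Poly F fun i => atom (if P i then 1 else 0)) :
    PolyDec F P := Poly.congr h fun i => by congr

theorem le {a b : ι → ℚ} (ha : Poly F fun i => atom (a i)) (hb : Poly F fun i => atom (b i)) :
    PolyDec F fun i => a i ≤ b i :=
  ofPoly <| (ha.pair hb).trans <| Poly.of_op .le (fun i => rfl) <|
    (PB.const 3).of_le fun i => by split_ifs <;> simp [Data.size]

theorem not (h : PolyDec F P) : PolyDec F fun i => ¬ P i := by
  classical
  exact Poly.congr (Poly.ite h (Poly.const F 0) (Poly.const F 1)) fun i => by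
    by_cases hi : P i <;> simp [hi]

theorem and (h : PolyDec F P) (h' : PolyDec F Q) : PolyDec F fun i => P i ∧ Q i := by
  classical
  exact Poly.congr (Poly.ite h h' (Poly.const F 0)) fun i => by
    by_cases hi : P i <;> simp [hi]

theorem or (h : PolyDec F P) (h' : PolyDec F Q) : PolyDec F fun i => P i ∨ Q i :=
  ((h.not.and h'.not).not).congr fun i => by tauto

theorem lt {a b : ι → ℚ} (ha : Poly F fun i => atom (a i)) (hb : Poly F fun i => atom (b i)) :
    PolyDec F fun i => a i < b i := ((le hb ha).not).congr fun _ => not_le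

theorem eq {a b : ι → ℚ} (ha : Poly F fun i => atom (a i)) (hb : Poly F fun i => atom (b i)) :
    PolyDec F fun i => a i = b i :=
  ((le ha hb).and (le hb ha)).congr fun _ => le_antisymm_iff.symm

theorem nat_le {a b : ι → ℕ} (ha : Poly F fun i => nat (a i)) (hb : Poly F fun i => nat (b i)) :
    PolyDec F fun i => a i ≤ b i := (le ha hb).congr fun _ => Nat.cast_le

theorem fin_eq {n : ι → ℕ} {a b : ∀ i, Fin (n i)} (ha : Poly F fun i => nat (a i))
    (hb : Poly F fun i => nat (b i)) : PolyDec F fun i => a i = b i :=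
  (eq ha hb).congr fun i => by rw [Nat.cast_inj, Fin.ext_iff]

end PolyDec

namespace Poly

variable {ι : Type} {F : ι → Data}

theorem min {a b : ι → ℚ} (ha : Poly F fun i => atom (a i)) (hb : Poly F fun i => atom (b i)) :
    Poly F fun i => atom (min (a i) (b i)) :=
  (ite (PolyDec.le ha hb) ha hb).congr fun i => by rw [min_def]; split_ifs <;> rfl

theorem max {a b : ι → ℚ} (ha : Poly F fun i => atom (a i)) (hb : Poly F fun i => atom (b i)) :
    Poly F fun i => atom (max (a i) (b i)) :=
  (ite (PolyDec.le ha hb) hb ha).congr fun i => by rw [max_def]; split_ifs <;> rfl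

/-! ### Operations on lists -/

theorem nil (F : ι → Data) : Poly F fun _ => ofList [] := const F 0

/-- Moving elements one at a time onto another list reverses them; reversal and concatenation are
both obtained from this. -/
theorem foldlCons (l l' : ι → List Data) (h : Poly F fun i => ofList (l i))
    (h' : Poly F fun i => ofList (l' i)) :
    Poly F fun i => ofList ((l i).reverse ++ l' i) := by
  have := foldl (F := F) (α := fun _ => Data) (σ := fun _ => List Data) l
    (fun i s d => d :: s) l' (fun _ d => d) (fun _ => ofList)
    (fun i k s => s.length = (l' i).length + k ∧ ∀ d ∈ s, d ∈ l i ∨ d ∈ l' i)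
    (fun i => ⟨rfl, fun d hd => .inr hd⟩)
    (fun i k s a _ ha hs => ⟨by simp [hs.1]; omega, fun d hd => by
      rcases List.mem_cons.1 hd with rfl | hd
      · exact .inl ha
      · exact hs.2 d hd⟩)
    (h.congr fun i => by simp) h'
    (fun i => 2 + ((l' i).length + (l i).length) *
      (1 + ((ofList (l i)).size + (ofList (l' i)).size)))
    ((PB.const 2).add (((h'.size_bound.of_le fun i => length_le_size _).add
      (h.size_bound.of_le fun i => length_le_size _)).mul
      ((PB.const 1).add (h.size_bound.add h'.size_bound))))
    (fun i k s hk hs => size_ofList_le (by omega) fun d hd => by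
      rcases hs.2 d hd with hd | hd
      · have := size_le_of_mem hd; omega
      · have := size_le_of_mem hd; omega)
    (fun E g k s a _ _ _ _ ha hs => ha.pair hs)
  refine this.congr fun i => ?_
  congr 1
  generalize l' i = m
  induction l i generalizing m with
  | nil => rfl
  | cons a l ih => simp [ih]

theorem reverse {l : ι → List Data} (h : Poly F fun i => ofList (l i)) :
    Poly F fun i => ofList (l i).reverse := by
  simpa using foldlCons l (fun _ => []) h (nil F)

theorem append {l l' : ι → List Data} (h : Poly F fun i => ofList (l i))
    (h' : Poly F fun i => ofList (l' i)) : Poly F fun i => ofList (l i ++ l' i) := by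
  simpa using foldlCons _ _ h.reverse h'

theorem map {α : ι → Type} (l : ∀ i, List (α i)) (eα : ∀ i, α i → Data) (g : ∀ i, α i → Data)
    (hl : Poly F fun i => ofList ((l i).map (eα i)))
    (hg : ∀ {κ : Type} (E : κ → Data) (r : κ → ι) (a : ∀ j, α (r j)), (∀ j, a j ∈ l (r j)) →
      (∀ {X : ι → Data}, Poly F X → Poly E fun j => X (r j)) →
      Poly E (fun j => eα (r j) (a j)) → Poly E fun j => g (r j) (a j)) :
    Poly F fun i => ofList ((l i).map (g i)) := by
  -- A uniform bound for the images: `hg` is applied to the family of all pairs of an index `i` and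
  -- an element of `l i`, in the environment made of `F i` and that element.
  have hb : ∃ B : ι → ℕ, PB B (fun i => (F i).size) ∧
      ∀ i, ∀ a ∈ l i, (g i a).size ≤ B i := by
    have h1 := id (fun p : Σ i, {a // a ∈ l i} => Data.pair (F p.1) (eα p.1 p.2.1))
    obtain ⟨k, hk⟩ := (hg _ (fun p : Σ i, {a // a ∈ l i} => p.1) (fun p => p.2.1)
      (fun p => p.2.2) (fun hX => hX.weaken
        (fun p : Σ i, {a // a ∈ l i} => p.1) h1.fst) h1.snd).size_bound
    refine ⟨fun i => (1 + (F i).size + (ofList ((l i).map (eα i))).size + 2) ^ k,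
      PB.trans ⟨k, fun i => le_rfl⟩ (((PB.const 1).add (PB.refl _)).add hl.size_bound),
      fun i a ha => (hk ⟨i, a, ha⟩).trans (Nat.pow_le_pow_left ?_ k)⟩
    have := size_le_of_mem (List.mem_map_of_mem (f := eα i) ha)
    simp only [Data.size]
    omega
  obtain ⟨B, hB, hB'⟩ := hb
  have := foldl (F := F) (α := α) (σ := fun _ => List Data) l
    (fun i s a => g i a :: s) (fun _ => []) eα (fun _ => ofList)
    (fun i k s => s.length = k ∧ ∀ d ∈ s, d.size ≤ B i)
    (fun i => ⟨by simp, by simp⟩)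
    (fun i k s a _ ha hs => ⟨by simp [hs.1], fun d hd => by
      rcases List.mem_cons.1 hd with rfl | hd
      · exact hB' i a ha
      · exact hs.2 d hd⟩)
    hl (nil F)
    (fun i => 2 + (l i).length * (1 + B i))
    ((PB.const 2).add ((hl.size_bound.of_le fun i => by
      simpa using length_le_size ((l i).map (eα i))).mul ((PB.const 1).add hB)))
    (fun i k s hk hs => size_ofList_le (by omega) hs.2)
    (fun E r k s a _ ha _ wk ha' hs => (hg E r a ha wk ha').pair hs)
  refine this.reverse.congr fun i => ?_
  congr 1
  have aux : ∀ (L : List (α i)) (m : List Data),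
      List.foldl (fun s a => g i a :: s) m L = (L.map (g i)).reverse ++ m := by
    intro L
    induction L with
    | nil => simp
    | cons a L ih => intro m; simp [ih]
  simp [aux]

/-- The index is counted down while the list is shortened. It is written in binary, but it is
smaller than the length of the list, so the number of rounds is polynomial. -/
theorem getElem {l : ι → List Data} {k : ι → ℕ} (hk : ∀ i, k i < (l i).length)
    (h : Poly F fun i => ofList (l i)) (h' : Poly F fun i => nat (k i)) :
    Poly F fun i => (l i)[k i]'(hk i) := by
  have main : Poly F fun i => Data.pair (ofList ((l i).drop (k i))) (nat (k i - k i)) := by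
    refine loop k (fun i j => .pair (ofList ((l i).drop j)) (nat (k i - j))) ?_ ?_ ?_ ?_ ?_
    · simpa using h.pair h'
    · have h1 := id (fun p : {p : ι × ℕ // p.2 < k p.1} =>
        Data.pair (ofList ((l p.1.1).drop p.1.2)) (nat (k p.1.1 - p.1.2)))
      have h2 : Poly (fun p : {p : ι × ℕ // p.2 < k p.1} =>
          Data.pair (ofList ((l p.1.1).drop p.1.2)) (nat (k p.1.1 - p.1.2)))
          (fun p => .pair ((l p.1.1)[p.1.2]'(p.2.trans (hk _)))
            (ofList ((l p.1.1).drop (p.1.2 + 1)))) :=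
        h1.fst.congr fun p => by rw [List.drop_eq_getElem_cons (p.2.trans (hk _))]; rfl
      refine h2.snd.pair ((h1.snd.sub (const _ 1)).congr fun p => ?_)
      have := p.2
      rw [nat, ← Nat.sub_sub, Nat.cast_sub (m := 1) (by omega)]
      simp
    · refine (PolyDec.nat_le (a := fun _ => 1) ?_ (id _).snd).congr fun p => ?_
      · simpa [nat] using const _ (1 : ℚ)
      · omega
    · exact h.size_bound.of_le fun i => (hk i).le.trans (length_le_size _)
    · refine (((PB.const 1).add (h.size_bound.add h'.size_bound)).reindex
        (fun p : {p : ι × ℕ // p.2 ≤ k p.1} => p.1.1)).of_le fun p => ?_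
      have h1 := size_ofList_mono (List.drop_sublist p.1.2 (l p.1.1))
      have h2 := size_nat_mono (Nat.sub_le (k p.1.1) p.1.2)
      simp only [Data.size]
      omega
  have h2 : Poly F fun i => .pair ((l i)[k i]'(hk i)) (ofList ((l i).drop (k i + 1))) :=
    main.fst.congr fun i => by rw [List.drop_eq_getElem_cons (hk i)]; rfl
  exact h2.fst

/-! ### Vectors, sums and quantifiers -/

variable {n : ι → ℕ}

theorem get {v : ∀ i, Fin (n i) → Data} {j : ∀ i, Fin (n i)}
    (h : Poly F fun i => vec (v i)) (hj : Poly F fun i => nat (j i)) :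
    Poly F fun i => v i (j i) :=
  (getElem (l := fun i => List.ofFn (v i)) (k := fun i => j i) (fun i => by simp) h hj).congr
    fun i => by simp

theorem get₂ {x : ∀ i, Fin (n i) → Fin (n i) → ℚ} {u w : ∀ i, Fin (n i)}
    (h : Poly F fun i => mat (x i)) (hu : Poly F fun i => nat (u i))
    (hw : Poly F fun i => nat (w i)) : Poly F fun i => atom (x i (u i) (w i)) :=
  (get (v := fun i w => atom (x i (u i) w))
    (get (v := fun i u => vec fun w => atom (x i u w)) h hu) hw)

theorem rng_map (hn : Poly F fun i => rng (n i)) :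
    Poly F fun i => ofList ((List.finRange (n i)).map fun j : Fin (n i) => nat j) := by
  simpa only [rng, vec_eq_map] using hn

theorem tab {v : ∀ i, Fin (n i) → Data} (hn : Poly F fun i => rng (n i))
    (hv : ∀ {κ : Type} (E : κ → Data) (r : κ → ι) (j : ∀ k, Fin (n (r k))),
      (∀ {X : ι → Data}, Poly F X → Poly E fun j => X (r j)) →
      Poly E (fun k => nat (j k)) → Poly E fun k => v (r k) (j k)) :
    Poly F fun i => vec (v i) :=
  (map (fun i => List.finRange (n i)) (fun i (j : Fin (n i)) => nat j) v hn.rng_map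
    (fun E r a _ wk ha => hv E r a wk ha)).congr fun i => by rw [vec_eq_map]

theorem tab₂ {x : ∀ i, Fin (n i) → Fin (n i) → ℚ} (hn : Poly F fun i => rng (n i))
    (hx : ∀ {κ : Type} (E : κ → Data) (r : κ → ι) (u w : ∀ k, Fin (n (r k))),
      (∀ {X : ι → Data}, Poly F X → Poly E fun j => X (r j)) →
      Poly E (fun k => nat (u k)) → Poly E (fun k => nat (w k)) →
      Poly E fun k => atom (x (r k) (u k) (w k))) :
    Poly F fun i => mat (x i) :=
  tab hn fun _ r u wk hu => tab (wk hn) fun E' r' w wk' hw =>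
    hx E' (fun k => r (r' k)) (fun k => u (r' k)) w (fun hX => wk' (wk hX)) (wk' hu) hw

/-- Partial sums keep the common denominator of the list, and after `k` terms are at most `k` times
its magnitude. -/
theorem list_sum {q : ι → List ℚ} (h : Poly F fun i => ofList ((q i).map atom)) :
    Poly F fun i => atom (q i).sum := by
  set L : ι → Data := fun i => ofList ((q i).map atom) with hL
  have := foldl (F := F) (α := fun _ => ℚ) (σ := fun _ => ℚ) q (fun i s a => s + a) (fun _ => 0)
    (fun _ => atom) (fun _ => atom)
    (fun i k s => s.den ∣ (L i).dens ∧ |s| ≤ k * (L i).mag)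
    (fun i => ⟨by simp, by simp⟩)
    (fun i k s a _ ha hs => by
      have ha' := List.mem_map_of_mem (f := atom) ha
      refine ⟨den_add_dvd hs.1 (dens_dvd_of_mem ha'), (abs_add_le s a).trans ?_⟩
      have h1 := abs_le_natAbs_num a
      have h2 : (a.num.natAbs : ℚ) ≤ (L i).mag := by exact_mod_cast mag_le_of_mem ha'
      push_cast
      linarith [hs.2])
    h (const F 0)
    (fun i => 1 + ((q i).length + (L i).size) + 2 * (L i).size)
    (((PB.const 1).add ((h.size_bound.of_le fun i => by
      simpa using length_le_size ((q i).map atom)).add h.size_bound)).add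
      ((PB.const 2).mul h.size_bound))
    (fun i k s hk hs => by
      have h1 := size_atom_le (B := k * (L i).mag) (L i).dens_ne_zero hs.1
        (by rw [Nat.cast_mul]; exact hs.2)
      have h2 := nat_size_mul_le k (L i).mag
      have h3 := (L i).size_dens_le
      have h4 := (L i).size_mag_le
      have h5 : k.size ≤ k := Nat.size_le.2 Nat.lt_two_pow_self
      omega)
    (fun E r k s a _ _ _ _ ha hs => hs.add ha)
  refine this.congr fun i => ?_
  rw [List.sum_eq_foldl]

theorem sum {q : ∀ i, Fin (n i) → ℚ} (hn : Poly F fun i => rng (n i))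
    (hq : ∀ {κ : Type} (E : κ → Data) (r : κ → ι) (j : ∀ k, Fin (n (r k))),
      (∀ {X : ι → Data}, Poly F X → Poly E fun j => X (r j)) →
      Poly E (fun k => nat (j k)) → Poly E fun k => atom (q (r k) (j k))) :
    Poly F fun i => atom (∑ j, q i j) :=
  (list_sum (q := fun i => List.ofFn (q i)) ((tab hn hq).congr fun i => by
    rw [vec, List.map_ofFn])).congr fun i => by rw [List.sum_ofFn]

end Poly

namespace PolyDec

variable {ι : Type} {F : ι → Data}

theorem list_exists {α : ι → Type} {P : ∀ i, α i → Prop} (l : ∀ i, List (α i))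
    (eα : ∀ i, α i → Data) (hl : Poly F fun i => ofList ((l i).map (eα i)))
    (hP : ∀ {κ : Type} (E : κ → Data) (r : κ → ι) (a : ∀ j, α (r j)), (∀ j, a j ∈ l (r j)) →
      (∀ {X : ι → Data}, Poly F X → Poly E fun j => X (r j)) →
      Poly E (fun j => eα (r j) (a j)) → PolyDec E fun j => P (r j) (a j)) :
    PolyDec F fun i => ∃ a ∈ l i, P i a := by
  classical
  have := Poly.foldl (F := F) (α := α) (σ := fun _ => Prop) l
    (fun i s a => s ∨ P i a) (fun _ => False) eα (fun _ s => atom (if s then 1 else 0))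
    (fun i k s => True) (fun i => trivial) (fun i k s a _ _ _ => trivial)
    hl (by simpa using Poly.const F 0) (fun _ => 3) (PB.const 3)
    (fun i k s _ _ => by split_ifs <;> simp [Data.size])
    (fun E r k s a _ ha _ wk ha' hs => by
      exact (PolyDec.ofPoly (P := s) hs).or (hP E r a ha wk ha'))
  refine PolyDec.congr (PolyDec.ofPoly this) fun i => ?_
  have aux : ∀ (L : List (α i)) (s : Prop),
      List.foldl (fun s a => s ∨ P i a) s L ↔ s ∨ ∃ a ∈ L, P i a := by
    intro L
    induction L with
    | nil => simp
    | cons a L ih => intro s; simp [ih, or_assoc]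
  simpa using aux (l i) False

theorem fin_exists {n : ι → ℕ} {P : ∀ i, Fin (n i) → Prop} (hn : Poly F fun i => rng (n i))
    (hP : ∀ {κ : Type} (E : κ → Data) (r : κ → ι) (j : ∀ k, Fin (n (r k))),
      (∀ {X : ι → Data}, Poly F X → Poly E fun j => X (r j)) →
      Poly E (fun k => nat (j k)) → PolyDec E fun k => P (r k) (j k)) :
    PolyDec F fun i => ∃ j, P i j :=
  (list_exists (fun i => List.finRange (n i)) (fun i (j : Fin (n i)) => nat j) hn.rng_map
    (fun E r a _ wk ha => hP E r a wk ha)).congr fun i => by simp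

theorem fin_forall {n : ι → ℕ} {P : ∀ i, Fin (n i) → Prop} (hn : Poly F fun i => rng (n i))
    (hP : ∀ {κ : Type} (E : κ → Data) (r : κ → ι) (j : ∀ k, Fin (n (r k))),
      (∀ {X : ι → Data}, Poly F X → Poly E fun j => X (r j)) →
      Poly E (fun k => nat (j k)) → PolyDec E fun k => P (r k) (j k)) :
    PolyDec F fun i => ∀ j, P i j :=
  (fin_exists (P := fun i j => ¬ P i j) hn fun E r j wk hj => (hP E r j wk hj).not).not.congr
    fun i => by simp

end PolyDec

end Machine

namespace PCTSP

/-! ### Cuts and splitting off -/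

section Splitting

variable {V K : Type*} [Fintype V] [DecidableEq V] [Field K] [LinearOrder K]
  [IsStrictOrderedRing K]

/-- The total value of the pairs that leave `S`. -/
def cutv (x : V → V → K) (S : Finset V) : K := ∑ a ∈ S, ∑ b ∈ Sᶜ, x a b

/-- Whether `S` separates `a` from `b`, as a number. -/
def crossing (K : Type*) [Field K] (S : Finset V) (a b : V) : K := if a ∈ S ↔ b ∈ S then 0 else 1

/-- The adjacency matrix of the single edge `uw`. -/
def edgeInd (K : Type*) [Field K] (u w a b : V) : K :=
  if (a = u ∧ b = w) ∨ (a = w ∧ b = u) then 1 else 0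

/-- Replace the edges `uv` and `wv` by `uw`, to the extent of `α`. -/
def split (x : V → V → K) (v u w : V) (α : K) : V → V → K := fun a b =>
  x a b + α * (edgeInd K u w a b - edgeInd K u v a b - edgeInd K w v a b)

theorem edgeInd_comm (u w a b : V) : edgeInd K u w a b = edgeInd K u w b a := by
  unfold edgeInd
  congr 1
  exact propext ⟨by tauto, by tauto⟩

theorem edgeInd_eq {u w : V} (h : u ≠ w) (a b : V) :
    edgeInd K u w a b = (if a = u then if b = w then 1 else 0 else 0) +
      (if a = w then if b = u then 1 else 0 else 0) := by
  unfold edgeInd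
  by_cases h1 : a = u <;> by_cases h2 : a = w <;> by_cases h3 : b = u <;> by_cases h4 : b = w <;>
    simp_all

theorem sum_edgeInd {u w : V} (h : u ≠ w) (a : V) :
    ∑ b, edgeInd K u w a b = (if a = u then 1 else 0) + if a = w then 1 else 0 := by
  simp only [edgeInd_eq h, Finset.sum_add_distrib]
  by_cases h1 : a = u <;> by_cases h2 : a = w <;> simp [h1, h2]

theorem cutv_eq (x : V → V → K) (S : Finset V) :
    cutv x S = ∑ a, ∑ b, if a ∈ S ∧ b ∉ S then x a b else 0 := by
  unfold cutv
  rw [← Finset.sum_filter_add_sum_filter_not Finset.univ (· ∈ S)]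
  rw [Finset.sum_eq_zero (s := Finset.univ.filter fun a => a ∉ S), add_zero]
  · rw [Finset.filter_mem_eq_inter, Finset.univ_inter]
    refine Finset.sum_congr rfl fun a ha => ?_
    rw [← Finset.sum_filter]
    refine Finset.sum_congr ?_ fun _ _ => rfl
    ext b
    simp [ha]
  · intro a ha
    simp only [Finset.mem_filter] at ha
    simp [ha.2]

/-- Counting every edge from both ends turns a cut into a sum over all ordered pairs with a
symmetric indicator, so inequalities between cuts can be checked pair by pair. -/
theorem two_mul_cutv {x : V → V → K} (hx : ∀ a b, x a b = x b a) (S : Finset V) :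
    2 * cutv x S = ∑ a, ∑ b, x a b * crossing K S a b := by
  have h1 : cutv x S = ∑ a, ∑ b, if a ∉ S ∧ b ∈ S then x a b else 0 := by
    rw [cutv_eq, Finset.sum_comm]
    refine Finset.sum_congr rfl fun a _ => Finset.sum_congr rfl fun b _ => ?_
    rw [hx b a]
    congr 1
    exact propext and_comm
  rw [two_mul]
  nth_rewrite 1 [cutv_eq]
  rw [h1, ← Finset.sum_add_distrib]
  refine Finset.sum_congr rfl fun a _ => ?_
  rw [← Finset.sum_add_distrib]
  refine Finset.sum_congr rfl fun b _ => ?_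
  unfold crossing
  by_cases ha : a ∈ S <;> by_cases hb : b ∈ S <;> simp [ha, hb]

theorem cutv_compl {x : V → V → K} (hx : ∀ a b, x a b = x b a) (S : Finset V) :
    cutv x Sᶜ = cutv x S := by
  unfold cutv
  rw [compl_compl, Finset.sum_comm]
  exact Finset.sum_congr rfl fun a _ => Finset.sum_congr rfl fun b _ => hx _ _

theorem cutv_nonneg {x : V → V → K} (hx : ∀ a b, 0 ≤ x a b) (S : Finset V) : 0 ≤ cutv x S :=
  Finset.sum_nonneg fun _ _ => Finset.sum_nonneg fun _ _ => hx _ _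

theorem cutv_singleton {x : V → V → K} (hx : ∀ a, x a a = 0) (u : V) :
    cutv x {u} = ∑ b, x u b := by
  unfold cutv
  rw [Finset.sum_singleton, ← Finset.sum_compl_add_sum {u}]
  simp [hx]

theorem cutv_edgeInd {u w : V} (h : u ≠ w) (S : Finset V) :
    cutv (edgeInd K u w) S = crossing K S u w := by
  unfold cutv crossing
  simp only [edgeInd_eq h, Finset.sum_add_distrib]
  by_cases h1 : u ∈ S <;> by_cases h2 : w ∈ S <;> simp [Finset.sum_ite_eq', h1, h2]

theorem cutv_split {v u w : V} (huw : u ≠ w) (huv : u ≠ v) (hwv : w ≠ v) (x : V → V → K) (α : K)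
    (S : Finset V) : cutv (split x v u w α) S =
      cutv x S + α * (crossing K S u w - crossing K S u v - crossing K S w v) := by
  rw [← cutv_edgeInd huw, ← cutv_edgeInd huv, ← cutv_edgeInd hwv]
  unfold cutv split
  simp only [Finset.sum_add_distrib, Finset.sum_sub_distrib, ← Finset.mul_sum]

/-- A splitting at `v` affects only the cuts that have `u` and `w` on one side and `v` on the other;
these lose twice the amount. -/
theorem crossing_eq (S : Finset V) (u w v : V) :
    (crossing K S u w - crossing K S u v - crossing K S w v = -2 ∧ (u ∈ S ↔ w ∈ S) ∧
      ¬ (u ∈ S ↔ v ∈ S)) ∨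
    (crossing K S u w - crossing K S u v - crossing K S w v = 0) := by
  unfold crossing
  by_cases h1 : u ∈ S <;> by_cases h2 : w ∈ S <;> by_cases h3 : v ∈ S <;> simp [h1, h2, h3] <;>
    norm_num

/-- The vertices `u` and `w` lose one edge and gain another; only `v` loses degree. -/
theorem sum_split {v u w : V} (huw : u ≠ w) (huv : u ≠ v) (hwv : w ≠ v) (x : V → V → K) (α : K)
    (a : V) : ∑ b, split x v u w α a b = ∑ b, x a b - 2 * α * if a = v then 1 else 0 := by
  unfold split
  rw [Finset.sum_add_distrib, ← Finset.mul_sum, Finset.sum_sub_distrib, Finset.sum_sub_distrib,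
    sum_edgeInd huw, sum_edgeInd huv, sum_edgeInd hwv]
  ring

/-- Submodularity, checked pair by pair. -/
theorem cutv_inter_union_le {x : V → V → K} (hs : ∀ a b, x a b = x b a) (hx : ∀ a b, 0 ≤ x a b)
    (X Y : Finset V) : cutv x (X ∩ Y) + cutv x (X ∪ Y) ≤ cutv x X + cutv x Y := by
  have : 2 * cutv x (X ∩ Y) + 2 * cutv x (X ∪ Y) ≤ 2 * cutv x X + 2 * cutv x Y := by
    simp only [two_mul_cutv hs, ← Finset.sum_add_distrib]
    refine Finset.sum_le_sum fun a _ => Finset.sum_le_sum fun b _ => ?_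
    have := hx a b
    unfold crossing
    by_cases h1 : a ∈ X <;> by_cases h2 : b ∈ X <;> by_cases h3 : a ∈ Y <;> by_cases h4 : b ∈ Y <;>
      simp [h1, h2, h3, h4] <;> linarith
  linarith

/-- The difference form of uncrossing. The edge `uv` joins the intersection to the outside of the
union: it counts in both cuts on the right and in neither on the left, whence the gain. -/
theorem cutv_sdiff_le {x : V → V → K} (hs : ∀ a b, x a b = x b a) (hx : ∀ a b, 0 ≤ x a b)
    {X Y : Finset V} {u v : V} (hX : u ∈ X) (hY : u ∈ Y) (hvX : v ∉ X) (hvY : v ∉ Y) :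
    cutv x (X \ Y) + cutv x (Y \ X) + 2 * x u v ≤ cutv x X + cutv x Y := by
  have huv : u ≠ v := fun h => hvX (h ▸ hX)
  have e : 2 * x u v = ∑ a, ∑ b, x a b * edgeInd K u v a b := by
    simp only [edgeInd_eq huv, mul_add, Finset.sum_add_distrib, mul_ite, mul_one, mul_zero]
    rw [Finset.sum_comm, Finset.sum_comm (f := fun a b => if a = v then _ else _)]
    simp [hs v u, two_mul]
  have : 2 * cutv x (X \ Y) + 2 * cutv x (Y \ X) + 2 * (2 * x u v) ≤
      2 * cutv x X + 2 * cutv x Y := by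
    rw [e, Finset.mul_sum]
    simp only [two_mul_cutv hs, ← Finset.sum_add_distrib, Finset.mul_sum]
    refine Finset.sum_le_sum fun a _ => Finset.sum_le_sum fun b _ => ?_
    have := hx a b
    unfold crossing
    by_cases h : (a = u ∧ b = v) ∨ (a = v ∧ b = u)
    · rw [edgeInd, if_pos h]
      rcases h with ⟨rfl, rfl⟩ | ⟨rfl, rfl⟩ <;> simp [hX, hY, hvX, hvY] <;> linarith
    · rw [edgeInd, if_neg h]
      by_cases h1 : a ∈ X <;> by_cases h2 : b ∈ X <;> by_cases h3 : a ∈ Y <;>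
        by_cases h4 : b ∈ Y <;> simp [h1, h2, h3, h4] <;> linarith
  linarith

/-- Feasibility of symmetric edge values `x`, where vertices `u` with `y u < 0` carry no
requirement. -/
structure Feas (r : V) (x : V → V → K) (y : V → K) : Prop where
  symm : ∀ a b, x a b = x b a
  diag : ∀ a, x a a = 0
  nonneg : ∀ a b, 0 ≤ x a b
  deg : ∀ u, u ≠ r → 0 ≤ y u → ∑ b, x u b = 2 * y u
  deg_le : ∀ u, ∑ b, x u b ≤ 2
  cut : ∀ S z, r ∉ S → z ∈ S → 2 * y z ≤ cutv x S

namespace Feas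

variable {r : V} {x : V → V → K} {y : V → K}

/-- By symmetry of cuts only the separation of `z` from the root matters, not on which side the root
lies. This lets tight sets be replaced by their complements. -/
theorem cut_of_sep (h : Feas r x y) {S : Finset V} {z : V} (hz : z ∈ S ↔ r ∉ S) :
    2 * y z ≤ cutv x S := by
  by_cases hr : r ∈ S
  · rw [← cutv_compl h.symm]
    exact h.cut _ _ (by simpa using hr) (by rw [Finset.mem_compl]; tauto)
  · exact h.cut _ _ hr (hz.2 hr)

/-- Tight sets that contain a common neighbour of a vertex outside are closed under unions. -/
theorem tight_union (h : Feas r x y) {X Y : Finset V} {u v z₁ z₂ : V} (hX : u ∈ X) (hY : u ∈ Y)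
    (hvX : v ∉ X) (hvY : v ∉ Y) (huv : 0 < x u v) (h₁ : z₁ ∈ X ↔ r ∉ X) (h₂ : z₂ ∈ Y ↔ r ∉ Y)
    (t₁ : cutv x X = 2 * y z₁) (t₂ : cutv x Y = 2 * y z₂) :
    ∃ z, (z ∈ X ∪ Y ↔ r ∉ X ∪ Y) ∧ cutv x (X ∪ Y) = 2 * y z := by
  have hA := cutv_inter_union_le h.symm h.nonneg X Y
  have hB := cutv_sdiff_le h.symm h.nonneg hX hY hvX hvY
  -- Wherever `z₁`, `z₂` and `r` lie, one of the two uncrossings produces two sets that separate the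
  -- two vertices from the root again.
  have key : ((z₁ ∈ X ∩ Y ↔ r ∉ X ∩ Y) ∧ (z₂ ∈ X ∪ Y ↔ r ∉ X ∪ Y)) ∨
      ((z₂ ∈ X ∩ Y ↔ r ∉ X ∩ Y) ∧ (z₁ ∈ X ∪ Y ↔ r ∉ X ∪ Y)) ∨
      ((z₁ ∈ X \ Y ↔ r ∉ X \ Y) ∧ (z₂ ∈ Y \ X ↔ r ∉ Y \ X)) ∨
      ((z₂ ∈ X \ Y ↔ r ∉ X \ Y) ∧ (z₁ ∈ Y \ X ↔ r ∉ Y \ X)) := by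
    simp only [Finset.mem_inter, Finset.mem_union, Finset.mem_sdiff]
    by_cases a1 : z₁ ∈ X <;> by_cases a2 : z₁ ∈ Y <;> by_cases a3 : z₂ ∈ X <;>
      by_cases a4 : z₂ ∈ Y <;> by_cases a5 : r ∈ X <;> by_cases a6 : r ∈ Y <;> simp_all
  rcases key with ⟨k1, k2⟩ | ⟨k1, k2⟩ | ⟨k1, k2⟩ | ⟨k1, k2⟩
  · exact ⟨z₂, k2, by linarith [h.cut_of_sep k1, h.cut_of_sep k2]⟩
  · exact ⟨z₁, k2, by linarith [h.cut_of_sep k1, h.cut_of_sep k2]⟩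
  -- The difference form is impossible for tight sets, since it would gain `2 * x u v > 0`.
  · linarith [h.cut_of_sep k1, h.cut_of_sep k2]
  · linarith [h.cut_of_sep k1, h.cut_of_sep k2]

end Feas

/-- The pair `uw` cannot be split off at `v` any further. -/
def Blocked (r : V) (x : V → V → K) (y : V → K) (v u w : V) : Prop :=
  x u v = 0 ∨ x w v = 0 ∨ ∃ S z, r ∉ S ∧ z ∈ S ∧ cutv x S = 2 * y z ∧ (u ∈ S ↔ w ∈ S) ∧
    ¬ (u ∈ S ↔ v ∈ S)

/-- Passing to the complement if necessary puts `u` and `w` inside and `v` outside. -/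
theorem exists_side {x : V → V → K} (hs : ∀ a b, x a b = x b a) {S : Finset V} {r z u w v : V}
    {c : K} (hr : r ∉ S) (hz : z ∈ S) (ht : cutv x S = c) (h1 : u ∈ S ↔ w ∈ S)
    (h2 : ¬ (u ∈ S ↔ v ∈ S)) :
    ∃ Y z', v ∉ Y ∧ u ∈ Y ∧ w ∈ Y ∧ (z' ∈ Y ↔ r ∉ Y) ∧ cutv x Y = c ∧ z' = z := by
  by_cases hu : u ∈ S
  · exact ⟨S, z, fun hv => h2 ⟨fun _ => hv, fun _ => hu⟩, hu, h1.1 hu, by simp [hr, hz], ht, rfl⟩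
  · have hv : v ∈ S := by
      by_contra hv
      exact h2 ⟨fun h => absurd h hu, fun h => absurd h hv⟩
    refine ⟨Sᶜ, z, by simpa using hv, by simpa using hu, ?_, by simp [hr, hz], ?_, rfl⟩
    · simpa using fun h => hu (h1.2 h)
    · rw [cutv_compl hs, ht]

/-- When no pair can be split off any more, `v` is not joined to vertices other than the root. -/
theorem Feas.eq_zero_of_blocked {r : V} {x : V → V → K} {y : V → K} (h : Feas r x y) {v : V}
    (hvr : v ≠ r) (hv : y v < 0) (hdead : ∀ u, u ≠ v → y u < 0 → ∀ w, x u w = 0)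
    (hb : ∀ u w, u ≠ w → u ≠ v → w ≠ v → Blocked r x y v u w) {u : V} (hur : u ≠ r) :
    x u v = 0 := by
  by_contra hne
  have hpos : 0 < x u v := lt_of_le_of_ne (h.nonneg _ _) (Ne.symm hne)
  have huv : u ≠ v := fun e => hne (by rw [e, h.diag])
  have hyu : 0 ≤ y u := by
    by_contra hlt
    exact hne (hdead u huv (not_le.1 hlt) v)
  -- The tight sets of the blocked pairs are united one neighbour of `v` at a time, starting from
  -- `{u}`. This set is tight by the degree equation, which is where `u ≠ r` enters.
  have key : ∀ W : Finset V, (∀ w ∈ W, 0 < x w v) → ∃ X z, v ∉ X ∧ u ∈ X ∧ W ⊆ X ∧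
      (z ∈ X ↔ r ∉ X) ∧ cutv x X = 2 * y z := by
    intro W
    induction W using Finset.induction_on with
    | empty =>
      intro _
      exact ⟨{u}, u, by simpa using huv.symm, by simp, by simp, by simpa using hur.symm,
        by rw [cutv_singleton h.diag, h.deg u hur hyu]⟩
    | insert w W _ ih =>
      intro hW
      obtain ⟨X, z, hvX, huX, hWX, hz, ht⟩ := ih fun a ha => hW a (Finset.mem_insert_of_mem ha)
      by_cases hw : w = u
      · exact ⟨X, z, hvX, huX, Finset.insert_subset (hw ▸ huX) hWX, hz, ht⟩
      have hwpos := hW w (Finset.mem_insert_self _ _)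
      have hwv : w ≠ v := fun e => by rw [e, h.diag] at hwpos; exact lt_irrefl _ hwpos
      have : ∃ Y z', v ∉ Y ∧ u ∈ Y ∧ w ∈ Y ∧ (z' ∈ Y ↔ r ∉ Y) ∧ cutv x Y = 2 * y z' := by
        rcases hb u w (Ne.symm hw) huv hwv with h0 | h0 | ⟨S, z', hr, hz', ht', h1, h2⟩
        · exact absurd h0 hne
        · exact absurd h0 hwpos.ne'
        · obtain ⟨Y, _, k1, k2, k3, k4, k5, rfl⟩ := exists_side h.symm hr hz' ht' h1 h2
          exact ⟨Y, _, k1, k2, k3, k4, k5⟩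
      obtain ⟨Y, z', hvY, huY, hwY, hz', ht'⟩ := this
      obtain ⟨z'', hz'', ht''⟩ := h.tight_union huX huY hvX hvY hpos hz hz' ht ht'
      refine ⟨X ∪ Y, z'', by simp [hvX, hvY], by simp [huX], ?_, hz'', ht''⟩
      exact Finset.insert_subset (by simp [hwY]) (hWX.trans Finset.subset_union_left)
  obtain ⟨X, z, hvX, huX, hWX, hz, ht⟩ := key (Finset.univ.filter fun w => 0 < x w v) (by simp)
  have hzv : z ≠ v := by
    rintro rfl
    have := cutv_nonneg h.nonneg X
    linarith
  -- Adding `v` does not change which of `z` and `r` lie inside, but all edges at `v` end in `X`, so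
  -- the cut drops below that of the tight set `X` by at least `x u v`.
  have h1 : 2 * y z ≤ cutv x (insert v X) := by
    apply h.cut_of_sep
    simp [hzv, hvr.symm, hz]
  have hout : ∀ w, w ∉ X → x w v = 0 := fun w hw => by
    by_contra hc
    exact hw (hWX (by simpa using lt_of_le_of_ne (h.nonneg _ _) (Ne.symm hc)))
  have h2 : cutv x X = ∑ a ∈ X, x a v + ∑ a ∈ X, ∑ b ∈ (insert v X)ᶜ, x a b := by
    unfold cutv
    rw [← Finset.sum_add_distrib]
    refine Finset.sum_congr rfl fun a _ => ?_
    rw [show Xᶜ = insert v (insert v X)ᶜ by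
      ext b
      simp only [Finset.mem_compl, Finset.mem_insert]
      by_cases hb : b = v <;> simp [hb, hvX], Finset.sum_insert (by simp)]
  have h3 : cutv x (insert v X) = ∑ a ∈ X, ∑ b ∈ (insert v X)ᶜ, x a b := by
    unfold cutv
    rw [Finset.sum_insert hvX, Finset.sum_eq_zero, zero_add]
    intro b hb
    rw [h.symm]
    exact hout b (by simp at hb; tauto)
  have h4 : x u v ≤ ∑ a ∈ X, x a v :=
    Finset.single_le_sum (f := fun a => x a v) (fun a _ => h.nonneg a v) huX
  linarith

/-! ### Minimum cuts and the maximal amount of a splitting -/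

/-- The smallest value of a cut that separates `s` from `t`. -/
def mincut (x : V → V → K) (s t : V) : K :=
  if h : (Finset.univ.filter fun S : Finset V => s ∈ S ∧ t ∉ S).Nonempty then
    (Finset.univ.filter fun S : Finset V => s ∈ S ∧ t ∉ S).inf' h (cutv x) else 0

theorem mincut_le (x : V → V → K) {s t : V} {S : Finset V} (hs : s ∈ S) (ht : t ∉ S) :
    mincut x s t ≤ cutv x S := by
  have h : S ∈ Finset.univ.filter fun S : Finset V => s ∈ S ∧ t ∉ S := by simp [hs, ht]
  rw [mincut, dif_pos ⟨S, h⟩]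
  exact Finset.inf'_le _ h

theorem exists_mincut (x : V → V → K) {s t : V} (hst : s ≠ t) :
    ∃ S, s ∈ S ∧ t ∉ S ∧ mincut x s t = cutv x S := by
  have h : (Finset.univ.filter fun S : Finset V => s ∈ S ∧ t ∉ S).Nonempty :=
    ⟨{s}, by simpa using hst.symm⟩
  rw [mincut, dif_pos h]
  obtain ⟨S, hS, he⟩ := Finset.exists_mem_eq_inf' h (cutv x)
  simp only [Finset.mem_filter, Finset.mem_univ, true_and] at hS
  exact ⟨S, hS.1, hS.2, he⟩

/-- By how much the requirement of `z` is violated. -/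
def deficit (r : V) (x : V → V → K) (y : V → K) (z : V) : K :=
  if z = r then 0 else 2 * y z - mincut x z r

/-- The largest violation of a requirement. -/
def maxDeficit (l : List V) (r : V) (x : V → V → K) (y : V → K) : K :=
  l.foldl (fun m z => max m (deficit r x y z)) 0

/-- The largest amount by which the pair `uw` can be split off at `v`. -/
def splitAmount (l : List V) (r : V) (x : V → V → K) (y : V → K) (v u w : V) : K :=
  min (x u v) (x w v) - maxDeficit l r (split x v u w (min (x u v) (x w v))) y / 2

theorem foldl_max_spec (l : List V) (f : V → K) (m : K) :
    m ≤ l.foldl (fun m z => max m (f z)) m ∧ (∀ z ∈ l, f z ≤ l.foldl (fun m z => max m (f z)) m) ∧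
    (l.foldl (fun m z => max m (f z)) m = m ∨
      ∃ z ∈ l, l.foldl (fun m z => max m (f z)) m = f z) := by
  induction l generalizing m with
  | nil => simp
  | cons a l ih =>
    obtain ⟨h1, h2, h3⟩ := ih (max m (f a))
    simp only [List.foldl_cons, List.mem_cons, forall_eq_or_imp, exists_eq_or_imp]
    refine ⟨(le_max_left _ _).trans h1, ⟨(le_max_right _ _).trans h1, h2⟩, ?_⟩
    rcases h3 with h3 | h3
    · rcases max_choice m (f a) with h4 | h4
      · exact .inl (h3.trans h4)
      · exact .inr (.inl (h3.trans h4))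
    · exact .inr (.inr h3)

theorem split_symm {x : V → V → K} (hx : ∀ a b, x a b = x b a) (v u w : V) (α : K) (a b : V) :
    split x v u w α a b = split x v u w α b a := by
  unfold split
  rw [hx a b, edgeInd_comm u w a b, edgeInd_comm u v a b, edgeInd_comm w v a b]

theorem split_diag {v u w : V} (huw : u ≠ w) (huv : u ≠ v) (hwv : w ≠ v) {x : V → V → K}
    (hx : ∀ a, x a a = 0) (α : K) (a : V) : split x v u w α a a = 0 := by
  have : ∀ b c : V, b ≠ c → edgeInd K b c a a = 0 := fun b c h => by
    rw [edgeInd, if_neg]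
    rintro (⟨rfl, h'⟩ | ⟨rfl, h'⟩) <;> exact h (by simp [h'])
  simp [split, hx, this u w huw, this u v huv, this w v hwv]

theorem split_nonneg {v u w : V} {x : V → V → K} (hs : ∀ a b, x a b = x b a)
    (hx : ∀ a b, 0 ≤ x a b) {α : K} (h0 : 0 ≤ α) (h1 : α ≤ x u v) (h2 : α ≤ x w v) (huw : u ≠ w)
    (a b : V) : 0 ≤ split x v u w α a b := by
  have := hx a b
  unfold split edgeInd
  by_cases h3 : (a = u ∧ b = v) ∨ (a = v ∧ b = u)
  · have e : x a b = x u v := by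
      rcases h3 with ⟨rfl, rfl⟩ | ⟨rfl, rfl⟩
      · rfl
      · exact hs _ _
    have h4 : ¬ ((a = w ∧ b = v) ∨ (a = v ∧ b = w)) := by
      rintro (⟨rfl, rfl⟩ | ⟨rfl, rfl⟩) <;> rcases h3 with ⟨h, h'⟩ | ⟨h, h'⟩ <;> subst_vars <;>
        exact huw rfl
    rw [if_pos h3, if_neg h4, e]
    split_ifs <;> linarith
  · by_cases h4 : (a = w ∧ b = v) ∨ (a = v ∧ b = w)
    · have e : x a b = x w v := by
        rcases h4 with ⟨rfl, rfl⟩ | ⟨rfl, rfl⟩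
        · rfl
        · exact hs _ _
      rw [if_neg h3, if_pos h4, e]
      split_ifs <;> linarith
    · rw [if_neg h3, if_neg h4]
      split_ifs <;> linarith

section Amount

variable {l : List V} {r : V} {x : V → V → K} {y : V → K} {v u w : V}

/-- Splitting off the whole amount `a₀` violates requirements by at most `M`, and only at cuts that
lost `2 * a₀`. Giving back `M / 2` raises exactly these cuts by `M`. If `M = 0`, one of the two
edges has been used up; otherwise the most violated cut has become tight. In both cases the pair is
blocked. -/
theorem splitAmount_spec (hl : ∀ a, a ∈ l) (h : Feas r x y) (huw : u ≠ w) (huv : u ≠ v)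
    (hwv : w ≠ v) (hyv : y v < 0) :
    0 ≤ splitAmount l r x y v u w ∧ splitAmount l r x y v u w ≤ x u v ∧
    splitAmount l r x y v u w ≤ x w v ∧
    Feas r (split x v u w (splitAmount l r x y v u w)) y ∧
    Blocked r (split x v u w (splitAmount l r x y v u w)) y v u w := by
  set a₀ := min (x u v) (x w v) with ha₀
  set M := maxDeficit l r (split x v u w a₀) y with hM
  have hα : splitAmount l r x y v u w = a₀ - M / 2 := rfl
  rw [hα]
  obtain ⟨hM0, hMz, hMe⟩ := foldl_max_spec l (deficit r (split x v u w a₀) y) 0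
  change 0 ≤ M at hM0
  change ∀ z ∈ l, _ ≤ M at hMz
  change M = 0 ∨ ∃ z ∈ l, M = _ at hMe
  have ha0 : 0 ≤ a₀ := le_min (h.nonneg _ _) (h.nonneg _ _)
  have hle : ∀ S z, r ∉ S → z ∈ S → 2 * y z - M ≤ cutv (split x v u w a₀) S := by
    intro S z hr hz
    have h1 := hMz z (hl z)
    rw [deficit, if_neg (fun e : z = r => hr (e ▸ hz))] at h1
    have := mincut_le (split x v u w a₀) hz hr
    linarith
  have hM' : M = 0 ∨ ∃ S z, r ∉ S ∧ z ∈ S ∧ M = 2 * y z - cutv (split x v u w a₀) S := by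
    rcases hMe with h1 | ⟨z, _, h1⟩
    · exact .inl h1
    · by_cases hz : z = r
      · rw [deficit, if_pos hz] at h1
        exact .inl h1
      · rw [deficit, if_neg hz] at h1
        obtain ⟨S, hzS, hrS, e⟩ := exists_mincut (split x v u w a₀) hz
        exact .inr ⟨S, z, hrS, hzS, by rw [h1, e]⟩
  have hcut : ∀ S, cutv (split x v u w (a₀ - M / 2)) S = cutv (split x v u w a₀) S -
      M / 2 * (crossing K S u w - crossing K S u v - crossing K S w v) := by
    intro S
    rw [cutv_split huw huv hwv, cutv_split huw huv hwv]
    ring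
  -- The most violated cut satisfied its requirement before it lost `2 * a₀`, so `M ≤ 2 * a₀`.
  have hMa : M / 2 ≤ a₀ := by
    rcases hM' with h1 | ⟨S, z, hr, hz, h1⟩
    · rw [h1]; simpa using ha0
    · have h2 := h.cut S z hr hz
      rw [cutv_split huw huv hwv] at h1
      rcases crossing_eq (K := K) S u w v with ⟨h3, _⟩ | h3 <;> rw [h3] at h1 <;> linarith
  have b0 : 0 ≤ a₀ - M / 2 := by linarith
  have b1 : a₀ - M / 2 ≤ x u v := by
    have := min_le_left (x u v) (x w v); linarith
  have b2 : a₀ - M / 2 ≤ x w v := by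
    have := min_le_right (x u v) (x w v); linarith
  refine ⟨b0, b1, b2, ⟨split_symm h.symm v u w _, split_diag huw huv hwv h.diag _,
    split_nonneg h.symm h.nonneg b0 b1 b2 huw, ?_, ?_, ?_⟩, ?_⟩
  · intro a har ha
    rw [sum_split huw huv hwv, if_neg (fun e => by rw [e] at ha; linarith), h.deg a har ha]
    ring
  · intro a
    rw [sum_split huw huv hwv]
    have := h.deg_le a
    split_ifs <;> linarith
  · intro S z hr hz
    have h1 := hle S z hr hz
    rw [hcut]
    rcases crossing_eq (K := K) S u w v with ⟨h3, _⟩ | h3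
    · rw [h3]; linarith
    · have h2 := h.cut S z hr hz
      rw [cutv_split huw huv hwv, h3]
      linarith
  · rcases hM' with h1 | ⟨S, z, hr, hz, h1⟩
    · have e1 : split x v u w (a₀ - M / 2) u v = x u v - a₀ := by
        simp [split, edgeInd, h1, huv, hwv.symm, huw, sub_eq_add_neg]
      have e2 : split x v u w (a₀ - M / 2) w v = x w v - a₀ := by
        simp [split, edgeInd, h1, huv.symm, hwv, huw.symm, sub_eq_add_neg]
      rcases min_choice (x u v) (x w v) with h2 | h2
      · exact .inl (by rw [e1, ha₀, h2, sub_self])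
      · exact .inr (.inl (by rw [e2, ha₀, h2, sub_self]))
    · rcases crossing_eq (K := K) S u w v with ⟨h3, h4, h5⟩ | h3
      · refine .inr (.inr ⟨S, z, hr, hz, ?_, h4, h5⟩)
        rw [hcut, h3, h1]
        ring
      · have h2 := h.cut S z hr hz
        have h4 : M = 0 := by
          rw [cutv_split huw huv hwv, h3] at h1
          linarith
        have e1 : split x v u w (a₀ - M / 2) u v = x u v - a₀ := by
          simp [split, edgeInd, h4, huv, hwv.symm, huw, sub_eq_add_neg]
        have e2 : split x v u w (a₀ - M / 2) w v = x w v - a₀ := by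
          simp [split, edgeInd, h4, huv.symm, hwv, huw.symm, sub_eq_add_neg]
        rcases min_choice (x u v) (x w v) with h2 | h2
        · exact .inl (by rw [e1, ha₀, h2, sub_self])
        · exact .inr (.inl (by rw [e2, ha₀, h2, sub_self]))

/-- Splitting off keeps blocked pairs blocked. -/
theorem Blocked.split {a b : V} {α : K} (hb : Blocked r x y v a b) (hα : 0 ≤ α)
    (h : Feas r (split x v u w α) y) (huw : u ≠ w) (huv : u ≠ v) (hwv : w ≠ v) :
    Blocked r (PCTSP.split x v u w α) y v a b := by
  have hle : ∀ c, PCTSP.split x v u w α c v ≤ x c v := by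
    intro c
    have h1 : edgeInd K u w c v = 0 := by
      rw [edgeInd, if_neg]
      rintro (⟨_, h'⟩ | ⟨_, h'⟩)
      · exact hwv h'.symm
      · exact huv h'.symm
    have h2 : ∀ p q : V, 0 ≤ edgeInd K p q c v := fun p q => by
      unfold edgeInd
      split_ifs <;> simp
    rw [PCTSP.split, h1]
    nlinarith [mul_nonneg hα (h2 u v), mul_nonneg hα (h2 w v)]
  rcases hb with h0 | h0 | ⟨S, z, hr, hz, ht, h1, h2⟩
  · exact .inl (le_antisymm (h0 ▸ hle a) (h.nonneg _ _))
  · exact .inr (.inl (le_antisymm (h0 ▸ hle b) (h.nonneg _ _)))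
  -- Splitting never raises a cut, and feasibility keeps it from falling below the requirement, so
  -- tight sets stay tight.
  · refine .inr (.inr ⟨S, z, hr, hz, le_antisymm ?_ (h.cut S z hr hz), h1, h2⟩)
    rw [cutv_split huw huv hwv, ht]
    rcases crossing_eq (K := K) S u w v with ⟨h3, _⟩ | h3 <;> rw [h3] <;> linarith

end Amount

end Splitting

end PCTSP

namespace PCTSP

/-! ### Elimination of all vertices except the root -/

section Elimination

variable {V K : Type*} [Fintype V] [DecidableEq V] [Field K] [LinearOrder K]
  [IsStrictOrderedRing K]

/-- All pairs of elements of `l`. -/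
def pairs {V : Type*} (l : List V) : List (V × V) := l.flatMap fun u => l.map fun w => (u, w)

theorem mem_pairs {V : Type*} {l : List V} {u w : V} (hu : u ∈ l) (hw : w ∈ l) :
    (u, w) ∈ pairs l :=
  List.mem_flatMap.2 ⟨u, hu, List.mem_map_of_mem hw⟩

/-- Split off one pair at `v` as far as possible and record the values before. -/
def splitStep (l : List V) (r : V) (y : V → K) (v : V)
    (s : (V → V → K) × List (V × V × (V → V → K))) (p : V × V) :
    (V → V → K) × List (V × V × (V → V → K)) :=
  if p.1 = p.2 ∨ p.1 = v ∨ p.2 = v then s else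
    (split s.1 v p.1 p.2 (splitAmount l r s.1 y v p.1 p.2), (p.1, p.2, s.1) :: s.2)

/-- Split off all pairs at `v`. -/
def splitAll (l : List V) (r : V) (y : V → K) (v : V) (x : V → V → K) :
    (V → V → K) × List (V × V × (V → V → K)) :=
  (pairs l).foldl (splitStep l r y v) (x, [])

/-- Remove all edges at `v`. -/
def isolate (v : V) (x : V → V → K) : V → V → K := fun a b => if a = v ∨ b = v then 0 else x a b

/-- `SplitChain v x₀ recs x`: the values `x` arise from `x₀` by splitting off at `v` the pairs
recorded in `recs`, the last one first. -/
inductive SplitChain (v : V) (x₀ : V → V → K) :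
    List (V × V × (V → V → K)) → (V → V → K) → Prop
  | nil : SplitChain v x₀ [] x₀
  | cons {recs : List (V × V × (V → V → K))} {x : V → V → K} {u w : V} {α : K} :
      SplitChain v x₀ recs x → u ≠ w → u ≠ v → w ≠ v → 0 ≤ α → (∀ a b, 0 ≤ x a b) →
      (∀ a b, x a b = x b a) → SplitChain v x₀ ((u, w, x) :: recs) (split x v u w α)

/-- A vertex without edges can take part only in splittings of amount `0`. Hence eliminated vertices
stay isolated. -/
theorem split_row_eq_zero {x : V → V → K} {v u w : V} {α : K} (h0 : 0 ≤ α) (h1 : α ≤ x u v)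
    (h2 : α ≤ x w v) {a : V} (ha : a ≠ v) (hx : ∀ b, x a b = 0) (b : V) :
    split x v u w α a b = 0 := by
  by_cases hu : a = u ∨ a = w
  · have : α = 0 := by
      rcases hu with rfl | rfl
      · exact le_antisymm (hx v ▸ h1) h0
      · exact le_antisymm (hx v ▸ h2) h0
    simp [split, this, hx]
  · push Not at hu
    simp [split, edgeInd, hx, ha, hu.1, hu.2]

/-- One pass over the pairs suffices, because a blocked pair is never released by later splittings.
The pairs in `done` have been treated already. -/
theorem foldl_splitStep_spec {l : List V} {r : V} {y : V → K} {v : V} (hl : ∀ a, a ∈ l)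
    (hyv : y v < 0) {x₀ : V → V → K} (ps done : List (V × V))
    (s : (V → V → K) × List (V × V × (V → V → K))) (hc : SplitChain v x₀ s.2 s.1)
    (hs : Feas r s.1 y) (hdead : ∀ u, u ≠ v → y u < 0 → ∀ w, s.1 u w = 0)
    (hb : ∀ p ∈ done, p.1 ≠ p.2 → p.1 ≠ v → p.2 ≠ v → Blocked r s.1 y v p.1 p.2) :
    SplitChain v x₀ (ps.foldl (splitStep l r y v) s).2 (ps.foldl (splitStep l r y v) s).1 ∧
    Feas r (ps.foldl (splitStep l r y v) s).1 y ∧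
    (∀ u, u ≠ v → y u < 0 → ∀ w, (ps.foldl (splitStep l r y v) s).1 u w = 0) ∧
    ∀ p, p ∈ done ∨ p ∈ ps → p.1 ≠ p.2 → p.1 ≠ v → p.2 ≠ v →
      Blocked r (ps.foldl (splitStep l r y v) s).1 y v p.1 p.2 := by
  induction ps generalizing s done with
  | nil => exact ⟨hc, hs, hdead, fun p hp => hb p (by simpa using hp)⟩
  | cons p ps ih =>
    rw [List.foldl_cons]
    have key : SplitChain v x₀ (splitStep l r y v s p).2 (splitStep l r y v s p).1 ∧
        Feas r (splitStep l r y v s p).1 y ∧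
        (∀ u, u ≠ v → y u < 0 → ∀ w, (splitStep l r y v s p).1 u w = 0) ∧
        ∀ q ∈ p :: done, q.1 ≠ q.2 → q.1 ≠ v → q.2 ≠ v →
          Blocked r (splitStep l r y v s p).1 y v q.1 q.2 := by
      by_cases hp : p.1 = p.2 ∨ p.1 = v ∨ p.2 = v
      · rw [splitStep, if_pos hp]
        refine ⟨hc, hs, hdead, fun q hq h1 h2 h3 => ?_⟩
        rcases List.mem_cons.1 hq with rfl | hq
        · tauto
        · exact hb q hq h1 h2 h3
      · rw [splitStep, if_neg hp]
        push Not at hp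
        obtain ⟨k1, k2, k3⟩ := hp
        obtain ⟨a0, a1, a2, hF, hB⟩ := splitAmount_spec hl hs k1 k2 k3 hyv
        refine ⟨.cons hc k1 k2 k3 a0 hs.nonneg hs.symm, hF,
          fun a ha hya => split_row_eq_zero a0 a1 a2 ha (hdead a ha hya), fun q hq h1 h2 h3 => ?_⟩
        rcases List.mem_cons.1 hq with rfl | hq
        · exact hB
        · exact (hb q hq h1 h2 h3).split a0 hF k1 k2 k3
    obtain ⟨i1, i2, i3, i4⟩ := ih (p :: done) _ key.1 key.2.1 key.2.2.1 key.2.2.2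
    exact ⟨i1, i2, i3, fun q hq => i4 q (by simp only [List.mem_cons] at hq ⊢; tauto)⟩

theorem splitAll_spec {l : List V} {r : V} {x : V → V → K} {y : V → K} {v : V}
    (hl : ∀ a, a ∈ l) (hvr : v ≠ r) (hyv : y v < 0) (hs : Feas r x y)
    (hdead : ∀ u, u ≠ v → y u < 0 → ∀ w, x u w = 0) :
    SplitChain v x (splitAll l r y v x).2 (splitAll l r y v x).1 ∧
    Feas r (splitAll l r y v x).1 y ∧
    (∀ u, u ≠ v → y u < 0 → ∀ w, (splitAll l r y v x).1 u w = 0) ∧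
    ∀ u, u ≠ r → (splitAll l r y v x).1 u v = 0 := by
  obtain ⟨h1, h2, h3, h4⟩ := foldl_splitStep_spec (r := r) hl hyv (pairs l) [] (x, []) .nil hs
    hdead (by simp)
  exact ⟨h1, h2, h3, fun u hu => h2.eq_zero_of_blocked hvr hyv h3
    (fun a b hab ha hb => h4 (a, b) (.inr (mem_pairs (hl a) (hl b))) hab ha hb) hu⟩

theorem Feas.isolate {r : V} {x : V → V → K} {y : V → K} {v : V} (h : Feas r x y)
    (hyv : y v < 0) (hz : ∀ u, u ≠ r → x u v = 0) :
    Feas r (isolate v x) y where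
  symm a b := by
    unfold PCTSP.isolate
    rw [h.symm a b]
    congr 1
    exact propext or_comm
  diag a := by
    unfold PCTSP.isolate
    split_ifs
    · rfl
    · exact h.diag a
  nonneg a b := by
    unfold PCTSP.isolate
    split_ifs
    · rfl
    · exact h.nonneg a b
  deg u hu hyu := by
    have huv : u ≠ v := fun e => by rw [e] at hyu; linarith
    rw [← h.deg u hu hyu]
    refine Finset.sum_congr rfl fun b _ => ?_
    unfold PCTSP.isolate
    by_cases hb : b = v
    · rw [if_pos (.inr hb), hb, hz u hu]
    · rw [if_neg (by tauto)]
  deg_le u := by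
    refine le_trans (Finset.sum_le_sum fun b _ => ?_) (h.deg_le u)
    unfold PCTSP.isolate
    split_ifs
    · exact h.nonneg u b
    · exact le_rfl
  cut S z hr hzS := by
    by_cases hzv : z = v
    · refine le_trans ?_ (cutv_nonneg (fun a b => ?_) S)
      · rw [hzv]; linarith
      · unfold PCTSP.isolate
        split_ifs
        · rfl
        · exact h.nonneg a b
    -- Compare with `S` without `v`: its vertices are not the root, so none of them has an edge to
    -- `v`, and no edge of its cut is lost.
    · refine (h.cut (S.erase v) z (fun hc => hr (Finset.mem_of_mem_erase hc))
        (Finset.mem_erase.2 ⟨hzv, hzS⟩)).trans ?_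
      rw [cutv_eq, cutv_eq]
      refine Finset.sum_le_sum fun a _ => Finset.sum_le_sum fun b _ => ?_
      unfold PCTSP.isolate
      by_cases ha : a = v
      · simp [ha]
      by_cases hb : b = v
      · by_cases haS : a ∈ S
        · have har : a ≠ r := fun e => hr (e ▸ haS)
          simp [ha, hb, haS, hz a har]
        · simp [haS]
      · simp [ha, hb]

/-- The vertex with smallest nonnegative value of `y` apart from `r`; if there is none, `r`. -/
def selectMin (l : List V) (r : V) (y : V → K) : V :=
  l.foldl (fun best u => if u ≠ r ∧ 0 ≤ y u ∧ (best = r ∨ y u < y best) then u else best) r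

theorem selectMin_spec (l : List V) (r : V) (y : V → K) :
    (selectMin l r y = r ∧ ∀ u ∈ l, u ≠ r → y u < 0) ∨
    (selectMin l r y ≠ r ∧ 0 ≤ y (selectMin l r y) ∧
      ∀ u ∈ l, u ≠ r → 0 ≤ y u → y (selectMin l r y) ≤ y u) := by
  induction l using List.reverseRecOn with
  | nil => left; simp [selectMin]
  | append_singleton l a ih =>
    have e : selectMin (l ++ [a]) r y = if a ≠ r ∧ 0 ≤ y a ∧ (selectMin l r y = r ∨
        y a < y (selectMin l r y)) then a else selectMin l r y := by
      rw [selectMin, List.foldl_append]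
      rfl
    rw [e]
    split_ifs with h
    · right
      refine ⟨h.1, h.2.1, fun u hu hur hyu => ?_⟩
      rcases List.mem_append.1 hu with hu | hu
      · rcases ih with ih | ih
        · exact absurd (ih.2 u hu hur) (not_lt.2 hyu)
        · rcases h.2.2 with h' | h'
          · exact absurd h' ih.1
          · exact h'.le.trans (ih.2.2 u hu hur hyu)
      · rw [List.mem_singleton.1 hu]
    · rcases ih with ih | ih
      · left
        refine ⟨ih.1, fun u hu hur => ?_⟩
        rcases List.mem_append.1 hu with hu | hu
        · exact ih.2 u hu hur
        · rw [List.mem_singleton.1 hu] at hur ⊢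
          by_contra hc
          exact h ⟨hur, not_lt.1 hc, .inl ih.1⟩
      · right
        refine ⟨ih.1, ih.2.1, fun u hu hur hyu => ?_⟩
        rcases List.mem_append.1 hu with hu | hu
        · exact ih.2.2 u hu hur hyu
        · rw [List.mem_singleton.1 hu] at hur hyu ⊢
          by_contra hc
          exact h ⟨hur, hyu, .inr (not_le.1 hc)⟩

/-- A record of the elimination of a vertex `v`: the vertex, its value `y v`, the edge values
before, and the records of the splittings. -/
abbrev ElimRec (V K : Type*) := V × K × (V → V → K) × List (V × V × (V → V → K))

/-- Eliminate the vertex with smallest value of `y`. -/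
def elimStep (l : List V) (r : V) (s : (V → V → K) × (V → K) × List (ElimRec V K)) :
    (V → V → K) × (V → K) × List (ElimRec V K) :=
  if selectMin l r s.2.1 = r then s else
    (isolate (selectMin l r s.2.1) (splitAll l r (Function.update s.2.1 (selectMin l r s.2.1) (-1))
        (selectMin l r s.2.1) s.1).1,
      Function.update s.2.1 (selectMin l r s.2.1) (-1),
      (selectMin l r s.2.1, s.2.1 (selectMin l r s.2.1), s.1,
        (splitAll l r (Function.update s.2.1 (selectMin l r s.2.1) (-1))
          (selectMin l r s.2.1) s.1).2) :: s.2.2)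

/-- Eliminate all vertices except `r`. -/
def elimAll (l : List V) (r : V) (x : V → V → K) (y : V → K) :
    (V → V → K) × (V → K) × List (ElimRec V K) :=
  l.foldl (fun s _ => elimStep l r s) (x, y, [])

/-- `ElimChain r x₀ y₀ stack x y`: the values `x`, `y` arise from `x₀`, `y₀` by the eliminations
recorded in `stack`, the last one first. -/
inductive ElimChain (r : V) (x₀ : V → V → K) (y₀ : V → K) :
    List (ElimRec V K) → (V → V → K) → (V → K) → Prop
  | nil : ElimChain r x₀ y₀ [] x₀ y₀
  | cons {stack : List (ElimRec V K)} {x x' : V → V → K} {y : V → K} {v : V}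
      {recs : List (V × V × (V → V → K))} :
      ElimChain r x₀ y₀ stack x y → v ≠ r → 0 ≤ y v → (∀ u, 0 ≤ y u → y v ≤ y u) →
      (∀ u, y u < 0 → x u v = 0) → ∑ u, x u v = 2 * y v → (∀ a b, 0 ≤ x a b) → (∀ a b, x a b = x b a) →
      (∀ a, x a a = 0) → (∀ a b, 0 ≤ x' a b) → SplitChain v x recs x' →
      ElimChain r x₀ y₀ ((v, y v, x, recs) :: stack) (isolate v x') (Function.update y v (-1))

/-- The value `-1` switches the requirement of `v` off: a negative bound on cuts is void, and degree
equations are asked only for nonnegative values. -/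
theorem Feas.update {r : V} {x : V → V → K} {y : V → K} {v : V} (h : Feas r x y) :
    Feas r x (Function.update y v (-1)) where
  symm := h.symm
  diag := h.diag
  nonneg := h.nonneg
  deg u hu hyu := by
    by_cases huv : u = v
    · rw [huv, Function.update_self] at hyu
      linarith
    · rw [Function.update_of_ne huv] at hyu ⊢
      exact h.deg u hu hyu
  deg_le := h.deg_le
  cut S z hr hz := by
    by_cases hzv : z = v
    · rw [hzv, Function.update_self]
      linarith [cutv_nonneg h.nonneg S]
    · rw [Function.update_of_ne hzv]
      exact h.cut S z hr hz

/-- The invariant of the elimination. -/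
structure ElimInv (r : V) (x₀ : V → V → K) (y₀ : V → K)
    (s : (V → V → K) × (V → K) × List (ElimRec V K)) : Prop where
  chain : ElimChain r x₀ y₀ s.2.2 s.1 s.2.1
  feas : Feas r s.1 s.2.1
  dead : ∀ u, s.2.1 u < 0 → ∀ w, s.1 u w = 0
  root : s.2.1 r = 1
  le_one : ∀ u, s.2.1 u ≤ 1

theorem ElimInv.step {l : List V} (hl : ∀ a, a ∈ l) {r : V} {x₀ : V → V → K} {y₀ : V → K}
    {s : (V → V → K) × (V → K) × List (ElimRec V K)} (h : ElimInv r x₀ y₀ s) :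
    ElimInv r x₀ y₀ (elimStep l r s) := by
  unfold elimStep
  rcases selectMin_spec l r s.2.1 with hv | ⟨hvr, hyv, hmin⟩
  · rw [if_pos hv.1]
    exact h
  · rw [if_neg hvr]
    generalize selectMin l r s.2.1 = v at *
    have hyv' : Function.update s.2.1 v (-1) v < 0 := by
      rw [Function.update_self]; linarith
    have hdead : ∀ u, u ≠ v → Function.update s.2.1 v (-1) u < 0 → ∀ w, s.1 u w = 0 :=
      fun u hu hyu => h.dead u (by rwa [Function.update_of_ne hu] at hyu)
    obtain ⟨h1, h2, h3, h4⟩ := splitAll_spec hl hvr hyv' h.feas.update hdead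
    refine ⟨.cons h.chain hvr hyv (fun u hu => ?_) (fun u hu => h.dead u hu v) ?_ h.feas.nonneg
      h.feas.symm h.feas.diag h2.nonneg h1, h2.isolate hyv' h4, fun u hu w => ?_, ?_, fun u => ?_⟩
    -- The selection ignores the root, whose value `1` is maximal anyway.
    · by_cases hur : u = r
      · rw [hur, h.root]; exact h.le_one v
      · exact hmin u (hl u) hur hu
    · rw [← h.feas.deg v hvr hyv]
      exact Finset.sum_congr rfl fun u _ => h.feas.symm u v
    · show isolate v _ u w = 0
      unfold isolate
      split_ifs with hc
      · rfl
      · push Not at hc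
        exact h3 u hc.1 hu w
    · show Function.update s.2.1 v (-1) r = 1
      rw [Function.update_of_ne hvr.symm, h.root]
    · show Function.update s.2.1 v (-1) u ≤ 1
      by_cases huv : u = v
      · rw [huv, Function.update_self]; linarith
      · rw [Function.update_of_ne huv]; exact h.le_one u

/-- The number of vertices that remain to be eliminated. -/
def aliveCount (r : V) (y : V → K) : ℕ := (Finset.univ.filter fun u => u ≠ r ∧ 0 ≤ y u).card

theorem aliveCount_elimStep {l : List V} (hl : ∀ a, a ∈ l) (r : V)
    (s : (V → V → K) × (V → K) × List (ElimRec V K)) :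
    aliveCount r (elimStep l r s).2.1 ≤ aliveCount r s.2.1 - 1 := by
  unfold elimStep
  rcases selectMin_spec l r s.2.1 with hv | ⟨hvr, hyv, hmin⟩
  · rw [if_pos hv.1]
    have : aliveCount r s.2.1 = 0 := by
      rw [aliveCount, Finset.card_eq_zero, Finset.filter_eq_empty_iff]
      rintro u - ⟨hu, hyu⟩
      exact absurd (hv.2 u (hl u) hu) (not_lt.2 hyu)
    omega
  · rw [if_neg hvr]
    generalize selectMin l r s.2.1 = v at *
    rw [aliveCount, aliveCount, ← Finset.card_erase_of_mem (a := v) (by simp [hvr, hyv])]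
    refine Finset.card_le_card fun u hu => ?_
    simp only [Finset.mem_filter, Finset.mem_univ, true_and, Finset.mem_erase] at hu ⊢
    have huv : u ≠ v := by
      rintro rfl
      have := hu.2
      simp only [Function.update_self] at this
      linarith
    exact ⟨huv, hu.1, by simpa only [Function.update_of_ne huv] using hu.2⟩

/-- The list is only a counter here. Every round eliminates a vertex as long as one remains, so as
many rounds as there are vertices are enough. -/
theorem elimAll_spec {l : List V} (hl : ∀ a, a ∈ l) (hn : Fintype.card V ≤ l.length) {r : V}
    {x : V → V → K} {y : V → K} (h : Feas r x y) (hr : y r = 1) (h0 : ∀ u, 0 ≤ y u)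
    (h1 : ∀ u, y u ≤ 1) :
    ElimInv r x y (elimAll l r x y) ∧ ∀ u, u ≠ r → (elimAll l r x y).2.1 u < 0 := by
  have key : ∀ (m : List V) s, ElimInv r x y s →
      ElimInv r x y (m.foldl (fun s _ => elimStep l r s) s) ∧
      aliveCount r (m.foldl (fun s _ => elimStep l r s) s).2.1 ≤ aliveCount r s.2.1 - m.length := by
    intro m
    induction m with
    | nil => intro s hs; exact ⟨hs, by simp⟩
    | cons a m ih =>
      intro s hs
      obtain ⟨i1, i2⟩ := ih _ (hs.step hl)
      have := aliveCount_elimStep hl r s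
      exact ⟨i1, by simp only [List.foldl_cons, List.length_cons]; omega⟩
  obtain ⟨k1, k2⟩ := key l (x, y, []) ⟨.nil, h, fun u hu => absurd hu (not_lt.2 (h0 u)), hr, h1⟩
  refine ⟨k1, fun u hu => ?_⟩
  have h2 : aliveCount r y ≤ Fintype.card V := Finset.card_le_univ _
  have h3 : aliveCount r (elimAll l r x y).2.1 = 0 := by
    have : aliveCount r (elimAll l r x y).2.1 ≤ aliveCount r y - l.length := k2
    omega
  rw [aliveCount, Finset.card_eq_zero, Finset.filter_eq_empty_iff] at h3
  by_contra hc
  exact h3 (Finset.mem_univ u) ⟨hu, not_lt.1 hc⟩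

end Elimination

end PCTSP

namespace PCTSP

/-! ### Trees as parent functions

A tree with root `r` is a function `T` that sends every vertex to its parent; the root and the
vertices outside the tree are fixed. -/

section Trees

variable {V : Type*} [DecidableEq V]

/-- Membership of a vertex in a tree. -/
def InT (r : V) (T : V → V) (v : V) : Prop := v = r ∨ T v ≠ v

instance (r : V) (T : V → V) (v : V) : Decidable (InT r T v) := inferInstanceAs (Decidable (_ ∨ _))

/-- From every vertex of the tree, the root is reached. -/
def Valid (r : V) (T : V → V) : Prop := T r = r ∧ ∀ v, T v ≠ v → ∃ k, T^[k] v = r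

/-- `a` is an ancestor of `u`, possibly `u` itself. -/
def Anc (T : V → V) (a u : V) : Prop := ∃ k, T^[k] u = a

theorem iterate_fix {T : V → V} {v : V} (h : T v = v) (k : ℕ) : T^[k] v = v :=
  Function.iterate_fixed h k

theorem Anc.trans {T : V → V} {a b c : V} (h1 : Anc T a b) (h2 : Anc T b c) : Anc T a c := by
  obtain ⟨k, hk⟩ := h1
  obtain ⟨m, hm⟩ := h2
  exact ⟨k + m, by rw [Function.iterate_add_apply, hm, hk]⟩

theorem valid_id (r : V) : Valid r id := ⟨rfl, fun _ h => absurd rfl h⟩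

theorem Valid.reach {r : V} {T : V → V} (h : Valid r T) {v : V} (hv : InT r T v) :
    ∃ k, T^[k] v = r := by
  rcases hv with rfl | hv
  · exact ⟨0, rfl⟩
  · exact h.2 v hv

theorem Valid.inT_anc {r : V} {T : V → V} (h : Valid r T) {a u : V} (hu : InT r T u)
    (ha : Anc T a u) : InT r T a := by
  by_contra hc
  unfold InT at hc
  push Not at hc
  obtain ⟨k, hk⟩ := ha
  obtain ⟨m, hm⟩ := h.reach hu
  have h1 : T^[m + k] u = a := by
    rw [Function.iterate_add_apply, hk, iterate_fix hc.2]
  have h2 : T^[k + m] u = r := by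
    rw [Function.iterate_add_apply, hm, iterate_fix h.1]
  rw [add_comm, h2] at h1
  exact hc.1 h1.symm

theorem Valid.inT_parent {r : V} {T : V → V} (h : Valid r T) {u : V} (hu : InT r T u) :
    InT r T (T u) := h.inT_anc hu ⟨1, rfl⟩

/-- There are no cycles. -/
theorem Valid.not_anc {r : V} {T : V → V} (h : Valid r T) {w : V} (hw : T w ≠ w) :
    ¬ Anc T w (T w) := by
  rintro ⟨k, hk⟩
  have hwr : w ≠ r := fun e => hw (e ▸ h.1)
  have hk' : T^[k + 1] w = w := by rw [Function.iterate_add_apply]; exact hk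
  obtain ⟨m, hm⟩ := h.2 w hw
  -- A cycle of length `k + 1` through `w` leads back to `w` after `(k + 1) * m` steps, although `m`
  -- steps end in the fixed point `r`.
  have h1 : T^[(k + 1) * m] w = w := by
    rw [Function.iterate_mul]
    exact iterate_fix hk' m
  have h2 : T^[(k + 1) * m] w = r := by
    have : (k + 1) * m = k * m + m := by ring
    rw [this, Function.iterate_add_apply, hm, iterate_fix h.1]
  exact hwr (h1.symm.trans h2)

theorem iterate_update {T : V → V} {w u z : V} (h : ¬ Anc T w z) (k : ℕ) :
    (Function.update T w u)^[k] z = T^[k] z := by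
  induction k with
  | zero => rfl
  | succ k ih =>
    rw [Function.iterate_succ_apply', Function.iterate_succ_apply', ih, Function.update_of_ne]
    exact fun e => h ⟨k, e⟩

/-- Hang `w` (with its subtree, if there is one) below `u`. -/
theorem Valid.update {r : V} {T : V → V} (h : Valid r T) {w u : V} (hu : InT r T u) (hw : w ≠ r)
    (ha : ¬ Anc T w u) : Valid r (Function.update T w u) := by
  have h1 : ∃ k, (Function.update T w u)^[k] w = r := by
    obtain ⟨k, hk⟩ := h.reach hu
    exact ⟨k + 1, by rw [Function.iterate_succ_apply, Function.update_self, iterate_update ha, hk]⟩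
  refine ⟨by rw [Function.update_of_ne hw.symm, h.1], fun v hv => ?_⟩
  by_cases hvw : v = w
  · rw [hvw]; exact h1
  rw [Function.update_of_ne hvw] at hv
  obtain ⟨k, hk⟩ := h.2 v hv
  clear hv hvw
  induction k generalizing v with
  | zero => exact ⟨0, hk⟩
  | succ k ih =>
    by_cases hvw : v = w
    · rw [hvw]; exact h1
    · obtain ⟨m, hm⟩ := ih (T v) hk
      exact ⟨m + 1, by rw [Function.iterate_succ_apply, Function.update_of_ne hvw, hm]⟩

open Classical in
/-- Replace the arc from `w` to its parent `u` by a path through `v`. -/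
noncomputable def rerouteArc (T : V → V) (u w v : V) : V → V :=
  -- If `v` lies above `u`, it keeps its place. Otherwise it is moved below `u`, together with its
  -- subtree if it was in the tree. In both cases `v` does not lie below `w`, so hanging `w` below
  -- `v` closes no cycle.
  Function.update (if Anc T v u then T else Function.update T v u) w v

section Reroute

variable {r : V} {T : V → V} {u w v : V}

theorem Valid.rerouteArc (h : Valid r T) (hw : T w = u) (huw : u ≠ w) (huv : u ≠ v)
    (hwv : w ≠ v) (hvr : v ≠ r) : Valid r (rerouteArc T u w v) := by
  subst hw
  have hwr : w ≠ r := fun e => huw (e ▸ h.1)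
  have hu : InT r T (T w) := h.inT_parent (.inr huw)
  have hnw := h.not_anc huw
  unfold PCTSP.rerouteArc
  by_cases ha : Anc T v (T w)
  · rw [if_pos ha]
    exact h.update (h.inT_anc hu ha) hwr fun hc => hnw (hc.trans ha)
  · rw [if_neg ha]
    refine (h.update hu hvr ha).update (.inr ?_) hwr ?_
    · rwa [Function.update_self]
    · rintro ⟨k, hk⟩
      cases k with
      | zero => exact hwv hk.symm
      | succ k =>
        rw [Function.iterate_succ_apply, Function.update_self, iterate_update ha] at hk
        exact hnw ⟨k, hk⟩

end Reroute

variable {K : Type*} [Fintype V] [Field K] [LinearOrder K] [IsStrictOrderedRing K]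

/-- The number of times a tree uses the edge `ab`. -/
def cnt (K : Type*) [Field K] (T : V → V) (a b : V) : K :=
  if a = b then 0 else (if T b = a then 1 else 0) + if T a = b then 1 else 0

/-- Membership as a number. -/
def mem (K : Type*) [Field K] (r : V) (T : V → V) (v : V) : K := if InT r T v then 1 else 0

/-- The degree of `v` in a tree. -/
def dg (K : Type*) [Field K] (T : V → V) (v : V) : K := ∑ z, cnt K T z v

theorem cnt_nonneg (T : V → V) (a b : V) : 0 ≤ cnt K T a b := by
  unfold cnt
  split_ifs <;> norm_num

theorem mem_nonneg (r : V) (T : V → V) (a : V) : 0 ≤ mem K r T a := by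
  unfold mem
  split_ifs <;> norm_num

theorem cnt_comm (T : V → V) (a b : V) : cnt K T a b = cnt K T b a := by
  unfold cnt
  by_cases h : a = b
  · rw [h]
  · rw [if_neg h, if_neg (Ne.symm h), add_comm]

theorem dg_eq (T : V → V) (v : V) :
    dg K T v = (if T v = v then 0 else 1) + ∑ z, if z = v then 0 else if T z = v then 1 else 0 := by
  unfold dg cnt
  have : ∀ z, (if z = v then (0 : K) else (if T v = z then 1 else 0) + if T z = v then 1 else 0) =
      (if z = T v then if T v = v then 0 else 1 else 0) +
        if z = v then 0 else if T z = v then 1 else 0 := by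
    intro z
    by_cases h1 : z = v
    · rw [if_pos h1, if_pos h1, add_zero]
      split_ifs with h2 h3
      · rfl
      · exact absurd (h2.symm.trans h1) h3
      · rfl
    · rw [if_neg h1, if_neg h1]
      congr 1
      by_cases h2 : z = T v
      · rw [if_pos h2.symm, if_pos h2, if_neg fun e => h1 (h2.trans e)]
      · rw [if_neg (Ne.symm h2), if_neg h2]
  simp only [this, Finset.sum_add_distrib, Finset.sum_ite_eq', Finset.mem_univ, if_true]

theorem mem_le_dg {r : V} (T : V → V) {v : V} (hv : v ≠ r) : mem K r T v ≤ dg K T v := by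
  rw [dg_eq, mem]
  have : (0 : K) ≤ ∑ z, if z = v then 0 else if T z = v then 1 else 0 :=
    Finset.sum_nonneg fun z _ => by split_ifs <;> norm_num
  unfold InT
  by_cases h : T v = v <;> simp [h, hv, this]

theorem edgeInd_eq' {u w a b : V} (hab : a ≠ b) : edgeInd K u w a b =
    (if b = w ∧ a = u then 1 else 0) + if a = w ∧ b = u then 1 else 0 := by
  unfold edgeInd
  by_cases h1 : a = u <;> by_cases h2 : a = w <;> by_cases h3 : b = u <;> by_cases h4 : b = w <;>
    simp_all

section RerouteArc

variable {r : V} {T : V → V} {u w v : V}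

/-- Only an inequality: the arc from `v` to `u` is not needed if `v` is an ancestor of `u`, and
otherwise a former parent arc of `v` disappears. -/
theorem cnt_rerouteArc_le (hw : T w = u) (huw : u ≠ w) (huv : u ≠ v) (hwv : w ≠ v) {a b : V}
    (hab : a ≠ b) : cnt K (rerouteArc T u w v) a b ≤
      cnt K T a b + edgeInd K u v a b + edgeInd K w v a b - edgeInd K u w a b := by
  have key : ∀ a b : V, a ≠ b → (if rerouteArc T u w v b = a then (1 : K) else 0) ≤
      (if T b = a then 1 else 0) + (if b = v ∧ a = u then 1 else 0) +
        (if b = w ∧ a = v then 1 else 0) - if b = w ∧ a = u then 1 else 0 := by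
    intro a b _
    unfold rerouteArc
    by_cases hbw : b = w
    · subst hbw
      rw [Function.update_self, hw]
      by_cases h1 : a = u <;> by_cases h2 : a = v <;> simp_all [eq_comm]
    · rw [Function.update_of_ne hbw]
      by_cases ha : Anc T v u
      · rw [if_pos ha]
        simp only [hbw, false_and, if_false]
        split_ifs <;> norm_num
      · rw [if_neg ha]
        by_cases hbv : b = v
        · subst hbv
          rw [Function.update_self]
          simp only [hbw, false_and, if_false, true_and, eq_comm (a := u)]
          split_ifs <;> norm_num
        · rw [Function.update_of_ne hbv]
          simp [hbw, hbv]
  have h1 := key a b hab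
  have h2 := key b a hab.symm
  rw [cnt, cnt, if_neg hab, if_neg hab, edgeInd_eq' hab, edgeInd_eq' hab, edgeInd_eq' hab]
  have e1 : (if b = w ∧ a = v then (1 : K) else 0) = if a = v ∧ b = w then 1 else 0 :=
    if_congr and_comm rfl rfl
  have e2 : (if a = w ∧ b = v then (1 : K) else 0) = if b = v ∧ a = w then 1 else 0 :=
    if_congr and_comm rfl rfl
  linarith

theorem mem_rerouteArc (hw : T w = u) (huw : u ≠ w) (hwv : w ≠ v) {z : V} (hz : z ≠ v) :
    mem K r (rerouteArc T u w v) z = mem K r T z := by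
  refine if_congr ?_ rfl rfl
  unfold InT rerouteArc
  by_cases hzw : z = w
  · subst hzw
    simp [hw, huw, hwv.symm]
  · rw [Function.update_of_ne hzw]
    split_ifs with h1
    · rfl
    · rw [Function.update_of_ne hz]

/-- The only possible new child of `v` is `w`, and the parent edge of `v` is there precisely when
`v` is in the tree. So a new vertex `v` may cost degree two, an old one costs at most one. -/
theorem dg_rerouteArc_le (hvr : v ≠ r) : dg K (rerouteArc T u w v) v ≤
      dg K T v + 1 + (mem K r (rerouteArc T u w v) v - mem K r T v) := by
  rw [dg_eq, dg_eq]
  have h1 : (∑ z, if z = v then (0 : K) else if rerouteArc T u w v z = v then 1 else 0) ≤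
      ∑ z, ((if z = v then 0 else if T z = v then 1 else 0) + if z = w then 1 else 0) := by
    refine Finset.sum_le_sum fun z _ => ?_
    unfold rerouteArc
    by_cases hzv : z = v
    · rw [if_pos hzv, if_pos hzv]
      split_ifs <;> norm_num
    · rw [if_neg hzv, if_neg hzv]
      by_cases hzw : z = w
      · rw [if_pos hzw]
        split_ifs <;> norm_num
      · rw [Function.update_of_ne hzw, if_neg hzw, add_zero]
        by_cases ha : Anc T v u
        · rw [if_pos ha]
        · rw [if_neg ha, Function.update_of_ne hzv]
  rw [Finset.sum_add_distrib, Finset.sum_ite_eq', if_pos (Finset.mem_univ w)] at h1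
  have e : ∀ T' : V → V, mem K r T' v = if T' v = v then 0 else 1 := by
    intro T'
    unfold mem InT
    by_cases h : T' v = v <;> simp [h, hvr]
  rw [e, e]
  linarith

theorem mem_rerouteArc_le :
    mem K r (rerouteArc T u w v) v ≤ mem K r T v + 1 := by
  have := mem_nonneg (K := K) r T v
  have h2 : mem K r (rerouteArc T u w v) v ≤ 1 := by
    unfold mem
    split_ifs <;> norm_num
  linarith

end RerouteArc

/-- Replace the edge `uw` by a path through `v`. -/
noncomputable def reroute (u w v : V) (T : V → V) : V → V :=
  if T w = u then rerouteArc T u w v else rerouteArc T w u v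

section RerouteEdge

variable {r : V} {T : V → V} {u w v : V}

theorem Valid.reroute (h : Valid r T) (hP : T w = u ∨ T u = w) (huw : u ≠ w) (huv : u ≠ v)
    (hwv : w ≠ v) (hvr : v ≠ r) : Valid r (reroute u w v T) := by
  unfold PCTSP.reroute
  split_ifs with hw
  · exact h.rerouteArc hw huw huv hwv hvr
  · exact h.rerouteArc (hP.resolve_left hw) huw.symm hwv huv hvr

theorem cnt_reroute_le (hP : T w = u ∨ T u = w) (huw : u ≠ w) (huv : u ≠ v)
    (hwv : w ≠ v) {a b : V} (hab : a ≠ b) : cnt K (reroute u w v T) a b ≤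
      cnt K T a b + edgeInd K u v a b + edgeInd K w v a b - edgeInd K u w a b := by
  unfold reroute
  split_ifs with hw
  · exact cnt_rerouteArc_le hw huw huv hwv hab
  · have := cnt_rerouteArc_le (K := K) (hP.resolve_left hw) huw.symm hwv huv hab
    have e : edgeInd K w u a b = edgeInd K u w a b := by
      unfold edgeInd
      congr 1
      exact propext or_comm
    rw [e] at this
    linarith

theorem mem_reroute (hP : T w = u ∨ T u = w) (huw : u ≠ w) (huv : u ≠ v)
    (hwv : w ≠ v) {z : V} (hz : z ≠ v) : mem K r (reroute u w v T) z = mem K r T z := by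
  unfold reroute
  split_ifs with hw
  · exact mem_rerouteArc hw huw hwv hz
  · exact mem_rerouteArc (hP.resolve_left hw) huw.symm huv hz

theorem dg_reroute_le (hvr : v ≠ r) :
    dg K (reroute u w v T) v ≤ dg K T v + 1 + (mem K r (reroute u w v T) v - mem K r T v) := by
  unfold reroute
  split_ifs with hw
  · exact dg_rerouteArc_le hvr
  · exact dg_rerouteArc_le hvr

theorem mem_reroute_le :
    mem K r (reroute u w v T) v ≤ mem K r T v + 1 := by
  unfold reroute
  split_ifs with hw
  · exact mem_rerouteArc_le
  · exact mem_rerouteArc_le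

end RerouteEdge

section Attach

variable {r : V} {T : V → V} {u v : V}

theorem Valid.attach (h : Valid r T) (hu : InT r T u) (hv : ¬ InT r T v) :
    Valid r (Function.update T v u) :=
  h.update hu (fun e => hv (.inl e)) fun ha => hv (h.inT_anc hu ha)

theorem cnt_attach (huv : u ≠ v) (hv : ¬ InT r T v) {a b : V} (hab : a ≠ b) :
    cnt K (Function.update T v u) a b = cnt K T a b + edgeInd K u v a b := by
  have hTv : T v = v := by
    by_contra hc
    exact hv (.inr hc)
  have key : ∀ a b : V, a ≠ b → (if Function.update T v u b = a then (1 : K) else 0) =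
      (if T b = a then 1 else 0) + (if b = v ∧ a = u then 1 else 0) := by
    intro a b hab
    by_cases hbv : b = v
    · subst hbv
      rw [Function.update_self, hTv]
      simp [hab.symm, eq_comm]
    · rw [Function.update_of_ne hbv]
      simp [hbv]
  have h1 := key a b hab
  have h2 := key b a hab.symm
  rw [cnt, cnt, if_neg hab, if_neg hab, edgeInd_eq' hab, h1, h2]
  ring

theorem mem_attach {z : V} (hz : z ≠ v) : mem K r (Function.update T v u) z = mem K r T z := by
  refine if_congr ?_ rfl rfl
  unfold InT
  rw [Function.update_of_ne hz]

theorem mem_attach_self (huv : u ≠ v) (hv : ¬ InT r T v) :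
    mem K r (Function.update T v u) v = mem K r T v + 1 := by
  have : InT r (Function.update T v u) v := .inr (by rwa [Function.update_self])
  rw [mem, mem, if_pos this, if_neg hv, zero_add]

end Attach

end Trees

/-! ### Weighted families of trees -/

section Greedy

variable {K τ : Type*} [Field K] [LinearOrder K] [IsStrictOrderedRing K]

/-- The weighted sum of `φ`. -/
def wsum (φ : τ → K) (L : List (K × τ)) : K := (L.map fun q => q.1 * φ q.2).sum

theorem wsum_cons (φ : τ → K) (q : K × τ) (L : List (K × τ)) :
    wsum φ (q :: L) = q.1 * φ q.2 + wsum φ L := by simp [wsum]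

theorem wsum_nonneg {φ : τ → K} {L : List (K × τ)} (hL : ∀ q ∈ L, 0 ≤ q.1)
    (hφ : ∀ q ∈ L, 0 ≤ φ q.2) : 0 ≤ wsum φ L := by
  refine List.sum_nonneg fun a ha => ?_
  obtain ⟨q, hq, rfl⟩ := List.mem_map.1 ha
  exact mul_nonneg (hL q hq) (hφ q hq)

theorem wsum_le_wsum {φ ψ : τ → K} {L : List (K × τ)} (hL : ∀ q ∈ L, 0 ≤ q.1)
    (h : ∀ q ∈ L, φ q.2 ≤ ψ q.2) : wsum φ L ≤ wsum ψ L := by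
  induction L with
  | nil => simp [wsum]
  | cons q L ih =>
    rw [wsum_cons, wsum_cons]
    have h1 := mul_le_mul_of_nonneg_left (h q (by simp)) (hL q (by simp))
    have h2 := ih (fun q hq => hL q (by simp [hq])) fun q hq => h q (by simp [hq])
    linarith

theorem wsum_congr {φ ψ : τ → K} {L : List (K × τ)} (h : ∀ q ∈ L, φ q.2 = ψ q.2) :
    wsum φ L = wsum ψ L := by
  unfold wsum
  congr 1
  exact List.map_congr_left fun q hq => by rw [h q hq]

theorem wsum_add (φ ψ : τ → K) (L : List (K × τ)) :
    wsum (fun T => φ T + ψ T) L = wsum φ L + wsum ψ L := by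
  induction L with
  | nil => simp [wsum]
  | cons q L ih => rw [wsum_cons, wsum_cons, wsum_cons, ih]; ring

theorem wsum_const (c : K) (L : List (K × τ)) :
    wsum (fun _ => c) L = c * wsum (fun _ => 1) L := by
  induction L with
  | nil => simp [wsum]
  | cons q L ih => rw [wsum_cons, wsum_cons, ih]; ring

theorem wsum_sum {β : Type*} (s : Finset β) (φ : β → τ → K) (L : List (K × τ)) :
    wsum (fun T => ∑ i ∈ s, φ i T) L = ∑ i ∈ s, wsum (φ i) L := by
  induction L with
  | nil => simp [wsum]
  | cons q L ih => simp only [wsum_cons, ih, Finset.mul_sum, Finset.sum_add_distrib]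

open Classical in
/-- Apply `F` to (a part of) the next tree if it satisfies `P` and the budget is not exhausted. -/
noncomputable def greedyStep (P : τ → Prop) (F : τ → τ) (s : K × List (K × τ)) (q : K × τ) :
    K × List (K × τ) :=
  if P q.2 ∧ 0 < s.1 then
    if q.1 ≤ s.1 then (s.1 - q.1, (q.1, F q.2) :: s.2)
    else (0, (s.1, F q.2) :: (q.1 - s.1, q.2) :: s.2)
  else (s.1, q :: s.2)

/-- Apply `F` to trees with property `P` of total weight at most `b`. -/
noncomputable def greedy (P : τ → Prop) (F : τ → τ) (b : K) (L : List (K × τ)) : List (K × τ) :=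
  (L.foldl (greedyStep P F) (b, [])).2

/-- A tree is cut in two only by the step that exhausts the budget; the indicator of a positive
budget pays for this step. -/
theorem length_foldl_greedyStep (P : τ → Prop) (F : τ → τ) (L : List (K × τ))
    (s : K × List (K × τ)) :
    (L.foldl (greedyStep P F) s).2.length + (if 0 < (L.foldl (greedyStep P F) s).1 then 1 else 0) ≤
      L.length + s.2.length + if 0 < s.1 then 1 else 0 := by
  induction L generalizing s with
  | nil =>
    simp only [List.foldl_nil, List.length_nil, zero_add]
    exact le_rfl
  | cons q L ih =>
    rw [List.foldl_cons]
    refine (ih _).trans ?_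
    unfold greedyStep
    rw [List.length_cons]
    split_ifs <;> simp_all <;> omega

theorem length_greedy_le (P : τ → Prop) (F : τ → τ) (b : K) (L : List (K × τ)) :
    (greedy P F b L).length ≤ L.length + 1 := by
  have := length_foldl_greedyStep P F L (b, [])
  simp only [List.length_nil] at this
  unfold greedy
  split_ifs at this <;> omega

-- The list `A` records the portions to which `F` was applied. As a weighted family it makes the
-- effect on every statistic `φ` linear. Its total weight is the budget or the weight of the
-- eligible trees, whichever is smaller; the maximum with `0` accounts for a negative budget.
open Classical in
theorem foldl_greedyStep_spec (P : τ → Prop) (F : τ → τ) (L : List (K × τ))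
    (hL : ∀ q ∈ L, 0 ≤ q.1) (s : K × List (K × τ)) :
    ∃ A : List (K × τ), (∀ q ∈ A, 0 ≤ q.1 ∧ P q.2 ∧ ∃ q' ∈ L, q'.2 = q.2) ∧
      wsum (fun _ => 1) A = max 0 (min s.1 (wsum (fun T => if P T then 1 else 0) L)) ∧
      (∀ φ : τ → K, wsum φ (L.foldl (greedyStep P F) s).2 =
        wsum φ s.2 + wsum φ L + wsum (fun T => φ (F T) - φ T) A) ∧
      ∀ q ∈ (L.foldl (greedyStep P F) s).2, q ∈ s.2 ∨
        (0 ≤ q.1 ∧ ∃ q' ∈ L, q.2 = q'.2 ∨ (P q'.2 ∧ q.2 = F q'.2)) := by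
  induction L generalizing s with
  | nil =>
    refine ⟨[], by simp, ?_, by simp [wsum], fun q hq => .inl hq⟩
    simp only [wsum, List.map_nil, List.sum_nil]
    exact (max_eq_left (min_le_right _ _)).symm
  | cons q L ih =>
    have hq0 : 0 ≤ q.1 := hL q (by simp)
    have hL' : ∀ q ∈ L, 0 ≤ q.1 := fun q hq => hL q (by simp [hq])
    have hW : 0 ≤ wsum (fun T => if P T then (1 : K) else 0) L :=
      wsum_nonneg hL' fun q _ => by split_ifs <;> norm_num
    rw [List.foldl_cons]
    by_cases h1 : P q.2 ∧ 0 < s.1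
    · by_cases h2 : q.1 ≤ s.1
      · obtain ⟨A, a1, a2, a3, a4⟩ := ih hL' (s.1 - q.1, (q.1, F q.2) :: s.2)
        rw [greedyStep, if_pos h1, if_pos h2]
        refine ⟨q :: A, ?_, ?_, fun φ => ?_, fun p hp => ?_⟩
        · intro p hp
          rcases List.mem_cons.1 hp with rfl | hp
          · exact ⟨hq0, h1.1, p, by simp, rfl⟩
          · obtain ⟨b1, b2, p', hp', b3⟩ := a1 p hp
            exact ⟨b1, b2, p', by simp [hp'], b3⟩
        · rw [wsum_cons, wsum_cons, a2, if_pos h1.1, mul_one]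
          simp only
          rcases le_total (s.1 - q.1) (wsum (fun T => if P T then (1 : K) else 0) L) with h3 | h3
          · rw [min_eq_left h3, min_eq_left (by linarith), max_eq_right (by linarith),
              max_eq_right (by linarith)]
            ring
          · rw [min_eq_right h3, min_eq_right (by linarith), max_eq_right (by linarith),
              max_eq_right (by linarith)]
        · rw [a3, wsum_cons, wsum_cons, wsum_cons]
          ring
        · rcases a4 p hp with hp | ⟨b1, p', hp', b2⟩
          · rcases List.mem_cons.1 hp with rfl | hp
            · exact .inr ⟨hq0, q, by simp, .inr ⟨h1.1, rfl⟩⟩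
            · exact .inl hp
          · exact .inr ⟨b1, p', by simp [hp'], b2⟩
      · obtain ⟨A, a1, a2, a3, a4⟩ := ih hL' (0, (s.1, F q.2) :: (q.1 - s.1, q.2) :: s.2)
        rw [greedyStep, if_pos h1, if_neg h2]
        refine ⟨(s.1, q.2) :: A, ?_, ?_, fun φ => ?_, fun p hp => ?_⟩
        · intro p hp
          rcases List.mem_cons.1 hp with rfl | hp
          · exact ⟨h1.2.le, h1.1, q, by simp, rfl⟩
          · obtain ⟨b1, b2, p', hp', b3⟩ := a1 p hp
            exact ⟨b1, b2, p', by simp [hp'], b3⟩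
        · rw [wsum_cons, wsum_cons, a2, if_pos h1.1, min_eq_left hW, max_self,
            min_eq_left (by linarith), max_eq_right h1.2.le]
          ring
        · rw [a3, wsum_cons, wsum_cons, wsum_cons, wsum_cons]
          ring
        · rcases a4 p hp with hp | ⟨b1, p', hp', b2⟩
          · rcases List.mem_cons.1 hp with rfl | hp
            · exact .inr ⟨h1.2.le, q, by simp, .inr ⟨h1.1, rfl⟩⟩
            · rcases List.mem_cons.1 hp with rfl | hp
              · exact .inr ⟨by simp only; linarith, q, by simp, .inl rfl⟩
              · exact .inl hp
          · exact .inr ⟨b1, p', by simp [hp'], b2⟩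
    · obtain ⟨A, a1, a2, a3, a4⟩ := ih hL' (s.1, q :: s.2)
      rw [greedyStep, if_neg h1]
      refine ⟨A, ?_, ?_, fun φ => ?_, fun p hp => ?_⟩
      · intro p hp
        obtain ⟨b1, b2, p', hp', b3⟩ := a1 p hp
        exact ⟨b1, b2, p', by simp [hp'], b3⟩
      · rw [wsum_cons, a2]
        by_cases hP : P q.2
        · have hs : s.1 ≤ 0 := by
            by_contra hc
            exact h1 ⟨hP, not_le.1 hc⟩
          rw [max_eq_left ((min_le_left _ _).trans hs), max_eq_left ((min_le_left _ _).trans hs)]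
        · rw [if_neg hP, mul_zero, zero_add]
      · rw [a3, wsum_cons, wsum_cons]
        ring
      · rcases a4 p hp with hp | ⟨b1, p', hp', b2⟩
        · rcases List.mem_cons.1 hp with rfl | hp
          · exact .inr ⟨hq0, p, by simp, .inl rfl⟩
          · exact .inl hp
        · exact .inr ⟨b1, p', by simp [hp'], b2⟩

theorem greedy_spec (P : τ → Prop) (F : τ → τ) (b : K) (L : List (K × τ))
    (hL : ∀ q ∈ L, 0 ≤ q.1) (ψ : τ → K) (h1 : ∀ T, P T → ψ T = 1) (h0 : ∀ T, ¬ P T → ψ T = 0) :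
    ∃ A : List (K × τ), (∀ q ∈ A, 0 ≤ q.1 ∧ P q.2 ∧ ∃ q' ∈ L, q'.2 = q.2) ∧
      wsum (fun _ => 1) A = max 0 (min b (wsum ψ L)) ∧
      (∀ φ : τ → K, wsum φ (greedy P F b L) = wsum φ L + wsum (fun T => φ (F T) - φ T) A) ∧
      ∀ q ∈ greedy P F b L,
        0 ≤ q.1 ∧ ∃ q' ∈ L, q.2 = q'.2 ∨ (P q'.2 ∧ q.2 = F q'.2) := by
  classical
  have e : ψ = fun T => if P T then 1 else 0 := by
    funext T
    by_cases hP : P T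
    · rw [if_pos hP, h1 T hP]
    · rw [if_neg hP, h0 T hP]
  rw [e]
  obtain ⟨A, a1, a2, a3, a4⟩ := foldl_greedyStep_spec P F L hL (b, [])
  refine ⟨A, a1, a2, fun φ => ?_, fun q hq => ?_⟩
  · have := a3 φ
    simp only [wsum, List.map_nil, List.sum_nil, zero_add] at this ⊢
    exact this
  · simpa using a4 q hq

end Greedy

end PCTSP

namespace PCTSP

/-! ### Undoing the elimination -/

section Undo

variable {V K : Type*} [Fintype V] [DecidableEq V] [Field K] [LinearOrder K]
  [IsStrictOrderedRing K]

/-- The total weight of the trees at the edge `ab`. -/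
def used (L : List (K × (V → V))) (a b : V) : K := wsum (fun T => cnt K T a b) L

/-- The total weight of the trees that contain `v`. -/
def cov (r : V) (L : List (K × (V → V))) (v : V) : K := wsum (fun T => mem K r T v) L

/-- Undo the splitting off of a pair at `v`. -/
noncomputable def undoSplit (v : V) (L : List (K × (V → V))) (q : V × V × (V → V → K)) :
    List (K × (V → V)) :=
  greedy (fun T => T q.2.1 = q.1 ∨ T q.1 = q.2.1) (reroute q.1 q.2.1 v)
    (used L q.1 q.2.1 - q.2.2 q.1 q.2.1) L

/-- Attach `v` as a leaf with parent `u` to trees, as long as there is room at the edge `uv` and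
`v` is not covered completely. -/
noncomputable def attachStep (r v : V) (x : V → V → K) (c : K) (L : List (K × (V → V))) (u : V) :
    List (K × (V → V)) :=
  greedy (fun T => InT r T u ∧ ¬ InT r T v) (fun T => Function.update T v u)
    (min (x u v - used L u v) (c - cov r L v)) L

/-- Undo the elimination of a vertex. -/
noncomputable def undoElim (l : List V) (r : V) (L : List (K × (V → V))) (q : ElimRec V K) :
    List (K × (V → V)) :=
  l.foldl (attachStep r q.1 q.2.2.1 q.2.1) (q.2.2.2.foldl (undoSplit q.1) L)

/-- The weighted trees for `x` and `y`. -/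
noncomputable def weightedTrees (l : List V) (r : V) (x : V → V → K) (y : V → K) :
    List (K × (V → V)) :=
  (elimAll l r x y).2.2.foldl (undoElim l r) [(1, id)]

/-- Weighted trees that are dominated by `x`. -/
structure Dominated (r : V) (x : V → V → K) (L : List (K × (V → V))) : Prop where
  nonneg : ∀ q ∈ L, 0 ≤ q.1
  valid : ∀ q ∈ L, Valid r q.2
  total : wsum (fun _ => 1) L = 1
  used_le : ∀ a b, a ≠ b → used L a b ≤ x a b

theorem used_nonneg {L : List (K × (V → V))} (hL : ∀ q ∈ L, 0 ≤ q.1) (a b : V) :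
    0 ≤ used L a b := wsum_nonneg hL fun _ _ => cnt_nonneg _ _ _

theorem used_comm (L : List (K × (V → V))) (a b : V) : used L a b = used L b a :=
  wsum_congr fun q _ => cnt_comm q.2 a b

theorem used_self (L : List (K × (V → V))) (a : V) : used L a a = 0 := by
  have : used L a a = wsum (fun _ => 0) L := wsum_congr fun q _ => by simp [cnt]
  rw [this, wsum_const, zero_mul]

theorem wsum_dg (L : List (K × (V → V))) (v : V) :
    wsum (fun T => dg K T v) L = ∑ z, used L z v := wsum_sum _ _ _

theorem edgeInd_nonneg (u w a b : V) : 0 ≤ edgeInd K u w a b := by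
  unfold edgeInd
  split_ifs <;> norm_num

/-- Before the splitting, `uw` had `α` less capacity, while `uv` and `wv` had `α` more. So at most
`α` has to be moved away from `uw`, and there is room for it on both edges of the detour. The last
two claims are the bookkeeping at `v`: degree grows by at most the moved weight plus the growth of
the coverage. -/
theorem undoSplit_spec {r v u w : V} {x : V → V → K} {α : K} {L : List (K × (V → V))}
    (h : Dominated r (split x v u w α) L) (huw : u ≠ w) (huv : u ≠ v) (hwv : w ≠ v) (hvr : v ≠ r)
    (hα : 0 ≤ α) (hx : ∀ a b, 0 ≤ x a b) (hs : ∀ a b, x a b = x b a) :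
    Dominated r x (undoSplit v L (u, w, x)) ∧
    (∀ z, z ≠ v → cov r (undoSplit v L (u, w, x)) z = cov r L z) ∧
    cov r (undoSplit v L (u, w, x)) v ≤ cov r L v + α ∧
    ∑ z, used (undoSplit v L (u, w, x)) z v ≤
      ∑ z, used L z v + α + (cov r (undoSplit v L (u, w, x)) v - cov r L v) := by
  obtain ⟨A, hA, ht, hφ, hmem⟩ := greedy_spec (fun T : V → V => T w = u ∨ T u = w)
    (reroute u w v) (used L u w - x u w) L h.nonneg
    (fun T => if T w = u ∨ T u = w then 1 else 0) (fun _ h => if_pos h) (fun _ h => if_neg h)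
  change ∀ φ, wsum φ (undoSplit v L (u, w, x)) = _ at hφ
  change ∀ q ∈ undoSplit v L (u, w, x), _ at hmem
  set L' := undoSplit v L (u, w, x) with hL'
  set t := wsum (fun _ => 1) A with htdef
  have hA0 : ∀ q ∈ A, 0 ≤ q.1 := fun q hq => (hA q hq).1
  have hval : ∀ q ∈ A, Valid r q.2 := fun q hq => by
    obtain ⟨q', hq', e⟩ := (hA q hq).2.2
    exact e ▸ h.valid q' hq'
  -- Without cycles a tree uses `uw` in one direction only, so the eligible weight is the usage of
  -- the edge.
  have hW : wsum (fun T : V → V => if T w = u ∨ T u = w then (1 : K) else 0) L = used L u w := by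
    refine wsum_congr fun q hq => ?_
    have := h.valid q hq
    unfold cnt
    rw [if_neg huw]
    by_cases h1 : q.2 w = u
    · have h2 : q.2 u ≠ w := fun h2 => this.not_anc (w := w) (h1 ▸ huw) ⟨1, by rw [h1]; exact h2⟩
      simp [h1, h2]
    · simp [h1]
  rw [hW] at ht
  have hsuw : split x v u w α u w = x u w + α := by
    simp [split, edgeInd, huw, huv, hwv]
  have huse : used L u w ≤ x u w + α := hsuw ▸ h.used_le u w huw
  -- The excess never exceeds the eligible weight, since `x u w` is nonnegative; so the greedy
  -- procedure removes all of it.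
  have hmin : min (used L u w - x u w) (used L u w) = used L u w - x u w :=
    min_eq_left (by linarith [hx u w])
  rw [hmin] at ht
  have ht0 : 0 ≤ t := ht ▸ le_max_left _ _
  have htb : used L u w - x u w ≤ t := ht ▸ le_max_right _ _
  have htα : t ≤ α := ht ▸ max_le hα (by linarith)
  have huse' : ∀ a b, a ≠ b → used L' a b ≤ used L a b +
      (edgeInd K u v a b + edgeInd K w v a b - edgeInd K u w a b) * t := by
    intro a b hab
    rw [used, hφ, ← wsum_const]
    refine add_le_add le_rfl (wsum_le_wsum hA0 fun q hq => ?_)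
    have := cnt_reroute_le (K := K) (hA q hq).2.1 huw huv hwv hab
    linarith
  refine ⟨⟨fun q hq => (hmem q hq).1, fun q hq => ?_, ?_, fun a b hab => ?_⟩, fun z hz => ?_,
    ?_, ?_⟩
  · obtain ⟨_, q', hq', h1 | ⟨hP, h1⟩⟩ := hmem q hq
    · exact h1 ▸ h.valid q' hq'
    · exact h1 ▸ (h.valid q' hq').reroute hP huw huv hwv hvr
  · rw [hφ, h.total, wsum_congr (ψ := fun _ => 0) (fun q _ => sub_self _), wsum_const]
    simp
  · have h1 := huse' a b hab
    by_cases hc : (a = u ∧ b = w) ∨ (a = w ∧ b = u)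
    · have e1 : edgeInd K u w a b = 1 := by rw [edgeInd, if_pos hc]
      have e2 : edgeInd K u v a b = 0 := by
        rw [edgeInd, if_neg]
        rcases hc with ⟨rfl, rfl⟩ | ⟨rfl, rfl⟩ <;> tauto
      have e3 : edgeInd K w v a b = 0 := by
        rw [edgeInd, if_neg]
        rcases hc with ⟨rfl, rfl⟩ | ⟨rfl, rfl⟩ <;> tauto
      have e4 : used L a b = used L u w := by
        rcases hc with ⟨rfl, rfl⟩ | ⟨rfl, rfl⟩
        · rfl
        · exact used_comm _ _ _
      have e5 : x a b = x u w := by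
        rcases hc with ⟨rfl, rfl⟩ | ⟨rfl, rfl⟩
        · rfl
        · exact hs _ _
      rw [e1, e2, e3, e4] at h1
      rw [e5]
      linarith
    · have e1 : edgeInd K u w a b = 0 := by rw [edgeInd, if_neg hc]
      have h2 := h.used_le a b hab
      rw [split, e1] at h2
      rw [e1] at h1
      have h3 := edgeInd_nonneg (K := K) u v a b
      have h4 := edgeInd_nonneg (K := K) w v a b
      nlinarith [mul_le_mul_of_nonneg_left htα (add_nonneg h3 h4)]
  · rw [cov, hφ, wsum_congr (L := A) (ψ := fun _ => 0), wsum_const, zero_mul, add_zero, cov]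
    intro q hq
    rw [mem_reroute (hA q hq).2.1 huw huv hwv hz, sub_self]
  · rw [cov, hφ]
    have : wsum (fun T => mem K r (reroute u w v T) v - mem K r T v) A ≤ wsum (fun _ => 1) A :=
      wsum_le_wsum hA0 fun q _ => by
        have := mem_reroute_le (K := K) (r := r) (T := q.2) (u := u) (w := w) (v := v)
        linarith
    rw [cov]
    linarith
  · rw [← wsum_dg, ← wsum_dg, cov, hφ, hφ, cov]
    have : wsum (fun T => dg K (reroute u w v T) v - dg K T v) A ≤
        wsum (fun T => 1 + (mem K r (reroute u w v T) v - mem K r T v)) A :=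
      wsum_le_wsum hA0 fun q _ => by
        have := dg_reroute_le (K := K) (T := q.2) (u := u) (w := w) hvr
        linarith
    rw [wsum_add] at this
    linarith

theorem sum_col_split {v u w : V} (huw : u ≠ w) (huv : u ≠ v) (hwv : w ≠ v) {x : V → V → K}
    (hs : ∀ a b, x a b = x b a) (α : K) :
    ∑ a, split x v u w α a v = ∑ a, x a v - 2 * α := by
  have h1 : ∑ a, split x v u w α a v = ∑ a, split x v u w α v a :=
    Finset.sum_congr rfl fun a _ => split_symm hs v u w α a v
  have h2 : ∑ a, x a v = ∑ a, x v a := Finset.sum_congr rfl fun a _ => hs a v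
  rw [h1, h2, sum_split huw huv hwv, if_pos rfl, mul_one]

/-- Undoing a splitting raises the capacity at `v` by `2 * α`, and the coverage of `v` by at most
`α`; both inequalities are preserved. The constant `ρ` stands for the capacity that was still
present at `v` when its remaining edges were deleted. -/
theorem foldl_undoSplit_spec {r v : V} (hvr : v ≠ r) {x x' : V → V → K}
    {recs : List (V × V × (V → V → K))} (hc : SplitChain v x recs x') (ρ : K)
    {L : List (K × (V → V))} (h : Dominated r x' L)
    (h1 : 2 * cov r L v ≤ ∑ a, x' a v - ρ)
    (h2 : 2 * ∑ z, used L z v ≤ 2 * cov r L v + (∑ a, x' a v - ρ)) :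
    Dominated r x (recs.foldl (undoSplit v) L) ∧
    (∀ z, z ≠ v → cov r (recs.foldl (undoSplit v) L) z = cov r L z) ∧
    2 * cov r (recs.foldl (undoSplit v) L) v ≤ ∑ a, x a v - ρ ∧
    2 * ∑ z, used (recs.foldl (undoSplit v) L) z v ≤
      2 * cov r (recs.foldl (undoSplit v) L) v + (∑ a, x a v - ρ) := by
  induction hc generalizing L with
  | nil => exact ⟨h, fun _ _ => rfl, h1, h2⟩
  | cons hc huw huv hwv hα hx hs ih =>
    obtain ⟨k1, k2, k3, k4⟩ := undoSplit_spec h huw huv hwv hvr hα hx hs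
    rw [sum_col_split huw huv hwv hs] at h1 h2
    obtain ⟨i1, i2, i3, i4⟩ := ih k1 (by linarith) (by linarith)
    exact ⟨i1, fun z hz => (i2 z hz).trans (k2 z hz), i3, i4⟩

/-- The state while `v` is attached as a leaf, up to total coverage `c`. -/
structure Attaching (r v : V) (x : V → V → K) (y : V → K) (c : K) (L : List (K × (V → V))) :
    Prop where
  dom : Dominated r x L
  cov_eq : ∀ z, z ≠ v → 0 ≤ y z → cov r L z = y z
  cov_le : cov r L v ≤ c
  room : c ≤ cov r L v + ∑ a, (x a v - used L a v)

/-- The attachments along `uv` end because the edge is full, because `v` is covered, or because no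
tree is left that contains `u` and misses `v`. In the last case the coverage of `v` is at least that
of `u`, which is at least `c` by `hmin`, so `v` is covered too. An eliminated `u` has no capacity
towards `v`. Each attachment uses as much capacity as it adds coverage, so `room` is kept. -/
theorem attachStep_spec {r v : V} {x : V → V → K} {y : V → K} {c : K} {L : List (K × (V → V))}
    (h : Attaching r v x y c L) (hvr : v ≠ r) (hs : ∀ a b, x a b = x b a)
    (hmin : ∀ u, 0 ≤ y u → c ≤ y u)     (hdead : ∀ u, y u < 0 → x u v = 0) (u : V) :
    Attaching r v x y c (attachStep r v x c L u) ∧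
    (u ≠ v → cov r (attachStep r v x c L u) v = c ∨ x u v - used (attachStep r v x c L u) u v = 0) ∧
    (cov r L v = c → cov r (attachStep r v x c L u) v = c) ∧
    ∀ a, a ≠ v → x a v - used L a v = 0 → x a v - used (attachStep r v x c L u) a v = 0 := by
  obtain ⟨A, hA, ht, hφ, hmem⟩ := greedy_spec (fun T : V → V => InT r T u ∧ ¬ InT r T v)
    (fun T => Function.update T v u) (min (x u v - used L u v) (c - cov r L v)) L h.dom.nonneg
    (fun T => if InT r T u ∧ ¬ InT r T v then 1 else 0) (fun _ h => if_pos h) (fun _ h => if_neg h)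
  change ∀ φ, wsum φ (attachStep r v x c L u) = _ at hφ
  change ∀ q ∈ attachStep r v x c L u, _ at hmem
  set L' := attachStep r v x c L u with hL'
  set t := wsum (fun _ => 1) A with htdef
  have huv : ∀ q ∈ A, u ≠ v := fun q hq e => by
    have := (hA q hq).2.1
    rw [e] at this
    exact this.2 this.1
  have hA0 : ∀ q ∈ A, 0 ≤ q.1 := fun q hq => (hA q hq).1
  have hused : ∀ a b, a ≠ b → used L' a b = used L a b + edgeInd K u v a b * t := by
    intro a b hab
    rw [used, hφ, ← wsum_const]
    refine congrArg₂ _ rfl (wsum_congr fun q hq => ?_)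
    rw [cnt_attach (huv q hq) (hA q hq).2.1.2 hab]
    ring
  have hcovv : cov r L' v = cov r L v + t := by
    rw [cov, hφ]
    refine congrArg₂ _ rfl (wsum_congr fun q hq => ?_)
    rw [mem_attach_self (huv q hq) (hA q hq).2.1.2]
    ring
  have ht0 : 0 ≤ t := ht ▸ le_max_left _ _
  have hW0 : 0 ≤ wsum (fun T : V → V => if InT r T u ∧ ¬ InT r T v then (1 : K) else 0) L :=
    wsum_nonneg h.dom.nonneg fun q _ => by split_ifs <;> norm_num
  have hc0 : 0 ≤ c - cov r L v := by linarith [h.cov_le]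
  have htle : t ≤ max 0 (min (x u v - used L u v) (c - cov r L v)) := by
    rw [ht]
    exact max_le_max le_rfl (min_le_left _ _)
  have htc : t ≤ c - cov r L v := htle.trans (max_le hc0 (min_le_right _ _))
  have htu : u ≠ v → t ≤ x u v - used L u v := fun huv' =>
    htle.trans (max_le (by linarith [h.dom.used_le u v huv']) (min_le_left _ _))
  have huv0 : u = v → t = 0 := fun e => by
    have : A = [] := List.eq_nil_iff_forall_not_mem.2 fun q hq => huv q hq e
    rw [htdef, this]
    simp [wsum]
  have hslack : ∀ a, a ≠ v → used L' a v = used L a v + if a = u then t else 0 := by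
    intro a hav
    rw [hused a v hav]
    by_cases hau : a = u
    · simp [edgeInd, hau]
    · simp [edgeInd, hau, hav]
  have hslackv : used L' v v = used L v v := by rw [used_self, used_self]
  refine ⟨⟨⟨fun q hq => (hmem q hq).1, fun q hq => ?_, ?_, fun a b hab => ?_⟩, fun z hz hyz => ?_,
    by linarith, ?_⟩, fun huv' => ?_, fun he => by linarith, fun a hav ha => ?_⟩
  · obtain ⟨_, q', hq', h1 | ⟨hP, h1⟩⟩ := hmem q hq
    · exact h1 ▸ h.dom.valid q' hq'
    · exact h1 ▸ (h.dom.valid q' hq').attach hP.1 hP.2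
  · rw [hφ, h.dom.total, wsum_congr (ψ := fun _ => 0) (fun q _ => sub_self _), wsum_const]
    simp
  · rw [hused a b hab]
    by_cases hc : (a = u ∧ b = v) ∨ (a = v ∧ b = u)
    · have e1 : edgeInd K u v a b = 1 := by rw [edgeInd, if_pos hc]
      rw [e1, one_mul]
      rcases hc with ⟨rfl, rfl⟩ | ⟨rfl, rfl⟩
      · linarith [htu hab]
      · have h1 := h.dom.used_le a b hab
        have h2 := htu hab.symm
        rw [hs, used_comm]
        linarith
    · rw [edgeInd, if_neg hc, zero_mul, add_zero]
      exact h.dom.used_le a b hab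
  · rw [← h.cov_eq z hz hyz, cov, hφ, wsum_congr (L := A) (ψ := fun _ => 0), wsum_const, zero_mul,
      add_zero, cov]
    intro q hq
    rw [mem_attach hz, sub_self]
  · have h1 : ∑ a, (x a v - used L a v) - t ≤ ∑ a, (x a v - used L' a v) := by
      have : ∑ a, (x a v - used L a v) - t =
          ∑ a, (x a v - used L a v - if a = u then t else 0) := by
        rw [Finset.sum_sub_distrib (f := fun a => x a v - used L a v), Finset.sum_ite_eq',
          if_pos (Finset.mem_univ u)]
      rw [this]
      refine Finset.sum_le_sum fun a _ => ?_
      by_cases hav : a = v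
      · rw [hav, hslackv]
        split_ifs <;> linarith
      · rw [hslack a hav]
        linarith
    linarith [h.room]
  · by_cases hyu : 0 ≤ y u
    · have hs0 : 0 ≤ x u v - used L u v := by linarith [h.dom.used_le u v huv']
      rw [max_eq_right (le_min (le_min hs0 hc0) hW0)] at ht
      rw [hslack u huv', if_pos rfl, hcovv]
      rcases min_choice (min (x u v - used L u v) (c - cov r L v))
        (wsum (fun T : V → V => if InT r T u ∧ ¬ InT r T v then (1 : K) else 0) L) with h1 | h1
      · rw [h1] at ht
        rcases min_choice (x u v - used L u v) (c - cov r L v) with h2 | h2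
        · right; rw [h2] at ht; linarith
        · left; rw [h2] at ht; linarith
      · left
        rw [h1] at ht
        have h2 : cov r L u ≤ cov r L v + t := by
          rw [ht, cov, cov, ← wsum_add]
          refine wsum_le_wsum h.dom.nonneg fun q _ => ?_
          unfold mem
          by_cases a1 : InT r q.2 u <;> by_cases a2 : InT r q.2 v <;> simp [a1, a2]
        have h3 := h.cov_eq u huv' hyu
        have h4 := hmin u hyu
        linarith
    · right
      have h1 := hdead u (not_le.1 hyu)
      have h2 := used_nonneg h.dom.nonneg u v
      have h3 := htu huv'
      have h4 := h.dom.used_le u v huv'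
      rw [hslack u huv', if_pos rfl]
      linarith
  · rw [hslack a hav]
    by_cases hau : a = u
    · rw [if_pos hau]
      have := htu (hau ▸ hav)
      rw [hau] at ha ⊢
      linarith
    · rw [if_neg hau]
      linarith

theorem foldl_attachStep_spec {r v : V} {x : V → V → K} {y : V → K} {c : K} (hvr : v ≠ r)
    (hs : ∀ a b, x a b = x b a) (hmin : ∀ u, 0 ≤ y u → c ≤ y u)
    (hdead : ∀ u, y u < 0 → x u v = 0) (l : List V) {L : List (K × (V → V))}
    (h : Attaching r v x y c L) :
    Attaching r v x y c (l.foldl (attachStep r v x c) L) ∧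
    (cov r L v = c → cov r (l.foldl (attachStep r v x c) L) v = c) ∧
    (∀ a, a ≠ v → x a v - used L a v = 0 →
      x a v - used (l.foldl (attachStep r v x c) L) a v = 0) ∧
    ∀ u ∈ l, u ≠ v → cov r (l.foldl (attachStep r v x c) L) v = c ∨
      x u v - used (l.foldl (attachStep r v x c) L) u v = 0 := by
  induction l generalizing L with
  | nil => exact ⟨h, fun e => e, fun _ _ e => e, by simp⟩
  | cons a l ih =>
    obtain ⟨k1, k2, k3, k4⟩ := attachStep_spec h hvr hs hmin hdead a
    obtain ⟨i1, i2, i3, i4⟩ := ih k1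
    refine ⟨i1, fun e => i2 (k3 e), fun b hb e => i3 b hb (k4 b hb e), fun u hu huv => ?_⟩
    rcases List.mem_cons.1 hu with rfl | hu
    · rcases k2 huv with h1 | h1
      · exact .inl (i2 h1)
      · exact .inr (i3 _ huv h1)
    · exact i4 u hu huv

/-- Weighted trees that are dominated by `x` and cover the vertices to the extent of `y`. -/
structure Covering (r : V) (x : V → V → K) (y : V → K) (L : List (K × (V → V))) : Prop where
  dom : Dominated r x L
  cov_eq : ∀ z, 0 ≤ y z → cov r L z = y z

theorem isolate_le {x : V → V → K} (hx : ∀ a b, 0 ≤ x a b) (v a b : V) :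
    isolate v x a b ≤ x a b := by
  unfold isolate
  split_ifs
  · exact hx a b
  · exact le_rfl

/-- At the beginning no tree contains `v`, as it is isolated; with `ρ = ∑ a, x' a v` both
inequalities of `foldl_undoSplit_spec` hold trivially. Afterwards the coverage is at most `y v - ρ /
2` and the usage at `v` exceeds it by at most `y v - ρ / 2`. Of the capacity `2 * y v` there remains
at least the missing coverage. -/
theorem Covering.undoElim {l : List V} (hl : ∀ a, a ∈ l) {r v : V} {x x' : V → V → K} {y : V → K}
    {recs : List (V × V × (V → V → K))} {L : List (K × (V → V))}
    (h : Covering r (isolate v x') (Function.update y v (-1)) L) (hvr : v ≠ r)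
    (hmin : ∀ u, 0 ≤ y u → y v ≤ y u) (hdead : ∀ u, y u < 0 → x u v = 0)
    (hdeg : ∑ u, x u v = 2 * y v) (hs : ∀ a b, x a b = x b a)
    (hd : ∀ a, x a a = 0) (hx' : ∀ a b, 0 ≤ x' a b) (hc : SplitChain v x recs x') :
    Covering r x y (undoElim l r L (v, y v, x, recs)) := by
  have hW : ∑ z, used L z v ≤ 0 := by
    refine Finset.sum_nonpos fun z _ => ?_
    by_cases hz : z = v
    · rw [hz, used_self]
    · have := h.dom.used_le z v hz
      rwa [isolate, if_pos (.inr rfl)] at this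
  have hcov0 : cov r L v ≤ 0 := by
    refine le_trans ?_ hW
    rw [← wsum_dg]
    exact wsum_le_wsum h.dom.nonneg fun q _ => mem_le_dg q.2 hvr
  have hcov0' : 0 ≤ cov r L v := wsum_nonneg h.dom.nonneg fun q _ => mem_nonneg r q.2 v
  have hdom : Dominated r x' L := ⟨h.dom.nonneg, h.dom.valid, h.dom.total, fun a b hab =>
    (h.dom.used_le a b hab).trans (isolate_le hx' v a b)⟩
  obtain ⟨k1, k2, k3, k4⟩ := foldl_undoSplit_spec hvr hc (∑ a, x' a v) hdom
    (by linarith) (by linarith)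
  have hρ : 0 ≤ ∑ a, x' a v := Finset.sum_nonneg fun a _ => hx' a v
  rw [hdeg] at k3 k4
  set M := recs.foldl (undoSplit v) L with hM
  have hatt : Attaching r v x y (y v) M := by
    refine ⟨k1, fun z hz hyz => ?_, by linarith, ?_⟩
    · rw [k2 z hz, h.cov_eq z (by rwa [Function.update_of_ne hz]), Function.update_of_ne hz]
    · rw [Finset.sum_sub_distrib, hdeg]
      linarith
  obtain ⟨j1, -, -, j4⟩ := foldl_attachStep_spec hvr hs hmin hdead l hatt
  change Covering r x y (l.foldl (attachStep r v x (y v)) M)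
  refine ⟨j1.dom, fun z hyz => ?_⟩
  by_cases hz : z = v
  · rw [hz]
    -- If `v` were not covered completely, every edge at `v` would be full, leaving no room for the
    -- missing coverage.
    by_contra hne
    have h1 : ∀ a, x a v - used (l.foldl (attachStep r v x (y v)) M) a v = 0 := fun a => by
      by_cases hav : a = v
      · rw [hav, used_self, hd, sub_zero]
      · exact (j4 a (hl a) hav).resolve_left hne
    have h2 := j1.room
    rw [Finset.sum_eq_zero fun a _ => h1 a, add_zero] at h2
    exact hne (le_antisymm j1.cov_le h2)
  · exact j1.cov_eq z hz hyz

theorem ElimChain.covering {l : List V} (hl : ∀ a, a ∈ l) {r : V} {x₀ x : V → V → K}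
    {y₀ y : V → K} {stack : List (ElimRec V K)} (h : ElimChain r x₀ y₀ stack x y)
    {L : List (K × (V → V))} (hL : Covering r x y L) :
    Covering r x₀ y₀ (stack.foldl (PCTSP.undoElim l r) L) := by
  induction h generalizing L with
  | nil => exact hL
  | cons _ hvr _ hmin hdead hdeg _ hs hd hx' hc ih =>
    exact ih (hL.undoElim hl hvr hmin hdead hdeg hs hd hx' hc)

theorem weightedTrees_spec {l : List V} (hl : ∀ a, a ∈ l) (hn : Fintype.card V ≤ l.length) {r : V}
    {x : V → V → K} {y : V → K} (h : Feas r x y) (hr : y r = 1) (h0 : ∀ u, 0 ≤ y u)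
    (h1 : ∀ u, y u ≤ 1) : Covering r x y (weightedTrees l r x y) := by
  obtain ⟨k1, k2⟩ := elimAll_spec hl hn h hr h0 h1
  -- The parent function `id` is the tree that consists of the root alone.
  refine k1.chain.covering hl ⟨⟨by simp, by simp [valid_id], by simp [wsum], fun a b hab => ?_⟩,
    fun z hz => ?_⟩
  · have : used [((1 : K), (id : V → V))] a b = 0 := by
      simp [used, wsum, cnt, hab, hab.symm]
    rw [this]
    exact k1.feas.nonneg a b
  · by_cases hzr : z = r
    · rw [hzr, k1.root]
      simp [cov, wsum, mem, InT]
    · exact absurd (k2 z hzr) (not_lt.2 hz)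

end Undo

end PCTSP

namespace PCTSP

/-! ### From parent functions to subgraphs -/

section Subgraphs

variable {V : Type*} [DecidableEq V]

/-- The subgraph of the complete graph that belongs to a tree. -/
def toSub (r : V) (T : V → V) : (⊤ : SimpleGraph V).Subgraph where
  verts := {v | InT r T v}
  Adj u w := u ≠ w ∧ InT r T u ∧ InT r T w ∧ (T w = u ∨ T u = w)
  adj_sub h := h.1
  edge_vert h := h.2.1
  symm := ⟨fun _ _ h => ⟨h.1.symm, h.2.2.1, h.2.1, h.2.2.2.symm⟩⟩

theorem mem_verts_toSub {r : V} {T : V → V} {v : V} : v ∈ (toSub r T).verts ↔ InT r T v := Iff.rfl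

theorem Valid.adj_parent {r : V} {T : V → V} (h : Valid r T) {v : V} (hv : T v ≠ v) :
    (toSub r T).Adj v (T v) :=
  ⟨hv.symm, .inr hv, h.inT_parent (.inr hv), .inr rfl⟩

theorem adj_toSub_iff {r : V} {T : V → V} (h : Valid r T) {u w : V} :
    (toSub r T).Adj u w ↔ u ≠ w ∧ (T w = u ∨ T u = w) := by
  refine ⟨fun hA => ⟨hA.1, hA.2.2.2⟩, fun ⟨h1, h2⟩ => ?_⟩
  rcases h2 with rfl | rfl
  · exact (h.adj_parent h1).symm
  · exact h.adj_parent h1.symm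

/-- Induction on the number of steps to the root. If both functions agree at the parent of `v`, the
edge between `v` and this parent cannot be oriented towards `v` in the second tree, since that would
give a cycle in the first. -/
theorem Valid.toSub_injective {r : V} {T T' : V → V} (h : Valid r T) (h' : Valid r T')
    (e : toSub r T = toSub r T') : T = T' := by
  have hin : ∀ v, InT r T v ↔ InT r T' v := fun v => by
    rw [← mem_verts_toSub, e, mem_verts_toSub]
  have key : ∀ k v, T^[k] v = r → T v = T' v := by
    intro k
    induction k with
    | zero =>
      intro v hv
      rw [show v = r from hv, h.1, h'.1]
    | succ k ih =>
      intro v hv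
      by_cases hvr : v = r
      · rw [hvr, h.1, h'.1]
      by_cases hTv : T v = v
      · by_contra hne
        have : InT r T v := (hin v).2 (.inr fun e' => hne (hTv.trans e'.symm))
        exact this.elim hvr fun h1 => h1 hTv
      · have h1 := ih (T v) hv
        have h2 := h.adj_parent hTv
        rw [e, adj_toSub_iff h'] at h2
        rcases h2.2 with h3 | h3
        · exact absurd ⟨1, by rw [Function.iterate_one, h1, h3]⟩ (h.not_anc hTv)
        · exact h3.symm
  funext v
  by_cases hv : InT r T v
  · obtain ⟨k, hk⟩ := h.reach hv
    exact key k v hk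
  · have hv' := mt (hin v).2 hv
    unfold InT at hv hv'
    push Not at hv hv'
    rw [hv.2, hv'.2]

/-- The graph is connected through the root, and mapping each edge to its lower end injects the
edges into the vertices other than the root. -/
theorem Valid.isTree [Finite V] {r : V} {T : V → V} (h : Valid r T) :
    (toSub r T).coe.IsTree := by
  have hr : InT r T r := .inl rfl
  have hconn : (toSub r T).coe.Connected := by
    rw [SimpleGraph.connected_iff_exists_forall_reachable]
    refine ⟨⟨r, hr⟩, fun ⟨v, hv⟩ => ?_⟩
    have key : ∀ k v (hv : InT r T v), T^[k] v = r →
        (toSub r T).coe.Reachable ⟨r, hr⟩ ⟨v, hv⟩ := by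
      intro k
      induction k with
      | zero =>
        intro v hv e
        have e : v = r := e
        subst e
        exact SimpleGraph.Reachable.refl _
      | succ k ih =>
        intro v hv e
        by_cases hTv : T v = v
        · rcases hv with rfl | hv
          · exact SimpleGraph.Reachable.refl _
          · exact absurd hTv hv
        · refine (ih (T v) (h.inT_parent hv) e).trans (SimpleGraph.Adj.reachable ?_)
          exact (h.adj_parent hTv).symm
    obtain ⟨k, hk⟩ := h.reach hv
    exact key k v hv hk
  rw [SimpleGraph.isTree_iff_connected_and_card]
  refine ⟨hconn, le_antisymm ?_ hconn.card_vert_le_card_edgeSet_add_one⟩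
  have hsurj : ∀ e : (toSub r T).coe.edgeSet, ∃ v : {v : (toSub r T).verts // v ≠ ⟨r, hr⟩},
      e.1 = s(v.1, ⟨T v.1.1, h.inT_parent v.1.2⟩) := by
    rintro ⟨e, he⟩
    induction e using Sym2.inductionOn with
    | hf a b =>
      have hab : (toSub r T).Adj a.1 b.1 := he
      rcases hab.2.2.2 with h1 | h1
      · refine ⟨⟨b, fun e' => hab.1 ?_⟩, ?_⟩
        · rw [← h1, e']; exact h.1
        · simp only [h1]
          exact Sym2.eq_swap
      · refine ⟨⟨a, fun e' => hab.1 ?_⟩, ?_⟩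
        · rw [← h1, e']; exact h.1.symm
        · simp only [h1]
  choose f hf using hsurj
  have hinj : Function.Injective f := fun e e' hee => Subtype.ext (by rw [hf e, hf e', hee])
  have h1 := Nat.card_le_card_of_injective f hinj
  have h2 : Nat.card {v : (toSub r T).verts // v ≠ ⟨r, hr⟩} + 1 = Nat.card (toSub r T).verts := by
    classical
    have := Fintype.ofFinite (toSub r T).verts
    rw [Nat.card_eq_fintype_card, Nat.card_eq_fintype_card, Fintype.card_subtype_compl,
      Fintype.card_subtype_eq]
    have : 0 < Fintype.card (toSub r T).verts := Fintype.card_pos_iff.2 ⟨⟨r, hr⟩⟩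
    omega
  omega

end Subgraphs

/-! ### Decomposition of a feasible solution of the linear program -/

section Partition

variable {V K : Type*} [Fintype V] [DecidableEq V] [Field K] [LinearOrder K]
  [IsStrictOrderedRing K]

/-- The matrix of the edge values. -/
def toMatrix (x : Sym2 V → K) : V → V → K := fun u w => if u = w then 0 else x s(u, w)

theorem cutv_toMatrix (x : Sym2 V → K) (S : Finset V) :
    cutv (toMatrix x) S = ∑ e ∈ cut S, x e := by
  unfold cutv
  rw [← Finset.sum_product']
  refine Finset.sum_bij (fun p _ => s(p.1, p.2)) ?_ ?_ ?_ ?_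
  · rintro ⟨a, b⟩ hp
    simp only [Finset.mem_product, Finset.mem_compl] at hp
    simp only [cut, Finset.mem_filter, Finset.mem_univ, true_and]
    exact ⟨a, hp.1, b, hp.2, rfl⟩
  · rintro ⟨a, b⟩ hp ⟨a', b'⟩ hp' e
    simp only [Finset.mem_product, Finset.mem_compl] at hp hp'
    rcases Sym2.eq_iff.1 e with ⟨rfl, rfl⟩ | ⟨rfl, rfl⟩
    · rfl
    · exact absurd hp'.1 hp.2
  · intro e he
    simp only [cut, Finset.mem_filter, Finset.mem_univ, true_and] at he
    obtain ⟨u, hu, v, hv, rfl⟩ := he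
    exact ⟨(u, v), by simp [hu, hv], rfl⟩
  · rintro ⟨a, b⟩ hp
    simp only [Finset.mem_product, Finset.mem_compl] at hp
    rw [toMatrix, if_neg]
    exact fun e : a = b => hp.2 (e ▸ hp.1)

theorem IsFeasible.feas {r : V} {x : Sym2 V → K} {y : V → K} (h : IsFeasible r x y) :
    Feas r (toMatrix x) y := by
  have hd : ∀ a, toMatrix x a a = 0 := fun a => if_pos rfl
  refine ⟨fun a b => ?_, hd, fun a b => ?_, fun u hu _ => ?_, fun u => ?_, fun S z hr hz => ?_⟩
  · unfold toMatrix
    rw [Sym2.eq_swap]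
    exact if_congr eq_comm rfl rfl
  · unfold toMatrix
    split_ifs with hab
    · rfl
    · exact h.edge_nonneg _ (by simpa using hab)
  · rw [← cutv_singleton hd, cutv_toMatrix, h.degree_eq u hu]
  · rw [← cutv_singleton hd, cutv_toMatrix]
    by_cases hu : u = r
    · rw [hu]; exact h.degree_root_le
    · rw [h.degree_eq u hu]
      linarith [(h.vertex_mem u).2]
  · rw [cutv_toMatrix]
    exact h.cut_ge S hr z hz

open Classical in
/-- The trees that occur in a weighted family. -/
noncomputable def treeSet (r : V) (L : List (K × (V → V))) :
    Finset (⊤ : SimpleGraph V).Subgraph := (L.map fun q => toSub r q.2).toFinset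

open Classical in
/-- The total weight of a tree in a weighted family. -/
noncomputable def treeWeight (r : V) (L : List (K × (V → V)))
    (H : (⊤ : SimpleGraph V).Subgraph) : K :=
  wsum (fun T => if toSub r T = H then 1 else 0) L

/-- Equal trees of the family are merged and their weights added; exchanging the sums shows that no
weighted sum changes. -/
theorem sum_treeSet (r : V) (L : List (K × (V → V))) (φ : (⊤ : SimpleGraph V).Subgraph → K) :
    ∑ H ∈ treeSet r L, treeWeight r L H * φ H = wsum (fun T => φ (toSub r T)) L := by
  classical
  have h1 : ∀ H, treeWeight r L H * φ H = wsum (fun T => if toSub r T = H then φ H else 0) L := by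
    intro H
    rw [mul_comm, treeWeight, wsum, wsum, ← List.sum_map_mul_left]
    congr 1
    refine List.map_congr_left fun q _ => ?_
    split_ifs <;> ring
  rw [Finset.sum_congr rfl fun H _ => h1 H, ← wsum_sum]
  refine wsum_congr fun q hq => ?_
  rw [Finset.sum_ite_eq, if_pos]
  unfold treeSet
  rw [List.mem_toFinset]
  exact List.mem_map_of_mem (f := fun q : K × (V → V) => toSub r q.2) hq

theorem Covering.isTreePartition {r : V} {x : Sym2 V → K} {y : V → K} {L : List (K × (V → V))}
    (h : Covering r (toMatrix x) y L) (hy : ∀ v, 0 ≤ y v) :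
    IsTreePartition r x y (treeSet r L) (treeWeight r L) := by
  classical
  have hmem : ∀ H ∈ treeSet r L, ∃ q ∈ L, toSub r q.2 = H := fun H hH => by
    simpa [treeSet] using hH
  have h0 : ∀ H, 0 ≤ treeWeight r L H := fun H =>
    wsum_nonneg h.dom.nonneg fun q _ => by split_ifs <;> norm_num
  have hsum : ∑ H ∈ treeSet r L, treeWeight r L H = 1 := by
    have := sum_treeSet r L fun _ => 1
    simp only [mul_one] at this
    rw [this, h.dom.total]
  refine ⟨fun H hH => ?_, fun H hH => ?_, fun H hH => ⟨h0 H, ?_⟩, hsum, fun e he => ?_,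
    fun v => ?_⟩
  · obtain ⟨q, hq, rfl⟩ := hmem H hH
    exact (h.dom.valid q hq).isTree
  · obtain ⟨q, hq, rfl⟩ := hmem H hH
    exact mem_verts_toSub.2 (.inl rfl)
  · rw [← hsum]
    exact Finset.single_le_sum (fun H _ => h0 H) hH
  · rw [sum_treeSet r L fun H => H.edgeSet.indicator (fun _ => (1 : K)) e]
    induction e using Sym2.inductionOn with
    | hf a b =>
      have hab : a ≠ b := by simpa using he
      have h1 := h.dom.used_le a b hab
      rw [toMatrix, if_neg hab] at h1
      refine le_trans (wsum_le_wsum h.dom.nonneg fun q hq => ?_) h1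
      by_cases hA : (toSub r q.2).Adj a b
      · rw [Set.indicator_of_mem (by simpa using hA)]
        have := hA.2.2.2
        rw [cnt, if_neg hab]
        split_ifs <;> first | (exfalso; tauto) | norm_num
      · rw [Set.indicator_of_notMem (by simpa using hA)]
        exact cnt_nonneg _ _ _
  · rw [Finset.sum_filter, ← h.cov_eq v (hy v)]
    have := sum_treeSet r L fun H => if v ∈ H.verts then 1 else 0
    simp only [mul_ite, mul_one, mul_zero] at this
    rw [this]
    exact wsum_congr fun q _ => if_congr mem_verts_toSub rfl rfl

theorem IsFeasible.isTreePartition {l : List V} (hl : ∀ a, a ∈ l)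
    (hn : Fintype.card V ≤ l.length) {r : V} {x : Sym2 V → K} {y : V → K} (h : IsFeasible r x y) :
    IsTreePartition r x y (treeSet r (weightedTrees l r (toMatrix x) y))
      (treeWeight r (weightedTrees l r (toMatrix x) y)) :=
  (weightedTrees_spec hl hn h.feas h.root_eq (fun u => (h.vertex_mem u).1)
    fun u => (h.vertex_mem u).2).isTreePartition fun u => (h.vertex_mem u).1

end Partition

end PCTSP

namespace PCTSP

/-! ### Minimum cuts by augmenting along widest paths -/

section Augmenting

variable {V K : Type*} [DecidableEq V] [Field K] [LinearOrder K]

/-- An arc of largest capacity that leaves the tree `q` rooted at `s`. -/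
def widestArc (l : List V) (c : V → V → K) (s t : V) (q : V → V) : V × V :=
  (pairs l).foldl (fun p a =>
    if InT s q a.1 ∧ ¬ InT s q a.2 ∧ c p.1 p.2 ≤ c a.1 a.2 then a else p) (s, t)

/-- Add the widest arc to the tree unless the tree contains `t`. The second component is a lower
bound for the capacities of the arcs of the tree. -/
def growStep (l : List V) (c : V → V → K) (s t : V) (g : (V → V) × K) : (V → V) × K :=
  if InT s g.1 t then g else
    (Function.update g.1 (widestArc l c s t g.1).2 (widestArc l c s t g.1).1,
      min g.2 (c (widestArc l c s t g.1).1 (widestArc l c s t g.1).2))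

/-- A tree of wide arcs from `s` to `t`. -/
def grow (l : List V) (c : V → V → K) (s t : V) : (V → V) × K :=
  l.foldl (fun g _ => growStep l c s t g) (id, (l.map (c s)).sum)

/-- Send `b` units of flow from `u` to `w`. -/
def push (c : V → V → K) (u w : V) (b : K) : V → V → K := fun a a' =>
  c a a' - (if a = u ∧ a' = w then b else 0) + if a = w ∧ a' = u then b else 0

/-- Send flow to the second component from its parent. -/
def walkStep (q : V → V) (b : K) (p : (V → V → K) × V) : (V → V → K) × V :=
  if q p.2 = p.2 then p else (push p.1 (q p.2) p.2 b, q p.2)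

/-- Send `b` units of flow along the path of the tree `q` that ends in `t`. -/
def augment (l : List V) (c : V → V → K) (t : V) (g : (V → V) × K) : V → V → K :=
  (l.foldl (fun p _ => walkStep g.1 g.2 p) (c, t)).1

/-- The capacities after `k` augmentations. -/
def residual (l : List V) (x : V → V → K) (s t : V) : ℕ → V → V → K
  | 0 => x
  | k + 1 => augment l (residual l x s t k) t (grow l (residual l x s t k) s t)

variable [IsStrictOrderedRing K]

theorem widestArc_spec {l : List V} {c : V → V → K} {s t : V} {q : V → V} (ht : ¬ InT s q t) :
    (InT s q (widestArc l c s t q).1 ∧ ¬ InT s q (widestArc l c s t q).2) ∧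
    ∀ u ∈ l, ∀ w ∈ l, InT s q u → ¬ InT s q w →
      c u w ≤ c (widestArc l c s t q).1 (widestArc l c s t q).2 := by
  have key : ∀ (L : List (V × V)) (p : V × V), InT s q p.1 → ¬ InT s q p.2 →
      let m := L.foldl (fun p a =>
        if InT s q a.1 ∧ ¬ InT s q a.2 ∧ c p.1 p.2 ≤ c a.1 a.2 then a else p) p
      (InT s q m.1 ∧ ¬ InT s q m.2) ∧ c p.1 p.2 ≤ c m.1 m.2 ∧
        ∀ a ∈ L, InT s q a.1 → ¬ InT s q a.2 → c a.1 a.2 ≤ c m.1 m.2 := by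
    intro L
    induction L with
    | nil => intro p h1 h2; exact ⟨⟨h1, h2⟩, le_rfl, by simp⟩
    | cons a L ih =>
      intro p h1 h2
      simp only [List.foldl_cons]
      by_cases h : InT s q a.1 ∧ ¬ InT s q a.2 ∧ c p.1 p.2 ≤ c a.1 a.2
      · rw [if_pos h]
        obtain ⟨i1, i2, i3⟩ := ih a h.1 h.2.1
        refine ⟨i1, h.2.2.trans i2, fun b hb hb1 hb2 => ?_⟩
        rcases List.mem_cons.1 hb with rfl | hb
        · exact i2
        · exact i3 b hb hb1 hb2
      · rw [if_neg h]
        obtain ⟨i1, i2, i3⟩ := ih p h1 h2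
        refine ⟨i1, i2, fun b hb hb1 hb2 => ?_⟩
        rcases List.mem_cons.1 hb with rfl | hb
        · refine le_trans (le_of_not_ge fun hc => h ⟨hb1, hb2, hc⟩) i2
        · exact i3 b hb hb1 hb2
  -- The pair `(s, t)` itself leaves the tree, so it is an admissible initial value.
  obtain ⟨h1, _, h3⟩ := key (pairs l) (s, t) (.inl rfl) ht
  exact ⟨h1, fun u hu w hw hu' hw' => h3 (u, w) (mem_pairs hu hw) hu' hw'⟩

variable [Fintype V]

/-- `q` is a tree with root `s` whose arcs have capacity at least `b`, together with a depth
function. -/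
structure WideTree (c : V → V → K) (s : V) (q : V → V) (b : K) (rank : V → ℕ) : Prop where
  root : q s = s
  rank_lt : ∀ a, q a ≠ a → rank (q a) < rank a
  inT : ∀ a, q a ≠ a → InT s q (q a)
  le : ∀ a, q a ≠ a → b ≤ c (q a) a

/-- If `uw` is a widest arc that leaves the current tree, the cut around this tree consists of at
most `n ^ 2` arcs of capacity at most `c u w`. Hence the running minimum is always accompanied by a
cut that is at most `n ^ 2` times as large. Each round adds a vertex, and the new vertex gets rank
`k + 1`, above all ranks so far. -/
theorem growStep_spec {l : List V} (hl : ∀ a, a ∈ l) {c : V → V → K} (hc : ∀ a b, 0 ≤ c a b)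
    {s t : V} {g : (V → V) × K} {k : ℕ}
    (h : (∃ rank : V → ℕ, WideTree c s g.1 g.2 rank ∧ ∀ a, rank a ≤ k) ∧ 0 ≤ g.2 ∧
      (∃ S, s ∈ S ∧ t ∉ S ∧ cutv c S ≤ (Fintype.card V) ^ 2 * g.2) ∧
      (InT s g.1 t ∨ k + 1 ≤ (Finset.univ.filter fun a => InT s g.1 a).card)) :
    (∃ rank : V → ℕ, WideTree c s (growStep l c s t g).1 (growStep l c s t g).2 rank ∧
        ∀ a, rank a ≤ k + 1) ∧ 0 ≤ (growStep l c s t g).2 ∧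
      (∃ S, s ∈ S ∧ t ∉ S ∧ cutv c S ≤ (Fintype.card V) ^ 2 * (growStep l c s t g).2) ∧
      (InT s (growStep l c s t g).1 t ∨
        k + 1 + 1 ≤ (Finset.univ.filter fun a => InT s (growStep l c s t g).1 a).card) := by
  obtain ⟨⟨rank, hT, hr⟩, hb, ⟨S, hsS, htS, hS⟩, hcard⟩ := h
  unfold growStep
  by_cases ht : InT s g.1 t
  · rw [if_pos ht]
    exact ⟨⟨rank, hT, fun a => (hr a).trans (Nat.le_succ k)⟩, hb, ⟨S, hsS, htS, hS⟩, .inl ht⟩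
  rw [if_neg ht]
  obtain ⟨⟨h1, h2⟩, h3⟩ := widestArc_spec (l := l) (c := c) ht
  obtain ⟨q, b⟩ := g
  simp only at *
  generalize widestArc l c s t q = p at *
  obtain ⟨u, w⟩ := p
  simp only at *
  have hws : w ≠ s := fun e => h2 (.inl e)
  have hqw : q w = w := by
    by_contra hne
    exact h2 (.inr hne)
  have huw : u ≠ w := fun e => h2 (e ▸ h1)
  have hup : ∀ a, a ≠ w → Function.update q w u a = q a := fun a ha => Function.update_of_ne ha _ _
  have hin : ∀ a, InT s (Function.update q w u) a ↔ a = w ∨ InT s q a := by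
    intro a
    by_cases ha : a = w
    · subst ha
      simp [InT, huw]
    · simp [InT, ha]
  refine ⟨⟨Function.update rank w (k + 1), ⟨?_, ?_, ?_, ?_⟩, ?_⟩, le_min hb (hc _ _), ?_, .inr ?_⟩
  · rw [hup s hws.symm, hT.root]
  · intro a ha
    by_cases haw : a = w
    · subst haw
      rw [Function.update_self, Function.update_self, Function.update_of_ne huw]
      exact Nat.lt_succ_of_le (hr u)
    · rw [hup a haw] at ha ⊢
      have : q a ≠ w := fun e => h2 (e ▸ hT.inT a ha)
      rw [Function.update_of_ne haw, Function.update_of_ne this]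
      exact hT.rank_lt a ha
  · intro a ha
    rw [hin]
    by_cases haw : a = w
    · subst haw
      rw [Function.update_self]
      exact .inr h1
    · rw [hup a haw] at ha ⊢
      exact .inr (hT.inT a ha)
  · intro a ha
    by_cases haw : a = w
    · subst haw
      rw [Function.update_self]
      exact min_le_right _ _
    · rw [hup a haw] at ha ⊢
      exact (min_le_left _ _).trans (hT.le a ha)
  · intro a
    by_cases haw : a = w
    · subst haw
      rw [Function.update_self]
    · rw [Function.update_of_ne haw]
      exact (hr a).trans (Nat.le_succ k)
  · rcases min_choice b (c u w) with e | e <;> rw [e]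
    · exact ⟨S, hsS, htS, hS⟩
    · refine ⟨Finset.univ.filter fun a => InT s q a,
        Finset.mem_filter.2 ⟨Finset.mem_univ _, .inl rfl⟩, by simpa using ht, ?_⟩
      rw [cutv_eq]
      refine (Finset.sum_le_card_nsmul _ _ (Fintype.card V * c u w) fun a _ => ?_).trans
        (le_of_eq ?_)
      · refine (Finset.sum_le_card_nsmul _ _ (c u w) fun a' _ => ?_).trans (le_of_eq ?_)
        · split_ifs with hh
          · simp only [Finset.mem_filter, Finset.mem_univ, true_and] at hh
            exact h3 a (hl a) a' (hl a') hh.1 hh.2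
          · exact hc _ _
        · rw [nsmul_eq_mul, Finset.card_univ]
      · rw [nsmul_eq_mul, Finset.card_univ]
        ring
  · have e : (Finset.univ.filter fun a => InT s (Function.update q w u) a) =
        insert w (Finset.univ.filter fun a => InT s q a) := by
      ext a
      simp [hin]
    rw [e, Finset.card_insert_of_notMem (by simpa using h2)]
    rcases hcard with h | h
    · exact absurd h ht
    · omega

theorem grow_spec {l : List V} (hl : ∀ a, a ∈ l) (hn : l.length = Fintype.card V) {c : V → V → K}
    (hc : ∀ a b, 0 ≤ c a b) {s t : V} (hst : s ≠ t) (hnd : l.Nodup) :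
    (∃ rank : V → ℕ, WideTree c s (grow l c s t).1 (grow l c s t).2 rank ∧
      ∀ a, rank a ≤ l.length) ∧ 0 ≤ (grow l c s t).2 ∧
    (∃ S, s ∈ S ∧ t ∉ S ∧ cutv c S ≤ (Fintype.card V) ^ 2 * (grow l c s t).2) ∧
    InT s (grow l c s t).1 t := by
  have key : ∀ (m : List V) (g : (V → V) × K) (k : ℕ),
      ((∃ rank : V → ℕ, WideTree c s g.1 g.2 rank ∧ ∀ a, rank a ≤ k) ∧ 0 ≤ g.2 ∧
      (∃ S, s ∈ S ∧ t ∉ S ∧ cutv c S ≤ (Fintype.card V) ^ 2 * g.2) ∧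
      (InT s g.1 t ∨ k + 1 ≤ (Finset.univ.filter fun a => InT s g.1 a).card)) →
      let g' := m.foldl (fun g _ => growStep l c s t g) g
      (∃ rank : V → ℕ, WideTree c s g'.1 g'.2 rank ∧ ∀ a, rank a ≤ k + m.length) ∧ 0 ≤ g'.2 ∧
      (∃ S, s ∈ S ∧ t ∉ S ∧ cutv c S ≤ (Fintype.card V) ^ 2 * g'.2) ∧
      (InT s g'.1 t ∨ k + m.length + 1 ≤ (Finset.univ.filter fun a => InT s g'.1 a).card) := by
    intro m
    induction m with
    | nil => intro g k h; exact h
    | cons a m ih =>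
      intro g k h
      have := ih _ _ (growStep_spec hl hc h)
      simp only [List.foldl_cons, List.length_cons] at this ⊢
      rwa [show k + (m.length + 1) = k + 1 + m.length by omega]
  have hb : 0 ≤ (l.map (c s)).sum := List.sum_nonneg (by
    intro z hz
    obtain ⟨a, _, rfl⟩ := List.mem_map.1 hz
    exact hc _ _)
  have hsum : (l.map (c s)).sum = ∑ a, c s a := by
    rw [← List.sum_toFinset _ hnd]
    congr 1
    ext a
    simp [hl]
  have := key l (id, (l.map (c s)).sum) 0 ⟨⟨fun _ => 0, ⟨rfl, fun a h => absurd rfl h,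
    fun a h => absurd rfl h, fun a h => absurd rfl h⟩, fun _ => le_rfl⟩, hb,
    ⟨{s}, by simp, by simpa using hst.symm, ?_⟩, .inr ?_⟩
  · obtain ⟨h1, h2, h3, h4⟩ := this
    rw [zero_add] at h1 h4
    refine ⟨h1, h2, h3, h4.resolve_right fun h => ?_⟩
    have := (Finset.univ.filter fun a => InT s (grow l c s t).1 a).card_le_univ
    rw [hn] at h
    exact absurd (h.trans this) (by omega)
  · simp only
    -- The starting value is the total capacity out of `s`, so `{s}` is the initial witness.
    have h1 : cutv c {s} ≤ (l.map (c s)).sum := by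
      rw [hsum, cutv, Finset.sum_singleton]
      exact Finset.sum_le_univ_sum_of_nonneg fun a => hc _ _
    have h2 : (1 : K) ≤ (Fintype.card V : K) ^ 2 :=
      one_le_pow₀ (by exact_mod_cast Fintype.card_pos_iff.2 ⟨s⟩)
    exact h1.trans (le_mul_of_one_le_left hb h2)
  · rw [zero_add]
    exact Finset.card_pos.2 ⟨s, by simp [InT]⟩

theorem cutv_push (c : V → V → K) (u w : V) (b : K) (S : Finset V) :
    cutv (push c u w b) S =
      cutv c S - b * ((if u ∈ S then 1 else 0) - if w ∈ S then 1 else 0) := by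
  have h : ∀ (u w : V), cutv (fun a a' => if a = u ∧ a' = w then b else 0) S =
      if u ∈ S ∧ w ∉ S then b else 0 := by
    intro u w
    unfold cutv
    simp only [ite_and, Finset.sum_ite_irrel, Finset.sum_const_zero, Finset.sum_ite_eq',
      Finset.mem_compl]
  have e : cutv (push c u w b) S = cutv c S - cutv (fun a a' => if a = u ∧ a' = w then b else 0) S
      + cutv (fun a a' => if a = w ∧ a' = u then b else 0) S := by
    unfold cutv push
    simp only [Finset.sum_add_distrib, Finset.sum_sub_distrib]
  rw [e, h, h]
  by_cases h1 : u ∈ S <;> by_cases h2 : w ∈ S <;> simp [h1, h2]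

/-- The total capacity of the two directions of an edge is invariant; with nonnegativity this bounds
all residual capacities by the initial ones. -/
theorem push_add (c : V → V → K) (u w : V) (b : K) (a a' : V) :
    push c u w b a a' + push c u w b a' a = c a a' + c a' a := by
  unfold push
  have e1 : (a' = u ∧ a = w) = (a = w ∧ a' = u) := propext and_comm
  have e2 : (a' = w ∧ a = u) = (a = u ∧ a' = w) := propext and_comm
  simp only [e1, e2]
  ring

/-- The walk from `t` to `s` descends strictly in rank, so arcs yet to be used are untouched and
still have capacity `b`. At any moment the cuts look as if `b` units had been sent from the current
vertex to `t`. -/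
theorem augment_spec {l : List V} {c : V → V → K} (hc : ∀ a b, 0 ≤ c a b) {s t : V}
    {g : (V → V) × K} {rank : V → ℕ} (hT : WideTree c s g.1 g.2 rank)
    (hr : ∀ a, rank a ≤ l.length) (hb : 0 ≤ g.2) (ht : InT s g.1 t) :
    (∀ a b, 0 ≤ augment l c t g a b) ∧
    (∀ a b, augment l c t g a b + augment l c t g b a = c a b + c b a) ∧
    ∀ S, cutv (augment l c t g) S =
      cutv c S - g.2 * ((if s ∈ S then 1 else 0) - if t ∈ S then 1 else 0) := by
  obtain ⟨q, b⟩ := g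
  simp only at *
  have key : ∀ (m : List V) (p : (V → V → K) × V), (∀ a a', 0 ≤ p.1 a a') →
      (∀ a a', p.1 a a' + p.1 a' a = c a a' + c a' a) →
      (∀ a, q a ≠ a → rank a ≤ rank p.2 → b ≤ p.1 (q a) a) → InT s q p.2 →
      (∀ S, cutv p.1 S = cutv c S - b * ((if p.2 ∈ S then 1 else 0) - if t ∈ S then 1 else 0)) →
      (rank p.2 ≤ m.length ∨ q p.2 = p.2) →
      let p' := m.foldl (fun p _ => walkStep q b p) p
      (∀ a a', 0 ≤ p'.1 a a') ∧ (∀ a a', p'.1 a a' + p'.1 a' a = c a a' + c a' a) ∧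
      (∀ S, cutv p'.1 S =
        cutv c S - b * ((if p'.2 ∈ S then 1 else 0) - if t ∈ S then 1 else 0)) ∧
      InT s q p'.2 ∧ q p'.2 = p'.2 := by
    intro m
    induction m with
    | nil =>
      intro p h1 h2 h3 h4 h5 h6
      refine ⟨h1, h2, h5, h4, ?_⟩
      rcases h6 with h6 | h6
      · by_contra hne
        have := hT.rank_lt _ hne
        simp only [List.foldl_nil, List.length_nil] at this h6
        omega
      · exact h6
    | cons z m ih =>
      intro p h1 h2 h3 h4 h5 h6
      rw [List.foldl_cons]
      by_cases hp : q p.2 = p.2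
      · have e : walkStep q b p = p := by rw [walkStep, if_pos hp]
        rw [e]
        exact ih p h1 h2 h3 h4 h5 (.inr hp)
      · have e : walkStep q b p = (push p.1 (q p.2) p.2 b, q p.2) := by rw [walkStep, if_neg hp]
        rw [e]
        have hlt := hT.rank_lt _ hp
        refine ih _ (fun a a' => ?_) (fun a a' => ?_) (fun a ha har => ?_) (hT.inT _ hp)
          (fun S => ?_) (.inl ?_)
        · have h7 := h3 p.2 hp le_rfl
          have h8 := h1 a a'
          simp only [push]
          by_cases h9 : a = q p.2 ∧ a' = p.2
          · rw [if_pos h9, h9.1, h9.2]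
            split_ifs <;> linarith
          · rw [if_neg h9]
            split_ifs <;> linarith
        · rw [push_add, h2]
        · simp only at har
          have h7 := h3 a ha (har.trans hlt.le)
          have h8 : ¬ (q a = q p.2 ∧ a = p.2) := by
            rintro ⟨_, rfl⟩
            omega
          simp only [push, if_neg h8]
          split_ifs <;> linarith
        · simp only
          rw [cutv_push, h5]
          ring
        · rcases h6 with h6 | h6
          · simp only [List.length_cons] at h6 ⊢
            omega
          · exact absurd h6 hp
  obtain ⟨h1, h2, h3, h4, h5⟩ := key l (c, t) hc (fun _ _ => rfl) (fun a ha _ => hT.le a ha) ht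
    (fun S => by simp) (.inl (hr t))
  have hs : (l.foldl (fun p _ => walkStep q b p) (c, t)).2 = s := by
    rcases h4 with h4 | h4
    · exact h4
    · exact absurd h5 h4
  rw [hs] at h3
  exact ⟨h1, h2, h3⟩

theorem mincut_eq_of_cutv {x c : V → V → K} {s t : V} (hst : s ≠ t) {f : K}
    (h : ∀ S, s ∈ S → t ∉ S → cutv c S = cutv x S - f) : mincut c s t = mincut x s t - f := by
  obtain ⟨S, h1, h2, h3⟩ := exists_mincut c hst
  obtain ⟨T, k1, k2, k3⟩ := exists_mincut x hst
  have h4 := mincut_le c k1 k2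
  have h5 := mincut_le x h1 h2
  rw [h T k1 k2] at h4
  rw [h S h1 h2] at h3
  exact le_antisymm (by rw [k3]; exact h4) (by rw [h3]; linarith)

theorem mincut_nonneg {x : V → V → K} (hx : ∀ a b, 0 ≤ x a b) {s t : V} (hst : s ≠ t) :
    0 ≤ mincut x s t := by
  obtain ⟨S, _, _, h⟩ := exists_mincut x hst
  rw [h]
  exact cutv_nonneg hx S

/-- A list of all vertices. -/
structure Enum (l : List V) : Prop where
  mem : ∀ a, a ∈ l
  nodup : l.Nodup
  length : l.length = Fintype.card V

theorem residual_spec {l : List V} (hl : Enum l) {x : V → V → K} (hx : ∀ a b, 0 ≤ x a b) {s t : V}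
    (hst : s ≠ t) (k : ℕ) :
    (∀ a b, 0 ≤ residual l x s t k a b) ∧
    (∀ a b, residual l x s t k a b + residual l x s t k b a = x a b + x b a) ∧
    ∃ f, ∀ S, cutv (residual l x s t k) S =
      cutv x S - f * ((if s ∈ S then 1 else 0) - if t ∈ S then 1 else 0) := by
  induction k with
  | zero => exact ⟨hx, fun _ _ => rfl, 0, fun S => by simp [residual]⟩
  | succ k ih =>
    obtain ⟨h1, h2, f, h3⟩ := ih
    obtain ⟨⟨rank, hT, hr⟩, hb, _, ht⟩ := grow_spec hl.mem hl.length h1 hst hl.nodup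
    obtain ⟨i1, i2, i3⟩ := augment_spec h1 hT hr hb ht
    refine ⟨i1, fun a b => (i2 a b).trans (h2 a b),
      f + (grow l (residual l x s t k) s t).2, fun S => ?_⟩
    rw [residual, i3, h3]
    ring

theorem mincut_residual_succ {l : List V} (hl : Enum l) {x : V → V → K} (hx : ∀ a b, 0 ≤ x a b)
    {s t : V} (hst : s ≠ t) (k : ℕ) :
    mincut (residual l x s t (k + 1)) s t =
      mincut (residual l x s t k) s t - (grow l (residual l x s t k) s t).2 := by
  obtain ⟨h1, -, -⟩ := residual_spec hl hx hst k
  obtain ⟨⟨rank, hT, hr⟩, hb, _, ht⟩ := grow_spec hl.mem hl.length h1 hst hl.nodup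
  obtain ⟨i1, i2, i3⟩ := augment_spec h1 hT hr hb ht
  refine mincut_eq_of_cutv hst fun S hs ht => ?_
  rw [residual, i3]
  simp [hs, ht]

theorem mincut_residual_le {l : List V} (hl : Enum l) {x : V → V → K} (hx : ∀ a b, 0 ≤ x a b)
    {s t : V} (hst : s ≠ t) (k : ℕ) :
    mincut (residual l x s t k) s t ≤
      (Fintype.card V) ^ 2 * (grow l (residual l x s t k) s t).2 := by
  obtain ⟨h1, -, -⟩ := residual_spec hl hx hst k
  obtain ⟨-, -, ⟨S, hs, ht, h⟩, -⟩ := grow_spec hl.mem hl.length h1 hst hl.nodup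
  exact (mincut_le _ hs ht).trans h

theorem grow_nonneg {l : List V} (hl : Enum l) {x : V → V → K} (hx : ∀ a b, 0 ≤ x a b)
    {s t : V} (hst : s ≠ t) (k : ℕ) : 0 ≤ (grow l (residual l x s t k) s t).2 :=
  (grow_spec hl.mem hl.length (residual_spec hl hx hst k).1 hst hl.nodup).2.1

/-- Width `0` forces the residual minimum cut to be `0`. All cuts separating `s` from `t` have lost
the same amount, the flow value, which can be read off at `{s}`. -/
theorem mincut_eq_of_grow_eq_zero {l : List V} (hl : Enum l) {x : V → V → K}
    (hx : ∀ a b, 0 ≤ x a b) {s t : V} (hst : s ≠ t) {k : ℕ}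
    (h0 : (grow l (residual l x s t k) s t).2 = 0) :
    mincut x s t = cutv x {s} - cutv (residual l x s t k) {s} := by
  have h1 := mincut_residual_le hl hx hst k
  obtain ⟨h2, -, f, h3⟩ := residual_spec hl hx hst k
  rw [h0, mul_zero] at h1
  have h4 := le_antisymm h1 (mincut_nonneg h2 hst)
  have h5 := mincut_eq_of_cutv hst (x := x) (c := residual l x s t k) (f := f)
    fun S hs ht => by rw [h3]; simp [hs, ht]
  have h6 := h3 {s}
  simp [hst.symm] at h6
  rw [h6]
  linarith

end Augmenting

/-! ### The number of augmentations -/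

section Iterations

variable {V : Type*} [DecidableEq V] [Fintype V]

/-- The widest path carries at least a `1 / n ^ 2` fraction of the residual minimum cut. -/
theorem mincut_residual_pow_le {l : List V} (hl : Enum l) {x : V → V → ℚ}
    (hx : ∀ a b, 0 ≤ x a b) {s t : V} (hst : s ≠ t) (k : ℕ) :
    mincut (residual l x s t k) s t ≤
      (1 - 1 / ((Fintype.card V) ^ 2 : ℕ)) ^ k * mincut x s t := by
  induction k with
  | zero => simp [residual]
  | succ k ih =>
    have h1 := mincut_residual_le hl hx hst k
    have hm : (1 : ℚ) ≤ ((Fintype.card V) ^ 2 : ℕ) := by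
      have : 0 < (Fintype.card V) ^ 2 := pow_pos (Fintype.card_pos_iff.2 ⟨s⟩) 2
      exact_mod_cast this
    set m : ℚ := (((Fintype.card V) ^ 2 : ℕ) : ℚ) with hmdef
    have e : ((Fintype.card V : ℚ)) ^ 2 = m := by rw [hmdef]; push_cast; rfl
    rw [e] at h1
    have h0 : 0 ≤ 1 - 1 / m := by
      rw [sub_nonneg, div_le_one (by linarith)]
      exact hm
    have h2 : mincut (residual l x s t k) s t / m ≤ (grow l (residual l x s t k) s t).2 := by
      rw [div_le_iff₀ (by linarith)]
      linarith
    calc mincut (residual l x s t (k + 1)) s t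
        ≤ (1 - 1 / m) * mincut (residual l x s t k) s t := by
          rw [mincut_residual_succ hl hx hst]
          have : (1 - 1 / m) * mincut (residual l x s t k) s t =
              mincut (residual l x s t k) s t - mincut (residual l x s t k) s t / m := by ring
          rw [this]
          linarith
      _ ≤ (1 - 1 / m) * ((1 - 1 / m) ^ k * mincut x s t) := mul_le_mul_of_nonneg_left ih h0
      _ = (1 - 1 / m) ^ (k + 1) * mincut x s t := by ring

theorem two_mul_one_sub_pow_le (m : ℕ) (hm : m ≠ 0) : 2 * (1 - 1 / (m : ℚ)) ^ m ≤ 1 := by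
  have h1 : (1 - 1 / (m : ℝ)) ^ m ≤ Real.exp (-1) :=
    Real.one_sub_div_pow_le_exp_neg (by exact_mod_cast Nat.one_le_iff_ne_zero.2 hm)
  have h2 : Real.exp (-1) ≤ 1 / 2 := by
    rw [Real.exp_neg, inv_eq_one_div]
    exact one_div_le_one_div_of_le (by norm_num) (by linarith [Real.add_one_le_exp 1])
  have : ((2 * (1 - 1 / (m : ℚ)) ^ m : ℚ) : ℝ) ≤ ((1 : ℚ) : ℝ) := by
    push_cast
    linarith
  exact_mod_cast this

theorem den_cutv_dvd {x : V → V → ℚ} {D : ℕ} (h : ∀ a b, (x a b).den ∣ D) (S : Finset V) :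
    (cutv x S).den ∣ D :=
  Machine.den_sum_dvd fun a _ => Machine.den_sum_dvd fun b _ => h a b

/-- A positive number with denominator dividing `D` is at least `1 / D`. -/
theorem one_le_mul_of_den_dvd {q : ℚ} {D : ℕ} (hq : 0 < q) (hD : D ≠ 0) (h : q.den ∣ D) :
    1 ≤ q * D := by
  obtain ⟨k, rfl⟩ := h
  have hk : (1 : ℚ) ≤ k := by
    exact_mod_cast Nat.one_le_iff_ne_zero.2 (right_ne_zero_of_mul hD)
  have h1 : (1 : ℚ) ≤ q.num := by exact_mod_cast Rat.num_pos.2 hq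
  have e : q * ((q.den * k : ℕ) : ℚ) = q.num * k := by
    push_cast
    rw [← mul_assoc, Rat.mul_den_eq_num]
  rw [e]
  nlinarith

/-- The residual minimum cut is halved at least every `n ^ 2` rounds. After the stated number of
rounds it is below `1 / D`, and since it is a multiple of `1 / D` it vanishes. -/
theorem exists_grow_eq_zero {l : List V} (hl : Enum l) {x : V → V → ℚ} (hx : ∀ a b, 0 ≤ x a b)
    {s t : V} (hst : s ≠ t) {D B : ℕ} (hD0 : D ≠ 0)
    (hD : ∀ k a b, (residual l x s t k a b).den ∣ D) (hB : mincut x s t ≤ B) :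
    ∃ k ≤ (Fintype.card V) ^ 2 * (B * D).size, (grow l (residual l x s t k) s t).2 = 0 := by
  refine ⟨_, le_rfl, ?_⟩
  set m := (Fintype.card V) ^ 2 with hm
  set j := (B * D).size with hj
  have hm0 : m ≠ 0 := pow_ne_zero 2 (Fintype.card_pos_iff.2 ⟨s⟩).ne'
  set v := mincut (residual l x s t (m * j)) s t with hv
  have h0 : 0 ≤ v := mincut_nonneg (residual_spec hl hx hst _).1 hst
  have hv0 : v = 0 := by
    by_contra hne
    have hpos : 0 < v := lt_of_le_of_ne h0 (Ne.symm hne)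
    have hd : v.den ∣ D := by
      obtain ⟨S, _, _, h⟩ := exists_mincut (residual l x s t (m * j)) hst
      rw [hv, h]
      exact den_cutv_dvd (hD _) S
    have h1 := one_le_mul_of_den_dvd hpos hD0 hd
    have h2 := mincut_residual_pow_le hl hx hst (m * j)
    rw [← hm, ← hv, pow_mul] at h2
    have h3 : ((1 : ℚ) - 1 / (m : ℚ)) ^ m ≤ 1 / 2 := by linarith [two_mul_one_sub_pow_le m hm0]
    have h4 : (0 : ℚ) ≤ 1 - 1 / (m : ℚ) := by
      rw [sub_nonneg, div_le_one (by positivity)]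
      exact_mod_cast Nat.one_le_iff_ne_zero.2 hm0
    have h5 : ((1 - 1 / (m : ℚ)) ^ m) ^ j ≤ (1 / 2) ^ j :=
      pow_le_pow_left₀ (pow_nonneg h4 m) h3 j
    have h6 : v ≤ (1 / 2) ^ j * B :=
      h2.trans (mul_le_mul h5 hB (mincut_nonneg hx hst) (by positivity))
    have h7 : ((B * D : ℕ) : ℚ) < 2 ^ j := by exact_mod_cast Nat.lt_size_self (B * D)
    have h8 : v * D * 2 ^ j ≤ B * D := by
      have : v * D * 2 ^ j ≤ (1 / 2) ^ j * B * D * 2 ^ j := by gcongr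
      refine this.trans (le_of_eq ?_)
      have e : ((1 / 2 : ℚ)) ^ j * 2 ^ j = 1 := by rw [← mul_pow]; norm_num
      linear_combination (B * D : ℚ) * e
    push_cast at h7
    nlinarith [show (0 : ℚ) < 2 ^ j by positivity]
  have h1 := mincut_residual_succ hl hx hst (m * j)
  have h2 := mincut_nonneg (residual_spec hl hx hst (m * j + 1)).1 hst
  rw [h1, ← hv, hv0] at h2
  exact le_antisymm (by linarith) (grow_nonneg hl hx hst _)

end Iterations

end PCTSP

namespace Machine

open Data PCTSP

/-! ### Computing minimum cuts in polynomial time -/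

namespace Data

/-- The list of the values of a function. -/
def fn {n : ℕ} (q : Fin n → Fin n) : Data := vec fun a => nat (q a)

/-- A pair of vertices. -/
def arc {n : ℕ} (p : Fin n × Fin n) : Data := .pair (nat p.1) (nat p.2)

theorem size_mat_le {n M : ℕ} {x : Fin n → Fin n → ℚ} (h : ∀ u w, (atom (x u w)).size ≤ M) :
    (mat x).size ≤ 2 + n * (1 + (2 + n * (1 + M))) :=
  size_vec_le fun u => size_vec_le fun w => h u w

theorem size_fn_le {n : ℕ} (q : Fin n → Fin n) : (fn q).size ≤ 2 + n * (1 + (rng n).size) :=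
  size_vec_le fun a => size_nat_fin_le (q a)

theorem size_arc_le {n : ℕ} (p : Fin n × Fin n) : (arc p).size ≤ 1 + 2 * (rng n).size := by
  have h1 := size_nat_fin_le p.1
  have h2 := size_nat_fin_le p.2
  simp only [arc, size]
  omega

theorem mem_list_vec {n : ℕ} (v : Fin n → Data) (j : Fin n) : v j ∈ List.ofFn v := by
  simp [List.mem_ofFn]

theorem size_mat_entry_le {n : ℕ} (x : Fin n → Fin n → ℚ) (u w : Fin n) :
    (atom (x u w)).size ≤ (mat x).size :=
  (size_entry_le (fun w => atom (x u w)) w).trans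
    (size_entry_le (fun u => vec fun w => atom (x u w)) u)

theorem den_dvd_dens_vec {n : ℕ} (y : Fin n → ℚ) (u : Fin n) :
    (y u).den ∣ (vec fun u => atom (y u)).dens :=
  dens_dvd_of_mem (mem_list_vec (fun u => atom (y u)) u)

theorem abs_le_mag_vec {n : ℕ} (y : Fin n → ℚ) (u : Fin n) :
    |y u| ≤ (vec fun u => atom (y u)).mag :=
  (abs_le_natAbs_num _).trans (by
    exact_mod_cast mag_le_of_mem (mem_list_vec (fun u => atom (y u)) u))

theorem den_dvd_dens_mat {n : ℕ} (x : Fin n → Fin n → ℚ) (u w : Fin n) :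
    (x u w).den ∣ (mat x).dens :=
  (den_dvd_dens_vec (x u) w).trans
    (dens_dvd_of_mem (mem_list_vec (fun u => vec fun w => atom (x u w)) u))

theorem abs_le_mag_mat {n : ℕ} (x : Fin n → Fin n → ℚ) (u w : Fin n) :
    |x u w| ≤ (mat x).mag :=
  (abs_le_mag_vec (x u) w).trans (by
    exact_mod_cast mag_le_of_mem (mem_list_vec (fun u => vec fun w => atom (x u w)) u))

theorem size_append_add (l l' : List Data) :
    (ofList (l ++ l')).size + 2 = (ofList l).size + (ofList l').size := by
  simp only [size_ofList_eq, List.map_append, List.sum_append]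
  omega

end Data

namespace Poly

variable {ι : Type} {F : ι → Data}

theorem flatten {L : ι → List (List Data)} (h : Poly F fun i => ofList ((L i).map ofList)) :
    Poly F fun i => ofList (L i).flatten := by
  have := foldl (F := F) (α := fun _ => List Data) (σ := fun _ => List Data) L
    (fun i s a => s ++ a) (fun _ => []) (fun _ => ofList) (fun _ => ofList)
    (fun i k s => (ofList s).size ≤ 2 + k * (ofList ((L i).map ofList)).size)
    (fun i => by simp [size_ofList_eq])
    (fun i k s a _ ha hs => by
      have h1 := size_append_add s a
      have h2 := size_le_of_mem (List.mem_map_of_mem (f := ofList) ha)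
      rw [add_mul, one_mul]
      omega)
    h (nil F)
    (fun i => 2 + (L i).length * (ofList ((L i).map ofList)).size)
    ((PB.const 2).add ((h.size_bound.of_le fun i => by
      simpa using length_le_size ((L i).map ofList)).mul h.size_bound))
    (fun i k s hk hs => hs.trans (Nat.add_le_add_left (Nat.mul_le_mul_right _ hk) 2))
    (fun E g k s a _ _ _ _ ha hs => hs.append ha)
  refine this.congr fun i => ?_
  have aux : ∀ (L : List (List Data)) (m : List Data),
      List.foldl (fun s a => s ++ a) m L = m ++ L.flatten := by
    intro L
    induction L with
    | nil => simp
    | cons a L ih => intro m; simp [ih]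
  simp [aux]

variable {n : ι → ℕ}

theorem pairs (hn : Poly F fun i => rng (n i)) :
    Poly F fun i => ofList ((PCTSP.pairs (List.finRange (n i))).map arc) := by
  have h1 : Poly F fun i => ofList (((List.finRange (n i)).map fun u : Fin (n i) =>
      (List.finRange (n i)).map fun w : Fin (n i) => arc (u, w)).map ofList) := by
    refine (map (fun i => List.finRange (n i)) (fun i (j : Fin (n i)) => nat j)
      (fun i u => ofList ((List.finRange (n i)).map fun w : Fin (n i) => arc (u, w))) hn.rng_map
      (fun E r a _ wk ha => map (fun j => List.finRange (n (r j))) (fun j w => nat w)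
        (fun j w => arc (a j, w)) (wk hn).rng_map
        fun E' r' a' _ wk' ha' => (wk' ha).pair ha')).congr fun i => ?_
    rw [List.map_map]
    rfl
  refine h1.flatten.congr fun i => ?_
  simp only [PCTSP.pairs, List.flatMap_def, List.map_flatten, List.map_map]
  congr 3
  funext u
  simp

theorem apply_fn {q : ∀ i, Fin (n i) → Fin (n i)} {a : ∀ i, Fin (n i)}
    (hq : Poly F fun i => fn (q i)) (ha : Poly F fun i => nat (a i)) :
    Poly F fun i => nat (q i (a i)) :=
  get (v := fun i a => nat (q i a)) hq ha

theorem fn_tab {q : ∀ i, Fin (n i) → Fin (n i)} (hn : Poly F fun i => rng (n i))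
    (hq : ∀ {κ : Type} (E : κ → Data) (r : κ → ι) (j : ∀ k, Fin (n (r k))),
      (∀ {X : ι → Data}, Poly F X → Poly E fun j => X (r j)) →
      Poly E (fun k => nat (j k)) → Poly E fun k => nat (q (r k) (j k))) :
    Poly F fun i => fn (q i) :=
  tab hn hq

theorem nat_ite {P : ι → Prop} [∀ i, Decidable (P i)] {a b : ∀ i, Fin (n i)} (hP : PolyDec F P)
    (ha : Poly F fun i => nat (a i)) (hb : Poly F fun i => nat (b i)) :
    Poly F fun i => nat (if P i then a i else b i : Fin (n i)) :=
  (ite hP ha hb).congr fun i => by split_ifs <;> rfl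

theorem update_fn {q : ∀ i, Fin (n i) → Fin (n i)} {a b : ∀ i, Fin (n i)}
    (hn : Poly F fun i => rng (n i)) (hq : Poly F fun i => fn (q i))
    (ha : Poly F fun i => nat (a i)) (hb : Poly F fun i => nat (b i)) :
    Poly F fun i => fn (Function.update (q i) (a i) (b i)) :=
  fn_tab hn fun E r j wk hj =>
    (nat_ite (PolyDec.fin_eq hj (wk ha)) (wk hb) (apply_fn (wk hq) hj)).congr fun k => by
      by_cases h : j k = a (r k)
      · rw [if_pos h, h, Function.update_self]
      · rw [if_neg h, Function.update_of_ne h]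

end Poly

theorem PolyDec.inT {ι : Type} {F : ι → Data} {n : ι → ℕ} {s a : ∀ i, Fin (n i)}
    {q : ∀ i, Fin (n i) → Fin (n i)} (hs : Poly F fun i => nat (s i))
    (hq : Poly F fun i => fn (q i)) (ha : Poly F fun i => nat (a i)) :
    PolyDec F fun i => InT (s i) (q i) (a i) :=
  (PolyDec.fin_eq ha hs).or (PolyDec.fin_eq (Poly.apply_fn hq ha) ha).not

namespace Poly

variable {ι : Type} {F : ι → Data} {n : ι → ℕ} {c x : ∀ i, Fin (n i) → Fin (n i) → ℚ}
  {s t : ∀ i, Fin (n i)}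

theorem widestArc {q : ∀ i, Fin (n i) → Fin (n i)} (hn : Poly F fun i => rng (n i))
    (hc : Poly F fun i => mat (c i)) (hs : Poly F fun i => nat (s i))
    (ht : Poly F fun i => nat (t i)) (hq : Poly F fun i => fn (q i)) :
    Poly F fun i => arc (PCTSP.widestArc (List.finRange (n i)) (c i) (s i) (t i) (q i)) :=
  foldl (α := fun i => Fin (n i) × Fin (n i)) (σ := fun i => Fin (n i) × Fin (n i))
    (fun i => PCTSP.pairs (List.finRange (n i)))
    (fun i p a => if InT (s i) (q i) a.1 ∧ ¬ InT (s i) (q i) a.2 ∧ c i p.1 p.2 ≤ c i a.1 a.2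
      then a else p)
    (fun i => (s i, t i)) (fun _ => arc) (fun _ => arc) (fun _ _ _ => True) (fun _ => trivial)
    (fun _ _ _ _ _ _ _ => trivial) hn.pairs (hs.pair ht)
    (fun i => 1 + 2 * (rng (n i)).size) ((PB.const 1).add ((PB.const 2).mul hn.size_bound))
    (fun i k p _ _ => size_arc_le p)
    (fun E g k p a _ _ _ wk ha hp => by
      refine (ite ((PolyDec.inT (wk hs) (wk hq) ha.fst).and ((PolyDec.inT (wk hs) (wk hq)
        ha.snd).not.and (PolyDec.le (get₂ (wk hc) hp.fst hp.snd) (get₂ (wk hc) ha.fst ha.snd))))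
        ha hp).congr fun j => ?_
      split_ifs <;> rfl)

/-- A tree with a bound for its capacities. -/
def _root_.Machine.Data.grown {n : ℕ} (g : (Fin n → Fin n) × ℚ) : Data := .pair (fn g.1) (atom g.2)

theorem grow (hn : Poly F fun i => rng (n i))
    (hc : Poly F fun i => mat (c i)) (hs : Poly F fun i => nat (s i))
    (ht : Poly F fun i => nat (t i)) :
    Poly F fun i => grown (PCTSP.grow (List.finRange (n i)) (c i) (s i) (t i)) := by
  have h0 : Poly F fun i => atom ((List.finRange (n i)).map (c i (s i))).sum :=
    (sum hn fun E r j wk hj => get₂ (wk hc) (wk hs) hj).congr fun i => by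
      rw [← List.ofFn_eq_map, List.sum_ofFn]
  have hid : Poly F fun i => fn (_root_.id : Fin (n i) → Fin (n i)) :=
    fn_tab hn fun E r j wk hj => hj
  exact foldl (α := fun i => Fin (n i)) (σ := fun i => (Fin (n i) → Fin (n i)) × ℚ)
    (fun i => List.finRange (n i))
    (fun i g _ => growStep (List.finRange (n i)) (c i) (s i) (t i) g)
    (fun i => (_root_.id, ((List.finRange (n i)).map (c i (s i))).sum)) (fun _ a => nat a)
    (fun _ => grown)
    (fun i _ g => (atom g.2).size ≤
      (atom ((List.finRange (n i)).map (c i (s i))).sum).size + (mat (c i)).size)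
    (fun i => Nat.le_add_right _ _)
    (fun i k g a _ _ hg => by
      simp only [growStep]
      split_ifs
      · exact hg
      · rcases min_choice g.2 (c i (PCTSP.widestArc (List.finRange (n i)) (c i) (s i) (t i) g.1).1
          (PCTSP.widestArc (List.finRange (n i)) (c i) (s i) (t i) g.1).2) with h | h
        · simp only [h]; exact hg
        · simp only [h]
          exact (size_mat_entry_le _ _ _).trans (Nat.le_add_left _ _))
    hn.rng_map (hid.pair h0)
    (fun i => 1 + (2 + n i * (1 + (rng (n i)).size)) +
      ((atom ((List.finRange (n i)).map (c i (s i))).sum).size + (mat (c i)).size))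
    (((PB.const 1).add ((PB.const 2).add ((hn.size_bound.of_le fun i => le_size_rng _).mul
      ((PB.const 1).add hn.size_bound)))).add (h0.size_bound.add hc.size_bound))
    (fun i k g _ hg => by
      have := size_fn_le g.1
      simp only [grown, size]
      simp only [size] at hg
      omega)
    (fun E r k g a _ _ _ wk ha hg => by
      have hw := widestArc (wk hn) (wk hc) (wk hs) (wk ht) hg.fst
      refine (ite (PolyDec.inT (wk hs) hg.fst (wk ht)) hg
        ((update_fn (wk hn) hg.fst hw.snd hw.fst).pair
          (min hg.snd (get₂ (wk hc) hw.fst hw.snd)))).congr fun j => ?_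
      simp only [growStep]
      split_ifs <;> rfl)

/-- A matrix and a vertex. -/
def _root_.Machine.Data.matAt {n : ℕ} (p : (Fin n → Fin n → ℚ) × Fin n) : Data :=
  .pair (mat p.1) (nat p.2)

theorem push {u w : ∀ i, Fin (n i)} {b : ι → ℚ} (hn : Poly F fun i => rng (n i))
    (hc : Poly F fun i => mat (c i)) (hu : Poly F fun i => nat (u i))
    (hw : Poly F fun i => nat (w i)) (hb : Poly F fun i => atom (b i)) :
    Poly F fun i => mat (PCTSP.push (c i) (u i) (w i) (b i)) :=
  tab₂ hn fun _ _ _ _ wk ha ha' =>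
    ((get₂ (wk hc) ha ha').sub (ite_atom ((PolyDec.fin_eq ha (wk hu)).and
      (PolyDec.fin_eq ha' (wk hw))) (wk hb) (const _ 0))).add
      (ite_atom ((PolyDec.fin_eq ha (wk hw)).and (PolyDec.fin_eq ha' (wk hu))) (wk hb) (const _ 0))

theorem _root_.PCTSP.den_push_dvd {n D : ℕ} {c : Fin n → Fin n → ℚ} {b : ℚ}
    (hc : ∀ a a', (c a a').den ∣ D) (hb : b.den ∣ D) (u w a a' : Fin n) :
    (PCTSP.push c u w b a a').den ∣ D := by
  unfold PCTSP.push
  refine den_add_dvd (den_sub_dvd (hc _ _) ?_) ?_ <;> split_ifs <;> simp [hb]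

theorem _root_.PCTSP.abs_push_le {n : ℕ} (c : Fin n → Fin n → ℚ) (b : ℚ) (u w a a' : Fin n) :
    |PCTSP.push c u w b a a'| ≤ |c a a'| + 2 * |b| := by
  unfold PCTSP.push
  refine (abs_add_le _ _).trans ?_
  have h1 := abs_sub (c a a') (if a = u ∧ a' = w then b else 0)
  have h2 : |if a = u ∧ a' = w then b else 0| ≤ |b| := by split_ifs <;> simp
  have h3 : |if a = w ∧ a' = u then b else 0| ≤ |b| := by split_ifs <;> simp
  linarith

/-- A bound that grows linearly with the number of pushes is enough for a single augmentation; over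
many augmentations the entries are bounded by `residual_spec` instead. -/
theorem augment {q : ∀ i, Fin (n i) → Fin (n i)} {b : ι → ℚ} (hn : Poly F fun i => rng (n i))
    (hc : Poly F fun i => mat (c i)) (ht : Poly F fun i => nat (t i))
    (hq : Poly F fun i => fn (q i)) (hb : Poly F fun i => atom (b i)) :
    Poly F fun i => mat (PCTSP.augment (List.finRange (n i)) (c i) (t i) (q i, b i)) := by
  set G : ι → Data := fun i => .pair (mat (c i)) (atom (b i)) with hG
  have hGP : Poly F G := hc.pair hb
  have hcd : ∀ i a a', (c i a a').den ∣ (G i).dens := fun i a a' =>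
    (den_dvd_dens_mat (c i) a a').trans (Dvd.intro _ rfl)
  have hbd : ∀ i, (b i).den ∣ (G i).dens := fun i => Dvd.intro_left _ rfl
  have hcm : ∀ i a a', |c i a a'| ≤ (G i).mag := fun i a a' =>
    (abs_le_mag_mat (c i) a a').trans (by exact_mod_cast Nat.le_add_right _ _)
  have hbm : ∀ i, |b i| ≤ (G i).mag := fun i =>
    (abs_le_natAbs_num (b i)).trans (by exact_mod_cast Nat.le_add_left _ _)
  exact (foldl (α := fun i => Fin (n i)) (σ := fun i => (Fin (n i) → Fin (n i) → ℚ) × Fin (n i))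
    (fun i => List.finRange (n i))
    (fun i p _ => walkStep (q i) (b i) p) (fun i => (c i, t i)) (fun _ a => nat a) (fun _ => matAt)
    (fun i k p => ∀ a a', (p.1 a a').den ∣ (G i).dens ∧ |p.1 a a'| ≤ (1 + 2 * k) * (G i).mag)
    (fun i a a' => ⟨hcd i a a', by simpa using hcm i a a'⟩)
    (fun i k p _ _ _ hp a a' => by
      have hk : (0 : ℚ) ≤ (G i).mag := Nat.cast_nonneg _
      simp only [walkStep]
      split_ifs
      · refine ⟨(hp a a').1, (hp a a').2.trans ?_⟩
        push_cast
        nlinarith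
      · refine ⟨den_push_dvd (fun a a' => (hp a a').1) (hbd i) _ _ a a',
          (abs_push_le p.1 (b i) _ _ a a').trans ?_⟩
        have h1 := (hp a a').2
        have h2 := hbm i
        push_cast
        nlinarith)
    hn.rng_map (hc.pair ht)
    (fun i => 1 + (2 + n i * (1 + (2 + n i * (1 + (1 + ((1 + 2 * n i) + (G i).size) +
      2 * (G i).size))))) + (rng (n i)).size)
    (by
      have h1 := hGP.size_bound
      have h2 : PB n fun i => (F i).size := hn.size_bound.of_le fun i => le_size_rng _
      exact ((PB.const 1).add ((PB.const 2).add (h2.mul ((PB.const 1).add ((PB.const 2).add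
        (h2.mul ((PB.const 1).add (((PB.const 1).add (((PB.const 1).add ((PB.const 2).mul h2)).add
        h1)).add ((PB.const 2).mul h1))))))))).add hn.size_bound)
    (fun i k p hk hp => by
      have h1 : (mat p.1).size ≤ _ := size_mat_le (M := 1 + ((1 + 2 * n i) + (G i).size) +
          2 * (G i).size) fun u w => by
        have h1 := size_atom_le (B := (1 + 2 * k) * (G i).mag) (G i).dens_ne_zero (hp u w).1
          (by push_cast; exact (hp u w).2)
        have h2 := nat_size_mul_le (1 + 2 * k) (G i).mag
        have h3 := (G i).size_dens_le
        have h4 := (G i).size_mag_le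
        have h5 : (1 + 2 * k).size ≤ 1 + 2 * k := Nat.size_le.2 Nat.lt_two_pow_self
        simp only [List.length_finRange] at hk
        omega
      have h2 := size_nat_fin_le p.2
      simp only [matAt, size]
      omega)
    (fun E r k p a _ _ _ wk _ hp => by
      have hqa := apply_fn (wk hq) hp.snd
      refine (ite (PolyDec.fin_eq hqa hp.snd) hp
        ((push (wk hn) hp.fst hqa hp.snd (wk hb)).pair hqa)).congr fun j => ?_
      simp only [walkStep]
      split_ifs <;> rfl)).fst

end Poly

end Machine

namespace PCTSP

open Machine

theorem den_grow_dvd {n D : ℕ} {c : Fin n → Fin n → ℚ} (hc : ∀ a a', (c a a').den ∣ D)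
    (l : List (Fin n)) (s t : Fin n) : (grow l c s t).2.den ∣ D := by
  have key : ∀ (m : List (Fin n)) (g : (Fin n → Fin n) × ℚ), g.2.den ∣ D →
      (m.foldl (fun g _ => growStep l c s t g) g).2.den ∣ D := by
    intro m
    induction m with
    | nil => intro g h; exact h
    | cons a m ih =>
      intro g h
      refine ih _ ?_
      show (growStep l c s t g).2.den ∣ D
      unfold growStep
      split_ifs
      · exact h
      · rcases min_choice g.2 (c (widestArc l c s t g.1).1 (widestArc l c s t g.1).2) with h' | h'
        · simp only [h']; exact h
        · simp only [h']; exact hc _ _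
  refine key l _ ?_
  show ((l.map (c s)).sum).den ∣ D
  clear key
  induction l with
  | nil => simp
  | cons a l ih => simpa using den_add_dvd (hc s a) ih

theorem den_augment_dvd {n D : ℕ} {c : Fin n → Fin n → ℚ} (hc : ∀ a a', (c a a').den ∣ D)
    (l : List (Fin n)) (t : Fin n) {g : (Fin n → Fin n) × ℚ} (hg : g.2.den ∣ D) (a a' : Fin n) :
    (augment l c t g a a').den ∣ D := by
  have key : ∀ (m : List (Fin n)) (p : (Fin n → Fin n → ℚ) × Fin n),
      (∀ a a', (p.1 a a').den ∣ D) →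
      ∀ a a', ((m.foldl (fun p _ => walkStep g.1 g.2 p) p).1 a a').den ∣ D := by
    intro m
    induction m with
    | nil => intro p h; exact h
    | cons z m ih =>
      intro p h
      refine ih _ ?_
      show ∀ a a', ((walkStep g.1 g.2 p).1 a a').den ∣ D
      unfold walkStep
      split_ifs
      · exact h
      · exact fun a a' => den_push_dvd h hg _ _ a a'
  exact key l _ hc a a'

theorem den_residual_dvd {n D : ℕ} {x : Fin n → Fin n → ℚ} (hx : ∀ a a', (x a a').den ∣ D)
    (l : List (Fin n)) (s t : Fin n) (k : ℕ) (a a' : Fin n) :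
    (residual l x s t k a a').den ∣ D := by
  induction k generalizing a a' with
  | zero => exact hx a a'
  | succ k ih => exact den_augment_dvd ih l t (den_grow_dvd ih l s t) a a'

theorem enum_finRange (n : ℕ) : Enum (List.finRange n) :=
  ⟨List.mem_finRange, List.nodup_finRange n, by simp⟩

end PCTSP

namespace Machine

open Data PCTSP

/-- Augmentation stops at the first width `0`, after polynomially many rounds. In between,
denominators divide that of the input matrix and entries are at most twice its magnitude, because
opposite capacities keep their sum. -/
theorem Poly.mincut {ι : Type} {F : ι → Data} {n : ι → ℕ} {x : ∀ i, Fin (n i) → Fin (n i) → ℚ}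
    {s t : ∀ i, Fin (n i)} (hn : Poly F fun i => rng (n i)) (hx : Poly F fun i => mat (x i))
    (hs : Poly F fun i => nat (s i)) (ht : Poly F fun i => nat (t i)) (hst : ∀ i, s i ≠ t i)
    (hx0 : ∀ i a b, 0 ≤ x i a b) : Poly F fun i => atom (mincut (x i) (s i) (t i)) := by
  set c : ∀ i, ℕ → Fin (n i) → Fin (n i) → ℚ := fun i =>
    residual (List.finRange (n i)) (x i) (s i) (t i) with hc
  set g : ∀ i, ℕ → (Fin (n i) → Fin (n i)) × ℚ := fun i k =>
    PCTSP.grow (List.finRange (n i)) (c i k) (s i) (t i) with hg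
  have hB : ∀ i, PCTSP.mincut (x i) (s i) (t i) ≤ ((n i * (mat (x i)).mag : ℕ) : ℚ) := by
    intro i
    refine (mincut_le (x i) (S := {s i}) (by simp) (by simpa using (hst i).symm)).trans ?_
    unfold cutv
    rw [Finset.sum_singleton]
    refine (Finset.sum_le_univ_sum_of_nonneg fun a => hx0 i _ _).trans ?_
    refine (Finset.sum_le_card_nsmul _ _ ((mat (x i)).mag : ℚ) fun a _ =>
      (le_abs_self _).trans (abs_le_mag_mat (x i) _ a)).trans (le_of_eq ?_)
    simp
  have hden : ∀ i k a b, (c i k a b).den ∣ (mat (x i)).dens := fun i k a b =>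
    den_residual_dvd (den_dvd_dens_mat (x i)) _ _ _ k a b
  have hex := fun i => exists_grow_eq_zero (enum_finRange (n i)) (hx0 i) (hst i)
    (mat (x i)).dens_ne_zero (hden i) (hB i)
  have hex' : ∀ i, ∃ k, (g i k).2 = 0 := fun i => (hex i).imp fun k hk => hk.2
  set N : ι → ℕ := fun i => Nat.find (hex' i) with hN
  have hn' : PB n fun i => (F i).size := hn.size_bound.of_le fun i => le_size_rng _
  have hNle : ∀ i, N i ≤ n i ^ 2 * (n i + 2 * (mat (x i)).size) := by
    intro i
    obtain ⟨k, hk, hk0⟩ := hex i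
    refine (Nat.find_min' (hex' i) hk0).trans (hk.trans ?_)
    rw [Fintype.card_fin]
    refine Nat.mul_le_mul_left _ ?_
    have h1 := nat_size_mul_le (n i * (mat (x i)).mag) (mat (x i)).dens
    have h2 := nat_size_mul_le (n i) (mat (x i)).mag
    have h3 := (mat (x i)).size_dens_le
    have h4 := (mat (x i)).size_mag_le
    have h5 : (n i).size ≤ n i := Nat.size_le.2 Nat.lt_two_pow_self
    omega
  have hcle : ∀ i k a b, |c i k a b| ≤ ((2 * (mat (x i)).mag : ℕ) : ℚ) := by
    intro i k a b
    obtain ⟨h1, h2, -⟩ := residual_spec (enum_finRange (n i)) (hx0 i) (hst i) k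
    have h3 := abs_le_mag_mat (x i) a b
    have h4 := abs_le_mag_mat (x i) b a
    have h5 := h2 a b
    have h6 := h1 b a
    rw [abs_of_nonneg (h1 a b)]
    push_cast
    linarith [le_abs_self (x i a b), le_abs_self (x i b a)]
  have hcsize : ∀ i k, (mat (c i k)).size ≤
      2 + n i * (1 + (2 + n i * (1 + (3 + 3 * (mat (x i)).size)))) := fun i k =>
    size_mat_le fun a b => by
      have h1 := size_atom_le (mat (x i)).dens_ne_zero (hden i k a b) (hcle i k a b)
      have h2 := nat_size_mul_le 2 (mat (x i)).mag
      have h3 := (mat (x i)).size_dens_le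
      have h4 := (mat (x i)).size_mag_le
      have h5 : Nat.size 2 = 2 := by decide
      omega
  set S : ι → ℕ → Data := fun i k => .pair (F i) (.pair (mat (c i k)) (grown (g i k))) with hS
  -- The size of the tree is bounded by the fact that one program computes it from the input and the
  -- residual matrix, uniformly in the round.
  have hgsize : PB (fun p : ι × ℕ => (grown (g p.1 p.2)).size)
      fun p => 1 + (F p.1).size + (mat (c p.1 p.2)).size := by
    have h0 := Poly.id (fun p : ι × ℕ => Data.pair (F p.1) (mat (c p.1 p.2)))
    have h1 := (Poly.grow (n := fun p : ι × ℕ => n p.1) (c := fun p => c p.1 p.2)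
      (s := fun p => s p.1) (t := fun p => t p.1)
      (hn.weaken (fun p : ι × ℕ => p.1) h0.fst) h0.snd
      (hs.weaken (fun p : ι × ℕ => p.1) h0.fst) (ht.weaken (fun p : ι × ℕ => p.1) h0.fst)).size_bound
    exact h1
  have main : Poly F fun i => S i (N i) := by
    refine Poly.loop N S ?_ ?_ ?_ ?_ ?_
    · exact (Poly.id F).pair (hx.pair (Poly.grow hn hx hs ht))
    · have h1 := Poly.id (fun p : {p : ι × ℕ // p.2 < N p.1} => S p.1.1 p.1.2)
      have hn1 := hn.weaken (fun p : {p : ι × ℕ // p.2 < N p.1} => p.1.1) h1.fst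
      have hs1 := hs.weaken (fun p : {p : ι × ℕ // p.2 < N p.1} => p.1.1) h1.fst
      have ht1 := ht.weaken (fun p : {p : ι × ℕ // p.2 < N p.1} => p.1.1) h1.fst
      have h2 := Poly.augment (n := fun p : {p : ι × ℕ // p.2 < N p.1} => n p.1.1)
        (b := fun p => (g p.1.1 p.1.2).2) (q := fun p => (g p.1.1 p.1.2).1)
        hn1 h1.snd.fst ht1 h1.snd.snd.fst h1.snd.snd.snd
      exact h1.fst.pair (h2.pair (Poly.grow hn1 h2 hs1 ht1))
    · have h1 := Poly.id (fun p : {p : ι × ℕ // p.2 ≤ N p.1} => S p.1.1 p.1.2)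
      refine ((PolyDec.eq (b := fun _ => 0) h1.snd.snd.snd (Poly.const _ 0)).not).congr fun p => ?_
      constructor
      · intro h
        refine lt_of_le_of_ne p.2 fun e => h ?_
        have := Nat.find_spec (hex' p.1.1)
        rw [e]
        exact this
      · intro h
        exact Nat.find_min (hex' p.1.1) h
    · exact ((hn'.mul hn').mul (hn'.add ((PB.const 2).mul hx.size_bound))).of_le fun i => by
        have := hNle i
        rwa [sq] at this
    · have hc1 : PB (fun i => 2 + n i * (1 + (2 + n i * (1 + (3 + 3 * (mat (x i)).size)))))
          fun i => (F i).size :=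
        (PB.const 2).add (hn'.mul ((PB.const 1).add ((PB.const 2).add (hn'.mul
          ((PB.const 1).add ((PB.const 3).add ((PB.const 3).mul hx.size_bound)))))))
      have hc2 : PB (fun p : ι × ℕ => (mat (c p.1 p.2)).size) fun p => (F p.1).size :=
        (hc1.reindex fun p : ι × ℕ => p.1).of_le fun p => hcsize p.1 p.2
      have h1 : PB (fun p : ι × ℕ => (S p.1 p.2).size) fun p => (F p.1).size := by
        have h3 : PB (fun p : ι × ℕ => (F p.1).size) fun p => (F p.1).size := PB.refl _
        refine (((PB.const 2).add h3).add (hc2.add (hgsize.trans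
          (((PB.const 1).add h3).add hc2)))).of_le fun p => ?_
        simp only [hS, size]
        omega
      exact h1.reindex (fun p : {p : ι × ℕ // p.2 ≤ N p.1} => p.1)
  have hfin : Poly F fun i => mat (c i (N i)) := main.snd.fst
  refine (Poly.sum hn (q := fun i w => if w = s i then 0 else x i (s i) w - c i (N i) (s i) w)
    fun E r j wk hj => Poly.ite_atom (PolyDec.fin_eq hj (wk hs)) (Poly.const _ 0)
      ((Poly.get₂ (wk hx) (wk hs) hj).sub (Poly.get₂ (wk hfin) (wk hs) hj))).congr fun i => ?_
  rw [mincut_eq_of_grow_eq_zero (enum_finRange (n i)) (hx0 i) (hst i) (Nat.find_spec (hex' i))]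
  congr 1
  unfold cutv
  rw [Finset.sum_singleton, Finset.sum_singleton, ← Finset.sum_sub_distrib,
    ← Finset.sum_compl_add_sum {s i}]
  simp only [Finset.sum_singleton, if_true, add_zero]
  refine Finset.sum_congr rfl fun w hw => ?_
  rw [if_neg (by simpa using hw)]

end Machine

namespace PCTSP

open Machine

/-! ### Denominators during the elimination -/

section Denominators

variable {n D : ℕ} {r : Fin n} {x : Fin n → Fin n → ℚ} {y : Fin n → ℚ} {v u w : Fin n}

/-- `x`, `y` and half the degrees are integral multiples of `1 / D`. -/
structure Integral (D : ℕ) (r : Fin n) (x : Fin n → Fin n → ℚ) (y : Fin n → ℚ) : Prop where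
  entry : ∀ a b, (x a b).den ∣ D
  deg : ∀ a, a ≠ r → ((∑ b, x a b) / 2).den ∣ D
  val : ∀ a, (y a).den ∣ D

/-- By symmetry and the zero diagonal, half of the double sum counts every unordered pair once. -/
theorem den_half_sum_dvd (hs : ∀ a b, x a b = x b a) (hd : ∀ a, x a a = 0)
    (hx : ∀ a b, (x a b).den ∣ D) (S : Finset (Fin n)) :
    ((∑ a ∈ S, ∑ b ∈ S, x a b) / 2).den ∣ D := by
  induction S using Finset.induction_on with
  | empty => simp
  | insert a S ha ih =>
    have e : (∑ c ∈ insert a S, ∑ b ∈ insert a S, x c b) / 2 =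
        (∑ c ∈ S, ∑ b ∈ S, x c b) / 2 + ∑ b ∈ S, x a b := by
      simp only [Finset.sum_insert ha, Finset.sum_add_distrib, hd]
      rw [Finset.sum_congr rfl fun b _ => hs b a]
      ring
    rw [e]
    exact den_add_dvd ih (den_sum_dvd fun b _ => hx a b)

/-- Half a cut is the sum of the half degrees minus the sum over the edges inside `S`. Thus the
halving in the amount of a splitting introduces no new denominator. -/
theorem Integral.den_half_cutv_dvd (h : Integral D r x y) (hs : ∀ a b, x a b = x b a)
    (hd : ∀ a, x a a = 0) {S : Finset (Fin n)} (hr : r ∉ S) : (cutv x S / 2).den ∣ D := by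
  have e : cutv x S / 2 = ∑ a ∈ S, (∑ b, x a b) / 2 - (∑ a ∈ S, ∑ b ∈ S, x a b) / 2 := by
    unfold cutv
    rw [← Finset.sum_div, ← sub_div, ← Finset.sum_sub_distrib]
    congr 1
    refine Finset.sum_congr rfl fun a _ => ?_
    rw [← Finset.sum_compl_add_sum S]
    ring
  rw [e]
  exact den_sub_dvd (den_sum_dvd fun a ha => h.deg a fun e => hr (e ▸ ha))
    (den_half_sum_dvd hs hd h.entry S)

theorem den_edgeInd (a b c d : Fin n) : (edgeInd ℚ a b c d).den = 1 := by
  unfold edgeInd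
  split_ifs <;> rfl

theorem den_mul_edgeInd_dvd {p : ℚ} (hp : p.den ∣ D) (a b c d : Fin n) :
    (p * edgeInd ℚ a b c d).den ∣ D :=
  (Rat.mul_den_dvd _ _).trans (by simpa [den_edgeInd] using hp)

theorem Integral.split (h : Integral D r x y) {α : ℚ} (hα : α.den ∣ D) (huw : u ≠ w) (huv : u ≠ v)
    (hwv : w ≠ v) : Integral D r (split x v u w α) y where
  entry a b := by
    unfold PCTSP.split
    rw [mul_sub, mul_sub]
    exact den_add_dvd (h.entry a b) (den_sub_dvd (den_sub_dvd (den_mul_edgeInd_dvd hα _ _ _ _)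
      (den_mul_edgeInd_dvd hα _ _ _ _)) (den_mul_edgeInd_dvd hα _ _ _ _))
  deg a ha := by
    rw [sum_split huw huv hwv]
    have e : ∀ t : ℚ, (t - 2 * α * (if a = v then 1 else 0)) / 2 =
        t / 2 - (if a = v then α else 0) := fun t => by split_ifs <;> ring
    rw [e]
    refine den_sub_dvd (h.deg a ha) ?_
    split_ifs
    · exact hα
    · simp
  val := h.val

/-- Half the largest deficit is `0` or of the form `y z` minus half a cut whose set does not contain
the root. -/
theorem Integral.splitAmount (h : Integral D r x y) (hs : ∀ a b, x a b = x b a)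
    (hd : ∀ a, x a a = 0) (huw : u ≠ w) (huv : u ≠ v) (hwv : w ≠ v) (l : List (Fin n)) :
    (splitAmount l r x y v u w).den ∣ D := by
  have h0 : (min (x u v) (x w v)).den ∣ D := by
    rcases min_choice (x u v) (x w v) with e | e <;> rw [e] <;> exact h.entry _ _
  have h1 := h.split h0 huw huv hwv
  refine den_sub_dvd h0 ?_
  obtain ⟨-, -, h2⟩ := foldl_max_spec l
    (deficit r (PCTSP.split x v u w (min (x u v) (x w v))) y) 0
  rw [maxDeficit]
  rcases h2 with h2 | ⟨z, _, h2⟩ <;> rw [h2]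
  · simp
  · unfold deficit
    split_ifs with hz
    · simp
    · obtain ⟨S, hzS, hrS, e⟩ :=
        exists_mincut (PCTSP.split x v u w (min (x u v) (x w v))) hz
      rw [e, sub_div, mul_div_cancel_left₀ _ two_ne_zero]
      exact den_sub_dvd (h.val z) (h1.den_half_cutv_dvd (split_symm hs v u w _)
        (split_diag huw huv hwv hd _) hrS)

theorem Integral.isolate (h : Integral D r x y)
    (hz : ∀ u, u ≠ r → x u v = 0) : Integral D r (isolate v x) y where
  entry a b := by
    unfold PCTSP.isolate
    split_ifs
    · simp
    · exact h.entry a b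
  deg a ha := by
    by_cases hav : a = v
    · have : ∀ b, PCTSP.isolate v x a b = 0 := fun b => by simp [PCTSP.isolate, hav]
      simp [this]
    · have : ∀ b, PCTSP.isolate v x a b = x a b := fun b => by
        by_cases hb : b = v
        · simp [PCTSP.isolate, hb, hz a ha]
        · simp [PCTSP.isolate, hb, hav]
      simpa only [this] using h.deg a ha
  val := h.val

theorem Integral.update (h : Integral D r x y) (v : Fin n) :
    Integral D r x (Function.update y v (-1)) where
  entry := h.entry
  deg := h.deg
  val a := by
    by_cases ha : a = v
    · rw [ha, Function.update_self]
      simp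
    · rw [Function.update_of_ne ha]
      exact h.val a

/-- The entries of `x` are integral multiples of `1 / D` and at most `2`. -/
def Small (D : ℕ) (x : Fin n → Fin n → ℚ) : Prop := ∀ a b, (x a b).den ∣ D ∧ |x a b| ≤ (2 : ℕ)

theorem Feas.small (h : Feas r x y) (hI : Integral D r x y) : Small D x := fun a b => by
  refine ⟨hI.entry a b, ?_⟩
  rw [abs_of_nonneg (h.nonneg a b)]
  have := Finset.single_le_sum (f := x a) (fun b _ => h.nonneg a b) (Finset.mem_univ b)
  exact this.trans (by exact_mod_cast h.deg_le a)

/-- A bound for the sizes of matrices with small entries. -/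
def matBound (n D : ℕ) : ℕ := 2 + n * (1 + (2 + n * (1 + (3 + 2 * D.size))))

theorem Small.size_le (hD : D ≠ 0) (h : Small D x) : (Data.mat x).size ≤ matBound n D :=
  Data.size_mat_le fun a b => by
    have h1 := size_atom_le hD (h a b).1 (h a b).2
    have h5 : Nat.size 2 = 2 := by decide
    omega

/-- The invariant of the splitting at a vertex `v`. -/
structure SplitInv (D : ℕ) (r : Fin n) (y : Fin n → ℚ) (v : Fin n) (k : ℕ)
    (s : (Fin n → Fin n → ℚ) × List (Fin n × Fin n × (Fin n → Fin n → ℚ))) : Prop where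
  feas : Feas r s.1 y
  integral : Integral D r s.1 y
  neg : y v < 0
  length : s.2.length ≤ k
  small : ∀ p ∈ s.2, Small D p.2.2

theorem SplitInv.step {k : ℕ}
    {s : (Fin n → Fin n → ℚ) × List (Fin n × Fin n × (Fin n → Fin n → ℚ))}
    (h : SplitInv D r y v k s) (p : Fin n × Fin n) :
    SplitInv D r y v (k + 1) (splitStep (List.finRange n) r y v s p) := by
  unfold splitStep
  split_ifs with hp
  · exact ⟨h.feas, h.integral, h.neg, h.length.trans (Nat.le_succ k), h.small⟩
  · push Not at hp
    obtain ⟨h1, h2, h3⟩ := hp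
    obtain ⟨-, -, -, hF, -⟩ := splitAmount_spec (l := List.finRange n) (by simp) h.feas h1 h2 h3 h.neg
    refine ⟨hF, h.integral.split (h.integral.splitAmount h.feas.symm h.feas.diag h1 h2 h3 _) h1 h2 h3,
      h.neg, by simpa using h.length, fun q hq => ?_⟩
    rcases List.mem_cons.1 hq with rfl | hq
    · exact h.feas.small h.integral
    · exact h.small q hq

theorem SplitInv.foldl (ps : List (Fin n × Fin n)) {k : ℕ}
    {s : (Fin n → Fin n → ℚ) × List (Fin n × Fin n × (Fin n → Fin n → ℚ))}
    (h : SplitInv D r y v k s) :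
    SplitInv D r y v (k + ps.length) (ps.foldl (splitStep (List.finRange n) r y v) s) := by
  induction ps generalizing k s with
  | nil => exact h
  | cons p ps ih =>
    rw [List.length_cons, List.foldl_cons, Nat.add_comm ps.length, ← Nat.add_assoc]
    exact ih (h.step p)

theorem length_pairs {V : Type*} (l : List V) : (pairs l).length = l.length * l.length := by
  simp [pairs, List.length_flatMap]

/-- The records of the elimination are small. -/
structure SmallRec (D : ℕ) (y₀ : Fin n → ℚ) (e : ElimRec (Fin n) ℚ) : Prop where
  val : e.2.1 = y₀ e.1
  mat : Small D e.2.2.1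
  length : e.2.2.2.length ≤ n * n
  recs : ∀ p ∈ e.2.2.2, Small D p.2.2

/-- The invariant of the elimination, with bounds. -/
structure ElimBounds (D : ℕ) (r : Fin n) (x₀ : Fin n → Fin n → ℚ) (y₀ : Fin n → ℚ) (k : ℕ)
    (s : (Fin n → Fin n → ℚ) × (Fin n → ℚ) × List (ElimRec (Fin n) ℚ)) : Prop where
  inv : ElimInv r x₀ y₀ s
  integral : Integral D r s.1 s.2.1
  val : ∀ a, s.2.1 a = y₀ a ∨ s.2.1 a = -1
  length : s.2.2.length ≤ k
  small : ∀ e ∈ s.2.2, SmallRec D y₀ e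

theorem ElimBounds.splitInv {k : ℕ} {x₀ : Fin n → Fin n → ℚ} {y₀ : Fin n → ℚ}
    {s : (Fin n → Fin n → ℚ) × (Fin n → ℚ) × List (ElimRec (Fin n) ℚ)}
    (h : ElimBounds D r x₀ y₀ k s) (v : Fin n) :
    SplitInv D r (Function.update s.2.1 v (-1)) v 0 (s.1, []) :=
  ⟨h.inv.feas.update, h.integral.update v, by simp, le_rfl, by simp⟩

theorem ElimBounds.step {k : ℕ} {x₀ : Fin n → Fin n → ℚ} {y₀ : Fin n → ℚ}
    {s : (Fin n → Fin n → ℚ) × (Fin n → ℚ) × List (ElimRec (Fin n) ℚ)}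
    (h : ElimBounds D r x₀ y₀ k s) :
    ElimBounds D r x₀ y₀ (k + 1) (elimStep (List.finRange n) r s) := by
  have hinv := h.inv.step (l := List.finRange n) (by simp)
  refine ⟨hinv, ?_, ?_, ?_, ?_⟩ <;> clear hinv <;> unfold elimStep <;>
    rcases selectMin_spec (List.finRange n) r s.2.1 with hv | ⟨hvr, hyv, hmin⟩
  · rw [if_pos hv.1]; exact h.integral
  · rw [if_neg hvr]
    generalize selectMin (List.finRange n) r s.2.1 = v at *
    have hs := (h.splitInv v).foldl (pairs (List.finRange n))
    obtain ⟨h1, h2, h3, h4⟩ := splitAll_spec (l := List.finRange n) (by simp) hvr hs.neg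
      h.inv.feas.update
      fun u hu hyu => h.inv.dead u (by rwa [Function.update_of_ne hu] at hyu)
    exact hs.integral.isolate h4
  · rw [if_pos hv.1]; exact h.val
  · rw [if_neg hvr]
    intro a
    show Function.update s.2.1 _ (-1) a = _ ∨ Function.update s.2.1 _ (-1) a = _
    by_cases ha : a = selectMin (List.finRange n) r s.2.1
    · right; rw [← ha, Function.update_self]
    · rw [Function.update_of_ne ha]; exact h.val a
  · rw [if_pos hv.1]; exact h.length.trans (Nat.le_succ k)
  · rw [if_neg hvr]; simpa using h.length
  · rw [if_pos hv.1]; exact h.small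
  · rw [if_neg hvr]
    generalize selectMin (List.finRange n) r s.2.1 = v at *
    have hs := (h.splitInv v).foldl (pairs (List.finRange n))
    intro e he
    rcases List.mem_cons.1 he with rfl | he
    -- The vertex chosen has a nonnegative value, so it still has its original one.
    · refine ⟨(h.val v).resolve_right fun e => ?_, h.inv.feas.small h.integral, ?_, hs.small⟩
      · rw [e] at hyv; linarith
      · have := hs.length
        rwa [length_pairs, List.length_finRange, zero_add] at this
    · exact h.small e he

theorem Feas.integral (h : Feas r x y) (h0 : ∀ u, 0 ≤ y u) (hx : ∀ a b, (x a b).den ∣ D)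
    (hy : ∀ a, (y a).den ∣ D) : Integral D r x y where
  entry := hx
  deg a ha := by
    rw [h.deg a ha (h0 a), mul_div_cancel_left₀ _ two_ne_zero]
    exact hy a
  val := hy

end Denominators

end PCTSP

namespace Machine

open Data PCTSP

/-! ### Computing the elimination in polynomial time -/

namespace Data

/-- A record of a splitting. -/
def splitRec {n : ℕ} (p : Fin n × Fin n × (Fin n → Fin n → ℚ)) : Data :=
  .pair (nat p.1) (.pair (nat p.2.1) (mat p.2.2))

/-- The state of the splitting at a vertex. -/
def splitState {n : ℕ}
    (s : (Fin n → Fin n → ℚ) × List (Fin n × Fin n × (Fin n → Fin n → ℚ))) : Data :=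
  .pair (mat s.1) (ofList (s.2.map splitRec))

/-- A record of an elimination. -/
def elimRec {n : ℕ} (e : ElimRec (Fin n) ℚ) : Data :=
  .pair (nat e.1) (.pair (atom e.2.1) (.pair (mat e.2.2.1) (ofList (e.2.2.2.map splitRec))))

/-- The state of the elimination. -/
def elimState {n : ℕ} (s : (Fin n → Fin n → ℚ) × (Fin n → ℚ) × List (ElimRec (Fin n) ℚ)) : Data :=
  .pair (mat s.1) (.pair (vec fun a => atom (s.2.1 a)) (ofList (s.2.2.map elimRec)))

theorem size_splitRecs_le {n D N : ℕ} (hD : D ≠ 0)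
    {l : List (Fin n × Fin n × (Fin n → Fin n → ℚ))} (hl : l.length ≤ N)
    (h : ∀ p ∈ l, Small D p.2.2) : (ofList (l.map splitRec)).size ≤
      2 + N * (1 + (2 + 2 * (rng n).size + matBound n D)) := by
  refine size_ofList_le (by simpa using hl) fun d hd => ?_
  obtain ⟨p, hp, rfl⟩ := List.mem_map.1 hd
  have h1 := size_nat_fin_le p.1
  have h2 := size_nat_fin_le p.2.1
  have h3 := (h p hp).size_le hD
  simp only [splitRec, size]
  omega

end Data

theorem PB.matBound {ι : Type*} {n D g : ι → ℕ} (hn : PB n g) (hD : PB (fun i => (D i).size) g) :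
    PB (fun i => matBound (n i) (D i)) g :=
  (PB.const 2).add (hn.mul ((PB.const 1).add ((PB.const 2).add (hn.mul ((PB.const 1).add
    ((PB.const 3).add ((PB.const 2).mul hD)))))))

namespace Poly

variable {ι : Type} {F : ι → Data} {n : ι → ℕ} {x : ∀ i, Fin (n i) → Fin (n i) → ℚ}
  {y : ∀ i, Fin (n i) → ℚ} {r v u w : ∀ i, Fin (n i)}

theorem n_bound (hn : Poly F fun i => rng (n i)) : PB n fun i => (F i).size :=
  hn.size_bound.of_le fun _ => le_size_rng _

theorem list_max {q : ι → List ℚ} (h : Poly F fun i => ofList ((q i).map atom)) :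
    Poly F fun i => atom ((q i).foldl (fun m z => Max.max m z) 0) :=
  foldl (F := F) (α := fun _ => ℚ) (σ := fun _ => ℚ) q (fun i s a => Max.max s a) (fun _ => 0)
    (fun _ => atom) (fun _ => atom)
    (fun i k s => (atom s).size ≤ 2 + (ofList ((q i).map atom)).size)
    (fun i => by simp [size])
    (fun i k s a _ ha hs => by
      rcases max_choice s a with e | e
      · simpa only [e] using hs
      · have := size_le_of_mem (List.mem_map_of_mem (f := atom) ha)
        simp only [e]
        omega)
    h (const F 0) _ ((PB.const 2).add h.size_bound) (fun i k s _ hs => hs)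
    (fun E g k s a _ _ _ _ ha hs => max hs ha)

theorem half {a : ι → ℚ} (ha : Poly F fun i => atom (a i)) : Poly F fun i => atom (a i / 2) :=
  (ha.mul (const F (1 / 2))).congr fun i => by rw [mul_one_div]

theorem maxDeficit (hn : Poly F fun i => rng (n i)) (hx : Poly F fun i => mat (x i))
    (hy : Poly F fun i => vec fun a => atom (y i a)) (hr : Poly F fun i => nat (r i))
    (hx0 : ∀ i a b, 0 ≤ x i a b) :
    Poly F fun i => atom (maxDeficit (List.finRange (n i)) (r i) (x i) (y i)) := by
  have h1 : Poly F fun i => ofList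
      (((List.finRange (n i)).map (deficit (r i) (x i) (y i))).map atom) := by
    refine (map (fun i => List.finRange (n i)) (fun i (j : Fin (n i)) => nat j)
      (fun i z => atom (deficit (r i) (x i) (y i) z)) hn.rng_map
      (fun E g a _ wk ha => ?_)).congr fun i => by rw [List.map_map]; rfl
    refine (ite_of (P := fun j => a j = r (g j)) (X := fun _ => atom 0)
      (Y := fun j => atom (2 * y (g j) (a j) - PCTSP.mincut (x (g j)) (a j) (r (g j))))
      (PolyDec.fin_eq ha (wk hr)) (const _ 0) ?_).congr fun j => ?_
    · exact ((const _ 2).mul ((get (v := fun j a => atom (y (g j) a)) (wk hy) ha).reindex _)).sub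
        (mincut ((wk hn).reindex _) ((wk hx).reindex _) (ha.reindex _) ((wk hr).reindex _)
          (fun j => j.2) fun j => hx0 _)
    · rw [deficit]
      split_ifs <;> rfl
  refine h1.list_max.congr fun i => ?_
  rw [PCTSP.maxDeficit, List.foldl_map]

theorem edgeInd {a b : ∀ i, Fin (n i)} (hu : Poly F fun i => nat (u i))
    (hw : Poly F fun i => nat (w i)) (ha : Poly F fun i => nat (a i))
    (hb : Poly F fun i => nat (b i)) :
    Poly F fun i => atom (edgeInd ℚ (u i) (w i) (a i) (b i)) :=
  ite_atom (((PolyDec.fin_eq ha hu).and (PolyDec.fin_eq hb hw)).or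
    ((PolyDec.fin_eq ha hw).and (PolyDec.fin_eq hb hu))) (const _ 1) (const _ 0)

theorem split {α : ι → ℚ} (hn : Poly F fun i => rng (n i)) (hx : Poly F fun i => mat (x i))
    (hv : Poly F fun i => nat (v i)) (hu : Poly F fun i => nat (u i))
    (hw : Poly F fun i => nat (w i)) (hα : Poly F fun i => atom (α i)) :
    Poly F fun i => mat (split (x i) (v i) (u i) (w i) (α i)) :=
  tab₂ hn fun _ _ _ _ wk ha hb => (get₂ (wk hx) ha hb).add ((wk hα).mul
    (((edgeInd (wk hu) (wk hw) ha hb).sub (edgeInd (wk hu) (wk hv) ha hb)).sub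
      (edgeInd (wk hw) (wk hv) ha hb)))

theorem splitAmount (hn : Poly F fun i => rng (n i)) (hx : Poly F fun i => mat (x i))
    (hy : Poly F fun i => vec fun a => atom (y i a)) (hr : Poly F fun i => nat (r i))
    (hv : Poly F fun i => nat (v i)) (hu : Poly F fun i => nat (u i))
    (hw : Poly F fun i => nat (w i)) (huw : ∀ i, u i ≠ w i) (hs : ∀ i a b, x i a b = x i b a)
    (hx0 : ∀ i a b, 0 ≤ x i a b) : Poly F fun i => atom
      (splitAmount (List.finRange (n i)) (r i) (x i) (y i) (v i) (u i) (w i)) := by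
  have h1 := min (get₂ hx hu hv) (get₂ hx hw hv)
  exact h1.sub (maxDeficit hn (split hn hx hv hu hw h1) hy hr fun i =>
    split_nonneg (hs i) (hx0 i) (le_min (hx0 i _ _) (hx0 i _ _)) (min_le_left _ _)
      (min_le_right _ _) (huw i)).half

/-- The invariant provides the nonnegativity and symmetry without which the computation of minimum
cuts could not be called on the intermediate matrices. -/
theorem splitAll {D : ι → ℕ} (hD0 : ∀ i, D i ≠ 0) (hD : PB (fun i => (D i).size) fun i => (F i).size)
    (hn : Poly F fun i => rng (n i)) (hx : Poly F fun i => mat (x i))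
    (hy : Poly F fun i => vec fun a => atom (y i a)) (hr : Poly F fun i => nat (r i))
    (hv : Poly F fun i => nat (v i)) (hI : ∀ i, SplitInv (D i) (r i) (y i) (v i) 0 (x i, [])) :
    Poly F fun i => splitState (splitAll (List.finRange (n i)) (r i) (y i) (v i) (x i)) :=
  foldl (α := fun i => Fin (n i) × Fin (n i)) (σ := fun i => (Fin (n i) → Fin (n i) → ℚ) ×
      List (Fin (n i) × Fin (n i) × (Fin (n i) → Fin (n i) → ℚ)))
    (fun i => PCTSP.pairs (List.finRange (n i)))
    (fun i => splitStep (List.finRange (n i)) (r i) (y i) (v i)) (fun i => (x i, []))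
    (fun _ => arc) (fun _ => splitState)
    (fun i k s => SplitInv (D i) (r i) (y i) (v i) k s) hI (fun i k s a _ _ h => h.step a)
    hn.pairs (hx.pair (nil F))
    (fun i => 1 + matBound (n i) (D i) +
      (2 + n i * n i * (1 + (2 + 2 * (rng (n i)).size + matBound (n i) (D i)))))
    (by
      have h1 := hn.n_bound
      have h2 := h1.matBound hD
      exact ((PB.const 1).add h2).add ((PB.const 2).add ((h1.mul h1).mul ((PB.const 1).add
        (((PB.const 2).add ((PB.const 2).mul hn.size_bound)).add h2)))))
    (fun i k s hk hs => by
      have h1 := (hs.feas.small hs.integral).size_le (hD0 i)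
      have h2 := size_splitRecs_le (hD0 i) (hs.length.trans (by simpa [length_pairs] using hk))
        hs.small
      simp only [splitState, size]
      omega)
    (fun E g k s p _ _ hs wk hp hs' => by
      have h1 := hs'.fst
      have h2 := hs'.snd
      refine (ite_of (P := fun j => (p j).1 = (p j).2 ∨ (p j).1 = v (g j) ∨ (p j).2 = v (g j))
        (X := fun j => splitState (s j))
        (Y := fun j => splitState (PCTSP.split (s j).1 (v (g j)) (p j).1 (p j).2
          (PCTSP.splitAmount (List.finRange (n (g j))) (r (g j)) (s j).1 (y (g j)) (v (g j))
            (p j).1 (p j).2), ((p j).1, (p j).2, (s j).1) :: (s j).2))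
        ((PolyDec.fin_eq hp.fst hp.snd).or ((PolyDec.fin_eq hp.fst (wk hv)).or
          (PolyDec.fin_eq hp.snd (wk hv)))) (hs'.reindex _) ?_).congr fun j => ?_
      · have hα := splitAmount (ι := {j // ¬ ((p j).1 = (p j).2 ∨ (p j).1 = v (g j) ∨
            (p j).2 = v (g j))}) ((wk hn).reindex _) (h1.reindex _) ((wk hy).reindex _)
          ((wk hr).reindex _) ((wk hv).reindex _) (hp.fst.reindex _) (hp.snd.reindex _)
          (fun j h => j.2 (.inl h)) (fun j => (hs j).feas.symm) (fun j => (hs j).feas.nonneg)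
        exact (split ((wk hn).reindex _) (h1.reindex _) ((wk hv).reindex _) (hp.fst.reindex _)
          (hp.snd.reindex _) hα).pair (((hp.fst.reindex _).pair ((hp.snd.reindex _).pair
            (h1.reindex _))).pair (h2.reindex _))
      · rw [splitStep]
        split_ifs <;> rfl)

theorem isolate (hn : Poly F fun i => rng (n i)) (hx : Poly F fun i => mat (x i))
    (hv : Poly F fun i => nat (v i)) : Poly F fun i => mat (isolate (v i) (x i)) :=
  tab₂ hn fun _ _ _ _ wk ha hb => ite_atom ((PolyDec.fin_eq ha (wk hv)).or
    (PolyDec.fin_eq hb (wk hv))) (const _ 0) (get₂ (wk hx) ha hb)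

theorem update_vec {c : ι → ℚ} (hn : Poly F fun i => rng (n i))
    (hy : Poly F fun i => vec fun a => atom (y i a)) (hv : Poly F fun i => nat (v i))
    (hc : Poly F fun i => atom (c i)) :
    Poly F fun i => vec fun a => atom (Function.update (y i) (v i) (c i) a) :=
  tab hn fun E g j wk hj => (ite_atom (PolyDec.fin_eq hj (wk hv)) (wk hc)
    (get (v := fun k a => atom (y (g k) a)) (wk hy) hj)).congr fun k => by
      by_cases h : j k = v (g k)
      · rw [if_pos h, h, Function.update_self]
      · rw [if_neg h, Function.update_of_ne h]

theorem selectMin (hn : Poly F fun i => rng (n i))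
    (hy : Poly F fun i => vec fun a => atom (y i a)) (hr : Poly F fun i => nat (r i)) :
    Poly F fun i => nat (selectMin (List.finRange (n i)) (r i) (y i) : Fin (n i)) :=
  foldl (α := fun i => Fin (n i)) (σ := fun i => Fin (n i)) (fun i => List.finRange (n i))
    (fun i best u => if u ≠ r i ∧ 0 ≤ y i u ∧ (best = r i ∨ y i u < y i best) then u else best) r
    (fun _ a => nat a) (fun _ a => nat a) (fun _ _ _ => True) (fun _ => trivial)
    (fun _ _ _ _ _ _ _ => trivial) hn.rng_map hr (fun i => (rng (n i)).size) hn.size_bound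
    (fun i k a _ _ => size_nat_fin_le a)
    (fun E g k b a _ _ _ wk ha hb => by
      have hya := get (v := fun k a => atom (y (g k) a)) (wk hy) ha
      have hyb := get (v := fun k a => atom (y (g k) a)) (wk hy) hb
      exact nat_ite ((PolyDec.fin_eq ha (wk hr)).not.and ((PolyDec.le (const _ 0) hya).and
        ((PolyDec.fin_eq hb (wk hr)).or (PolyDec.lt hya hyb)))) ha hb)

theorem elimAll {D : ι → ℕ} (hD0 : ∀ i, D i ≠ 0) (hD : PB (fun i => (D i).size) fun i => (F i).size)
    (hn : Poly F fun i => rng (n i)) (hx : Poly F fun i => mat (x i))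
    (hy : Poly F fun i => vec fun a => atom (y i a)) (hr : Poly F fun i => nat (r i))
    (hI : ∀ i, ElimBounds (D i) (r i) (x i) (y i) 0 (x i, y i, [])) :
    Poly F fun i => elimState (elimAll (List.finRange (n i)) (r i) (x i) (y i)) :=
  foldl (α := fun i => Fin (n i)) (σ := fun i => (Fin (n i) → Fin (n i) → ℚ) ×
      (Fin (n i) → ℚ) × List (ElimRec (Fin (n i)) ℚ))
    (fun i => List.finRange (n i))
    (fun i s _ => elimStep (List.finRange (n i)) (r i) s) (fun i => (x i, y i, []))
    (fun _ a => nat a) (fun _ => elimState)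
    (fun i k s => ElimBounds (D i) (r i) (x i) (y i) k s) hI (fun i k s a _ _ h => h.step)
    hn.rng_map (hx.pair (hy.pair (nil F)))
    (fun i => 2 + matBound (n i) (D i) + (2 + n i * (1 + ((vec fun a => atom (y i a)).size + 3))) +
      (2 + n i * (1 + (3 + (rng (n i)).size + (vec fun a => atom (y i a)).size +
        matBound (n i) (D i) + (2 + n i * n i * (1 + (2 + 2 * (rng (n i)).size +
        matBound (n i) (D i))))))))
    (by
      have h1 := hn.n_bound
      have h2 := h1.matBound hD
      exact (((PB.const 2).add h2).add ((PB.const 2).add (h1.mul ((PB.const 1).add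
        (hy.size_bound.add (PB.const 3)))))).add ((PB.const 2).add (h1.mul ((PB.const 1).add
        (((((PB.const 3).add hn.size_bound).add hy.size_bound).add h2).add
        ((PB.const 2).add ((h1.mul h1).mul ((PB.const 1).add
        (((PB.const 2).add ((PB.const 2).mul hn.size_bound)).add h2)))))))))
    (fun i k s hk hs => by
      have hk' : k ≤ n i := by simpa using hk
      have h1 := (hs.inv.feas.small hs.integral).size_le (hD0 i)
      have h2 := size_vec_le (v := fun a => atom (s.2.1 a))
          (M := (vec fun a => atom (y i a)).size + 3) fun a => by
        rcases hs.val a with e | e <;> rw [e]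
        · exact (size_entry_le (fun a => atom (y i a)) a).trans (Nat.le_add_right _ _)
        · simp [size]
      have h3 : (ofList (s.2.2.map elimRec)).size ≤ _ :=
        size_ofList_le (M := 3 + (rng (n i)).size + (vec fun a => atom (y i a)).size +
        matBound (n i) (D i) + (2 + n i * n i * (1 + (2 + 2 * (rng (n i)).size +
        matBound (n i) (D i))))) (by simpa using hs.length.trans hk') fun d hd => by
          obtain ⟨e, he, rfl⟩ := List.mem_map.1 hd
          have := hs.small e he
          have k1 := size_nat_fin_le e.1
          have k2 := size_entry_le (fun a => atom (y i a)) e.1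
          rw [← this.val] at k2
          have k3 := this.mat.size_le (hD0 i)
          have k4 := size_splitRecs_le (hD0 i) this.length this.recs
          simp only [elimRec, size]
          simp only [size] at k2
          omega
      simp only [elimState, size]
      omega)
    (fun E g k s a _ _ hs wk _ hs' => by
      have hx' := hs'.fst
      have hy' := hs'.snd.fst
      have hst := hs'.snd.snd
      have hv := selectMin (wk hn) hy' (wk hr)
      have hu := update_vec (wk hn) hy' hv (const _ (-1))
      have hsp := splitAll (D := fun j => D (g j)) (fun j => hD0 _)
        ((hD.reindex g).trans (wk (id F)).size_bound) (wk hn) hx' hu (wk hr) hv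
        fun j => (hs j).splitInv _
      refine (ite (PolyDec.fin_eq hv (wk hr)) hs' ((isolate (wk hn) hsp.fst hv).pair (hu.pair
        ((hv.pair ((get (v := fun j a => atom ((s j).2.1 a)) hy' hv).pair
          (hx'.pair hsp.snd))).pair hst)))).congr fun j => ?_
      show _ = elimState (elimStep (List.finRange (n (g j))) (r (g j)) (s j))
      rw [elimStep]
      split_ifs <;> rfl)

end Poly

end Machine

namespace PCTSP

open Machine

/-! ### Weights during the undoing of the elimination -/

section Ancestors

variable {V : Type*} [DecidableEq V]

/-- Making the walk stop at `v` turns the search for an ancestor into an iteration of prescribed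
length. -/
theorem iterate_stop_eq_iff (T : V → V) (v u : V) (m : ℕ) :
    (fun a => if a = v then a else T a)^[m] u = v ↔ ∃ k ≤ m, T^[k] u = v := by
  induction m generalizing u with
  | zero => simp
  | succ m ih =>
    rw [Function.iterate_succ_apply]
    by_cases hu : u = v
    · simp only [hu, if_true]
      rw [ih]
      exact ⟨fun _ => ⟨0, by omega, rfl⟩, fun _ => ⟨0, by omega, rfl⟩⟩
    · rw [if_neg hu, ih]
      constructor
      · rintro ⟨k, hk, h⟩
        exact ⟨k + 1, by omega, by rwa [Function.iterate_succ_apply]⟩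
      · rintro ⟨k, hk, h⟩
        cases k with
        | zero => exact absurd h hu
        | succ k => exact ⟨k, by omega, by rwa [Function.iterate_succ_apply] at h⟩

/-- Up to the first visit to `v` no vertex repeats, as a repetition would allow a shortcut to an
earlier visit. -/
theorem anc_iff_le_card [Fintype V] (T : V → V) (v u : V) :
    Anc T v u ↔ ∃ k ≤ Fintype.card V, T^[k] u = v := by
  refine ⟨fun h => ?_, fun ⟨k, _, h⟩ => ⟨k, h⟩⟩
  classical
  refine ⟨Nat.find h, ?_, Nat.find_spec h⟩
  have hinj : Function.Injective fun j : Fin (Nat.find h) => T^[(j : ℕ)] u := by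
    have aux : ∀ i j : Fin (Nat.find h), i < j → T^[(i : ℕ)] u ≠ T^[(j : ℕ)] u := by
      intro i j hij e
      have hij' : (i : ℕ) < j := hij
      have hj := j.2
      refine Nat.find_min h (m := Nat.find h - j + i) (by omega) ?_
      rw [Function.iterate_add_apply, e, ← Function.iterate_add_apply,
        Nat.sub_add_cancel hj.le]
      exact Nat.find_spec h
    intro i j e
    rcases lt_trichotomy i j with hij | hij | hij
    · exact absurd e (aux i j hij)
    · exact hij
    · exact absurd e.symm (aux j i hij)
  simpa using Fintype.card_le_of_injective _ hinj

end Ancestors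

section Weights

variable {n D N k : ℕ} {r : Fin n}

/-- At most `N` trees with weights in `[0, 1]` that are integral multiples of `1 / D`. -/
structure Weights (D N : ℕ) (L : List (ℚ × (Fin n → Fin n))) : Prop where
  length : L.length ≤ N
  den : ∀ q ∈ L, q.1.den ∣ D
  nonneg : ∀ q ∈ L, 0 ≤ q.1
  le_one : ∀ q ∈ L, q.1 ≤ 1

theorem Weights.cons {L : List (ℚ × (Fin n → Fin n))} (h : Weights D N L)
    {q : ℚ × (Fin n → Fin n)} (h1 : q.1.den ∣ D) (h2 : 0 ≤ q.1) (h3 : q.1 ≤ 1) :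
    Weights D (N + 1) (q :: L) where
  length := by simpa using h.length
  den p hp := by
    rcases List.mem_cons.1 hp with rfl | hp
    · exact h1
    · exact h.den p hp
  nonneg p hp := by
    rcases List.mem_cons.1 hp with rfl | hp
    · exact h2
    · exact h.nonneg p hp
  le_one p hp := by
    rcases List.mem_cons.1 hp with rfl | hp
    · exact h3
    · exact h.le_one p hp

theorem Weights.mono {L : List (ℚ × (Fin n → Fin n))} (h : Weights D N L) {N' : ℕ} (hN : N ≤ N') :
    Weights D N' L := ⟨h.length.trans hN, h.den, h.nonneg, h.le_one⟩

/-- The invariant of the greedy procedure. -/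
structure GreedyInv (D : ℕ) (b : ℚ) (k : ℕ) (s : ℚ × List (ℚ × (Fin n → Fin n))) : Prop where
  den : s.1.den ∣ D
  abs_le : |s.1| ≤ |b|
  weights : Weights D (2 * k) s.2

theorem GreedyInv.step {b : ℚ} {s : ℚ × List (ℚ × (Fin n → Fin n))} (h : GreedyInv D b k s)
    (P : (Fin n → Fin n) → Prop) (F : (Fin n → Fin n) → Fin n → Fin n)
    {q : ℚ × (Fin n → Fin n)} (h1 : q.1.den ∣ D) (h2 : 0 ≤ q.1) (h3 : q.1 ≤ 1) :
    GreedyInv D b (k + 1) (greedyStep P F s q) := by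
  unfold greedyStep
  split_ifs with hP hq
  · refine ⟨den_sub_dvd h.den h1, ?_,
      (h.weights.cons (q := (q.1, F q.2)) h1 h2 h3).mono (Nat.le_succ _)⟩
    have := h.abs_le
    rw [abs_of_nonneg hP.2.le] at this
    rw [abs_of_nonneg (sub_nonneg.2 hq)]
    linarith
  · push Not at hq
    have h4 := hP.2
    have h5 := (h.weights.cons (q := (q.1 - s.1, q.2)) (den_sub_dvd h1 h.den)
      (by simp only; linarith) (by simp only; linarith)).cons (q := (s.1, F q.2)) h.den hP.2.le
      (by simp only; linarith)
    exact ⟨by simp, by simp, h5.mono (by omega)⟩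
  · exact ⟨h.den, h.abs_le, (h.weights.cons h1 h2 h3).mono (Nat.le_succ _)⟩

/-- The factor `2` in `GreedyInv` only bounds intermediate states. For the result the sharper
`length_greedy_le` is essential, since doubling in every round would be exponential. -/
theorem Weights.greedy {L : List (ℚ × (Fin n → Fin n))} (h : Weights D N L)
    (P : (Fin n → Fin n) → Prop) (F : (Fin n → Fin n) → Fin n → Fin n) {b : ℚ} (hb : b.den ∣ D) :
    Weights D (N + 1) (greedy P F b L) := by
  have key : ∀ (M : List (ℚ × (Fin n → Fin n))) (k : ℕ) (s : ℚ × List (ℚ × (Fin n → Fin n))),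
      (∀ q ∈ M, q ∈ L) → GreedyInv D b k s →
      GreedyInv D b (k + M.length) (M.foldl (greedyStep P F) s) := by
    intro M
    induction M with
    | nil => intro k s _ hs; exact hs
    | cons q M ih =>
      intro k s hM hs
      have hq := hM q (by simp)
      have := ih (k + 1) _ (fun p hp => hM p (by simp [hp]))
        (hs.step P F (h.den q hq) (h.nonneg q hq) (h.le_one q hq))
      rwa [List.length_cons, Nat.add_comm M.length, ← Nat.add_assoc]
  have h1 := (key L 0 (b, []) (fun _ h => h) ⟨hb, le_rfl, by simp, by simp, by simp,
    by simp⟩).weights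
  exact ⟨(length_greedy_le P F b L).trans (Nat.succ_le_succ h.length), h1.den, h1.nonneg,
    h1.le_one⟩

theorem Weights.den_wsum_dvd {L : List (ℚ × (Fin n → Fin n))} (h : Weights D N L)
    {φ : (Fin n → Fin n) → ℚ} (hφ : ∀ T, (φ T).den = 1) : (wsum φ L).den ∣ D := by
  have hL := h.den
  clear h
  induction L with
  | nil => simp [wsum]
  | cons q L ih =>
    rw [wsum_cons]
    refine den_add_dvd ((Rat.mul_den_dvd _ _).trans ?_) (ih fun p hp => hL p (by simp [hp]))
    rw [hφ, mul_one]
    exact hL q (by simp)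

theorem den_cnt (T : Fin n → Fin n) (a b : Fin n) : (cnt ℚ T a b).den = 1 := by
  unfold cnt
  split_ifs <;> norm_num

theorem den_mem (r : Fin n) (T : Fin n → Fin n) (a : Fin n) : (mem ℚ r T a).den = 1 := by
  unfold mem
  split_ifs <;> rfl

theorem Weights.den_undoSplit_dvd {L : List (ℚ × (Fin n → Fin n))} (h : Weights D N L)
    {q : Fin n × Fin n × (Fin n → Fin n → ℚ)} (hq : Small D q.2.2) :
    (used L q.1 q.2.1 - q.2.2 q.1 q.2.1).den ∣ D :=
  den_sub_dvd (h.den_wsum_dvd fun T => den_cnt T _ _) (hq _ _).1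

theorem Weights.undoSplit {L : List (ℚ × (Fin n → Fin n))} (h : Weights D N L) (v : Fin n)
    {q : Fin n × Fin n × (Fin n → Fin n → ℚ)} (hq : Small D q.2.2) :
    Weights D (N + 1) (undoSplit v L q) :=
  h.greedy _ _ (h.den_undoSplit_dvd hq)

theorem Weights.den_attachStep_dvd {L : List (ℚ × (Fin n → Fin n))} (h : Weights D N L) (v : Fin n)
    {x : Fin n → Fin n → ℚ} (hx : Small D x) {c : ℚ} (hc : c.den ∣ D) (u : Fin n) :
    (min (x u v - used L u v) (c - cov r L v)).den ∣ D := by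
  rcases min_choice (x u v - used L u v) (c - cov r L v) with e | e <;> rw [e]
  · exact den_sub_dvd (hx _ _).1 (h.den_wsum_dvd fun T => den_cnt T _ _)
  · exact den_sub_dvd hc (h.den_wsum_dvd fun T => den_mem r T _)

theorem Weights.attachStep {L : List (ℚ × (Fin n → Fin n))} (h : Weights D N L) (v : Fin n)
    {x : Fin n → Fin n → ℚ} (hx : Small D x) {c : ℚ} (hc : c.den ∣ D) (u : Fin n) :
    Weights D (N + 1) (attachStep r v x c L u) :=
  h.greedy _ _ (h.den_attachStep_dvd v hx hc u)

theorem Weights.foldl_undoSplit {L : List (ℚ × (Fin n → Fin n))} (h : Weights D N L) (v : Fin n)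
    (m : List (Fin n × Fin n × (Fin n → Fin n → ℚ))) (hm : ∀ q ∈ m, Small D q.2.2) :
    Weights D (N + m.length) (m.foldl (PCTSP.undoSplit v) L) := by
  induction m generalizing N L with
  | nil => exact h
  | cons q m ih =>
    rw [List.length_cons, Nat.add_comm m.length, ← Nat.add_assoc]
    exact ih (h.undoSplit v (hm q (by simp))) fun p hp => hm p (by simp [hp])

theorem Weights.foldl_attachStep {L : List (ℚ × (Fin n → Fin n))} (h : Weights D N L) (v : Fin n)
    {x : Fin n → Fin n → ℚ} (hx : Small D x) {c : ℚ} (hc : c.den ∣ D) (m : List (Fin n)) :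
    Weights D (N + m.length) (m.foldl (PCTSP.attachStep r v x c) L) := by
  induction m generalizing N L with
  | nil => exact h
  | cons q m ih =>
    rw [List.length_cons, Nat.add_comm m.length, ← Nat.add_assoc]
    exact ih (h.attachStep v hx hc q)

/-- At most `n * n` undone splittings and `n` rounds of attachment add at most one tree each. -/
theorem Weights.undoElim {L : List (ℚ × (Fin n → Fin n))} (h : Weights D N L) {y₀ : Fin n → ℚ}
    (hy : ∀ a, (y₀ a).den ∣ D) {e : ElimRec (Fin n) ℚ} (he : SmallRec D y₀ e) :
    Weights D (N + (n * n + n)) (undoElim (List.finRange n) r L e) := by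
  have hc : e.2.1.den ∣ D := by
    rw [he.val]
    exact hy _
  have := (h.foldl_undoSplit e.1 e.2.2.2 he.recs).foldl_attachStep (r := r) e.1 he.mat hc
    (List.finRange n)
  refine this.mono ?_
  have := he.length
  rw [List.length_finRange]
  omega

theorem ElimBounds.elimAll {x : Fin n → Fin n → ℚ} {y : Fin n → ℚ}
    (h : ElimBounds D r x y 0 (x, y, [])) :
    ElimBounds D r x y n (elimAll (List.finRange n) r x y) := by
  have key : ∀ (m : List (Fin n)) (k : ℕ) s, ElimBounds D r x y k s →
      ElimBounds D r x y (k + m.length)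
        (m.foldl (fun s _ => elimStep (List.finRange n) r s) s) := by
    intro m
    induction m with
    | nil => intro k s hs; exact hs
    | cons a m ih =>
      intro k s hs
      rw [List.length_cons, Nat.add_comm m.length, ← Nat.add_assoc]
      exact ih _ _ hs.step
  have := key (List.finRange n) 0 _ h
  rwa [List.length_finRange, zero_add] at this

/-- The different trees that occur in a weighted family. -/
def distinct {K τ : Type*} [DecidableEq τ] (L : List (K × τ)) : List τ :=
  L.foldl (fun s q => s.insert q.2) []

theorem distinct_spec {K τ : Type*} [DecidableEq τ] (L : List (K × τ)) :
    (distinct L).Nodup ∧ ∀ T, T ∈ distinct L ↔ ∃ q ∈ L, q.2 = T := by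
  have key : ∀ (L : List (K × τ)) (s : List τ), s.Nodup →
      (L.foldl (fun s q => s.insert q.2) s).Nodup ∧
      ∀ T, T ∈ L.foldl (fun s q => s.insert q.2) s ↔ T ∈ s ∨ ∃ q ∈ L, q.2 = T := by
    intro L
    induction L with
    | nil => intro s hs; exact ⟨hs, by simp⟩
    | cons q L ih =>
      intro s hs
      obtain ⟨h1, h2⟩ := ih (s.insert q.2) hs.insert
      refine ⟨h1, fun T => ?_⟩
      rw [List.foldl_cons, h2, List.mem_insert_iff]
      constructor
      · rintro ((rfl | h) | ⟨p, hp, h⟩)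
        · exact .inr ⟨q, by simp, rfl⟩
        · exact .inl h
        · exact .inr ⟨p, by simp [hp], h⟩
      · rintro (h | ⟨p, hp, h⟩)
        · exact .inl (.inr h)
        · rcases List.mem_cons.1 hp with rfl | hp
          · exact .inl (.inl h.symm)
          · exact .inr ⟨p, hp, h⟩
  obtain ⟨h1, h2⟩ := key L [] List.nodup_nil
  exact ⟨h1, fun T => by rw [distinct, h2]; simp⟩

end Weights

end PCTSP

namespace Machine

open Data PCTSP

/-! ### Computing the weighted trees in polynomial time -/

namespace Data

/-- A weighted tree. -/
def wt {n : ℕ} (q : ℚ × (Fin n → Fin n)) : Data := .pair (atom q.1) (fn q.2)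

/-- A list of weighted trees. -/
def wts {n : ℕ} (L : List (ℚ × (Fin n → Fin n))) : Data := ofList (L.map wt)

/-- A bound for the size of a weighted tree. -/
def wtBound (n D : ℕ) : ℕ := 3 + 2 * D.size + (2 + n * (1 + (rng n).size))

theorem size_wts_le {n D N : ℕ} (hD : D ≠ 0) {L : List (ℚ × (Fin n → Fin n))}
    (h : Weights D N L) : (wts L).size ≤ 2 + N * (1 + wtBound n D) := by
  refine size_ofList_le (by simpa using h.length) fun d hd => ?_
  obtain ⟨q, hq, rfl⟩ := List.mem_map.1 hd
  have h1 := size_atom_le (B := 1) hD (h.den q hq) (by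
    rw [abs_of_nonneg (h.nonneg q hq)]
    exact_mod_cast h.le_one q hq)
  have h2 := size_fn_le q.2
  simp only [wt, size, wtBound, Nat.size_one] at h1 ⊢
  omega

end Data

theorem PB.wtBound {ι : Type*} {n D g : ι → ℕ} (hn : PB (fun i => (rng (n i)).size) g)
    (hD : PB (fun i => (D i).size) g) : PB (fun i => Data.wtBound (n i) (D i)) g :=
  ((PB.const 3).add ((PB.const 2).mul hD)).add ((PB.const 2).add
    ((hn.of_le fun _ => le_size_rng _).mul ((PB.const 1).add hn)))

theorem PolyDec.fn_eq {ι : Type} {F : ι → Data} {n : ι → ℕ} {p q : ∀ i, Fin (n i) → Fin (n i)}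
    (hn : Poly F fun i => rng (n i)) (hp : Poly F fun i => fn (p i))
    (hq : Poly F fun i => fn (q i)) : PolyDec F fun i => p i = q i :=
  (PolyDec.fin_forall (P := fun i a => p i a = q i a) hn fun _ _ _ wk ha =>
    PolyDec.fin_eq (Poly.apply_fn (wk hp) ha) (Poly.apply_fn (wk hq) ha)).congr fun _ =>
      funext_iff.symm

theorem PolyDec.anc {ι : Type} {F : ι → Data} {n : ι → ℕ} {T : ∀ i, Fin (n i) → Fin (n i)}
    {v u : ∀ i, Fin (n i)} (hn : Poly F fun i => rng (n i)) (hT : Poly F fun i => fn (T i))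
    (hv : Poly F fun i => nat (v i)) (hu : Poly F fun i => nat (u i)) :
    PolyDec F fun i => Anc (T i) (v i) (u i) := by
  have h1 := Poly.foldl (F := F) (α := fun i => Fin (n i)) (σ := fun i => Fin (n i))
    (fun i => List.finRange (n i)) (fun i a _ => if a = v i then a else T i a) u
    (fun _ a => nat a) (fun _ a => nat a) (fun _ _ _ => True) (fun _ => trivial)
    (fun _ _ _ _ _ _ _ => trivial) hn.rng_map hu (fun i => (rng (n i)).size) hn.size_bound
    (fun i k a _ _ => size_nat_fin_le a)
    (fun E g k a b _ _ _ wk _ ha =>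
      Poly.nat_ite (PolyDec.fin_eq ha (wk hv)) ha (Poly.apply_fn (wk hT) ha))
  refine (PolyDec.fin_eq h1 hv).congr fun i => ?_
  have aux : ∀ (l : List (Fin (n i))) (a : Fin (n i)),
      l.foldl (fun a _ => if a = v i then a else T i a) a =
        (fun a => if a = v i then a else T i a)^[l.length] a := by
    intro l
    induction l with
    | nil => intro a; rfl
    | cons b l ih =>
      intro a
      rw [List.foldl_cons, ih, List.length_cons, Function.iterate_succ_apply]
  rw [aux, iterate_stop_eq_iff, anc_iff_le_card, List.length_finRange, Fintype.card_fin]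

namespace Poly

variable {ι : Type} {F : ι → Data} {n : ι → ℕ} {r v u w : ∀ i, Fin (n i)}
  {L : ∀ i, List (ℚ × (Fin (n i) → Fin (n i)))}

theorem fn_ite {P : ι → Prop} [∀ i, Decidable (P i)] {p q : ∀ i, Fin (n i) → Fin (n i)}
    (hP : PolyDec F P) (hp : Poly F fun i => fn (p i)) (hq : Poly F fun i => fn (q i)) :
    Poly F fun i => fn (if P i then p i else q i) :=
  (ite hP hp hq).congr fun i => by split_ifs <;> rfl

theorem rerouteArc {T : ∀ i, Fin (n i) → Fin (n i)} (hn : Poly F fun i => rng (n i))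
    (hT : Poly F fun i => fn (T i)) (hu : Poly F fun i => nat (u i))
    (hw : Poly F fun i => nat (w i)) (hv : Poly F fun i => nat (v i)) :
    Poly F fun i => fn (rerouteArc (T i) (u i) (w i) (v i)) := by
  classical
  refine (update_fn hn (fn_ite (PolyDec.anc hn hT hv hu) hT (update_fn hn hT hv hu)) hw
    hv).congr fun i => ?_
  rw [PCTSP.rerouteArc]

theorem reroute {T : ∀ i, Fin (n i) → Fin (n i)} (hn : Poly F fun i => rng (n i))
    (hT : Poly F fun i => fn (T i)) (hu : Poly F fun i => nat (u i))
    (hw : Poly F fun i => nat (w i)) (hv : Poly F fun i => nat (v i)) :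
    Poly F fun i => fn (reroute (u i) (w i) (v i) (T i)) :=
  fn_ite (PolyDec.fin_eq (apply_fn hT hw) hu) (rerouteArc hn hT hu hw hv)
    (rerouteArc hn hT hw hu hv)

theorem wsum {φ : ∀ i, (Fin (n i) → Fin (n i)) → ℚ} (hL : Poly F fun i => wts (L i))
    (hφ : ∀ {κ : Type} (E : κ → Data) (g : κ → ι) (T : ∀ j, Fin (n (g j)) → Fin (n (g j))),
      (∀ {X : ι → Data}, Poly F X → Poly E fun j => X (g j)) →
      Poly E (fun j => fn (T j)) → Poly E fun j => atom (φ (g j) (T j))) :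
    Poly F fun i => atom (wsum (φ i) (L i)) :=
  list_sum (q := fun i => (L i).map fun q => q.1 * φ i q.2)
    ((map L (fun _ q => wt q) (fun i q => atom (q.1 * φ i q.2)) hL fun E g q _ wk hq =>
      mul hq.fst (hφ E g (fun j => (q j).2) wk hq.snd)).congr fun i => by rw [List.map_map]; rfl)

theorem used (hL : Poly F fun i => wts (L i)) (hu : Poly F fun i => nat (u i))
    (hw : Poly F fun i => nat (w i)) : Poly F fun i => atom (used (L i) (u i) (w i)) :=
  wsum hL fun _ _ _ wk hT => ite_atom (PolyDec.fin_eq (wk hu) (wk hw)) (const _ 0)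
    ((ite_atom (PolyDec.fin_eq (apply_fn hT (wk hw)) (wk hu)) (const _ 1) (const _ 0)).add
      (ite_atom (PolyDec.fin_eq (apply_fn hT (wk hu)) (wk hw)) (const _ 1) (const _ 0)))

theorem cov (hL : Poly F fun i => wts (L i)) (hr : Poly F fun i => nat (r i))
    (hv : Poly F fun i => nat (v i)) : Poly F fun i => atom (cov (r i) (L i) (v i)) :=
  wsum hL fun _ _ _ wk hT => ite_atom (PolyDec.inT (wk hr) hT (wk hv)) (const _ 1) (const _ 0)

theorem greedy {D N : ι → ℕ} {b : ι → ℚ} {P : ∀ i, (Fin (n i) → Fin (n i)) → Prop}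
    {G : ∀ i, (Fin (n i) → Fin (n i)) → Fin (n i) → Fin (n i)}
    (hD0 : ∀ i, D i ≠ 0) (hD : PB (fun i => (D i).size) fun i => (F i).size)
    (hn : Poly F fun i => rng (n i)) (hL : Poly F fun i => wts (L i))
    (hW : ∀ i, Weights (D i) (N i) (L i)) (hb : Poly F fun i => atom (b i))
    (hbD : ∀ i, (b i).den ∣ D i)
    (hP : ∀ {κ : Type} (E : κ → Data) (g : κ → ι) (T : ∀ j, Fin (n (g j)) → Fin (n (g j))),
      (∀ {X : ι → Data}, Poly F X → Poly E fun j => X (g j)) →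
      Poly E (fun j => fn (T j)) → PolyDec E fun j => P (g j) (T j))
    (hG : ∀ {κ : Type} (E : κ → Data) (g : κ → ι) (T : ∀ j, Fin (n (g j)) → Fin (n (g j))),
      (∀ {X : ι → Data}, Poly F X → Poly E fun j => X (g j)) →
      Poly E (fun j => fn (T j)) → Poly E fun j => fn (G (g j) (T j))) :
    Poly F fun i => wts (greedy (P i) (G i) (b i) (L i)) :=
  (foldl (α := fun i => ℚ × (Fin (n i) → Fin (n i)))
    (σ := fun i => ℚ × List (ℚ × (Fin (n i) → Fin (n i)))) L
    (fun i => greedyStep (P i) (G i)) (fun i => (b i, [])) (fun _ => wt)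
    (fun _ s => .pair (atom s.1) (wts s.2)) (fun i k s => GreedyInv (D i) (b i) k s)
    (fun i => ⟨hbD i, le_rfl, by simp, by simp, by simp, by simp⟩)
    (fun i k s q _ hq hs => hs.step _ _ ((hW i).den q hq) ((hW i).nonneg q hq)
      ((hW i).le_one q hq))
    hL (hb.pair (nil F))
    (fun i => 2 + (atom (b i)).size + 2 * (D i).size +
      (2 + 2 * (L i).length * (1 + wtBound (n i) (D i))))
    ((((PB.const 2).add hb.size_bound).add ((PB.const 2).mul hD)).add ((PB.const 2).add
      (((PB.const 2).mul (hL.size_bound.of_le fun i =>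
        (List.length_map wt).ge.trans (length_le_size ((L i).map wt)))).mul ((PB.const 1).add
          (PB.wtBound hn.size_bound hD)))))
    (fun i k s hk hs => by
      have h1 := size_atom_le (B := (b i).num.natAbs) (hD0 i) hs.den
        (hs.abs_le.trans (abs_le_natAbs_num _))
      have h2 := size_wts_le (hD0 i) (hs.weights.mono (Nat.mul_le_mul_left 2 hk))
      simp only [size] at h1 ⊢
      omega)
    (fun E g k s q _ _ _ wk hq hs => by
      classical
      refine (ite ((hP E g (fun j => (q j).2) wk hq.snd).and (PolyDec.lt (const _ 0) hs.fst))
        (ite (PolyDec.le hq.fst hs.fst)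
          ((sub hs.fst hq.fst).pair ((hq.fst.pair (hG E g (fun j => (q j).2) wk hq.snd)).pair hs.snd))
          ((const _ 0).pair ((hs.fst.pair (hG E g (fun j => (q j).2) wk hq.snd)).pair
            (((sub hq.fst hs.fst).pair hq.snd).pair hs.snd))))
        (hs.fst.pair (hq.pair hs.snd))).congr fun j => ?_
      rw [greedyStep]
      split_ifs <;> rfl)).snd

theorem undoSplit {D N : ι → ℕ} {q : ∀ i, Fin (n i) × Fin (n i) × (Fin (n i) → Fin (n i) → ℚ)}
    (hD0 : ∀ i, D i ≠ 0) (hD : PB (fun i => (D i).size) fun i => (F i).size)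
    (hn : Poly F fun i => rng (n i)) (hL : Poly F fun i => wts (L i))
    (hW : ∀ i, Weights (D i) (N i) (L i)) (hv : Poly F fun i => nat (v i))
    (hq : Poly F fun i => splitRec (q i)) (hqs : ∀ i, Small (D i) (q i).2.2) :
    Poly F fun i => wts (undoSplit (v i) (L i) (q i)) := by
  have hu := hq.fst
  have hw := hq.snd.fst
  have hx := hq.snd.snd
  exact greedy hD0 hD hn hL hW ((used hL hu hw).sub (get₂ hx hu hw))
    (fun i => (hW i).den_undoSplit_dvd (hqs i))
    (fun _ _ _ wk hT => (PolyDec.fin_eq (apply_fn hT (wk hw)) (wk hu)).or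
      (PolyDec.fin_eq (apply_fn hT (wk hu)) (wk hw)))
    (fun _ _ _ wk hT => reroute (wk hn) hT (wk hu) (wk hw) (wk hv))

theorem attachStep {D N : ι → ℕ} {x : ∀ i, Fin (n i) → Fin (n i) → ℚ} {c : ι → ℚ}
    (hD0 : ∀ i, D i ≠ 0) (hD : PB (fun i => (D i).size) fun i => (F i).size)
    (hn : Poly F fun i => rng (n i)) (hL : Poly F fun i => wts (L i))
    (hW : ∀ i, Weights (D i) (N i) (L i)) (hr : Poly F fun i => nat (r i))
    (hv : Poly F fun i => nat (v i)) (hx : Poly F fun i => mat (x i))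
    (hc : Poly F fun i => atom (c i)) (hu : Poly F fun i => nat (u i))
    (hxs : ∀ i, Small (D i) (x i)) (hcD : ∀ i, (c i).den ∣ D i) :
    Poly F fun i => wts (attachStep (r i) (v i) (x i) (c i) (L i) (u i)) :=
  greedy hD0 hD hn hL hW (min ((get₂ hx hu hv).sub (used hL hu hv)) (hc.sub (cov hL hr hv)))
    (fun i => (hW i).den_attachStep_dvd (v i) (hxs i) (hcD i) (u i))
    (fun _ _ _ wk hT => (PolyDec.inT (wk hr) hT (wk hu)).and (PolyDec.inT (wk hr) hT (wk hv)).not)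
    (fun _ _ _ wk hT => update_fn (wk hn) hT (wk hv) (wk hu))

theorem undoElim {D N : ι → ℕ} {y₀ : ∀ i, Fin (n i) → ℚ} {e : ∀ i, ElimRec (Fin (n i)) ℚ}
    (hD0 : ∀ i, D i ≠ 0) (hD : PB (fun i => (D i).size) fun i => (F i).size)
    (hN : PB N fun i => (F i).size)
    (hn : Poly F fun i => rng (n i)) (hL : Poly F fun i => wts (L i))
    (hW : ∀ i, Weights (D i) (N i) (L i)) (hr : Poly F fun i => nat (r i))
    (he : Poly F fun i => elimRec (e i)) (hes : ∀ i, SmallRec (D i) (y₀ i) (e i))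
    (hy : ∀ i a, (y₀ i a).den ∣ D i) :
    Poly F fun i => wts (undoElim (List.finRange (n i)) (r i) (L i) (e i)) := by
  have hv := he.fst
  have hc := he.snd.fst
  have hx := he.snd.snd.fst
  have hrecs := he.snd.snd.snd
  have hnB := hn.n_bound
  have hwB := PB.wtBound hn.size_bound hD
  have hcD : ∀ i, (e i).2.1.den ∣ D i := fun i => by rw [(hes i).val]; exact hy i _
  set M : ∀ i, List (ℚ × (Fin (n i) → Fin (n i))) := fun i =>
    (e i).2.2.2.foldl (PCTSP.undoSplit (e i).1) (L i) with hM
  have hMW : ∀ i, Weights (D i) (N i + n i * n i) (M i) := fun i =>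
    ((hW i).foldl_undoSplit (e i).1 _ (hes i).recs).mono
      (Nat.add_le_add_left (hes i).length _)
  have h1 : Poly F fun i => wts (M i) :=
    foldl (α := fun i => Fin (n i) × Fin (n i) × (Fin (n i) → Fin (n i) → ℚ))
      (σ := fun i => List (ℚ × (Fin (n i) → Fin (n i)))) (fun i => (e i).2.2.2)
      (fun i => PCTSP.undoSplit (e i).1) L (fun _ => splitRec) (fun _ => wts)
      (fun i k L => Weights (D i) (N i + k) L) hW
      (fun i k L q _ hq hL => hL.undoSplit _ ((hes i).recs q hq)) hrecs hL
      (fun i => 2 + (N i + n i * n i) * (1 + wtBound (n i) (D i)))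
      ((PB.const 2).add ((hN.add (hnB.mul hnB)).mul ((PB.const 1).add hwB)))
      (fun i k L hk hL => size_wts_le (hD0 i)
        (hL.mono (Nat.add_le_add_left (hk.trans (hes i).length) _)))
      (fun E g k L q _ hq hLW wk hq' hL' => undoSplit (fun j => hD0 (g j))
        ((hD.reindex g).trans (wk (id F)).size_bound) (wk hn) hL' hLW (wk hv) hq'
        fun j => (hes (g j)).recs _ (hq j))
  exact foldl (α := fun i => Fin (n i)) (σ := fun i => List (ℚ × (Fin (n i) → Fin (n i))))
    (fun i => List.finRange (n i))
    (fun i => PCTSP.attachStep (r i) (e i).1 (e i).2.2.1 (e i).2.1) M (fun _ a => nat a)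
    (fun _ => wts) (fun i k L => Weights (D i) (N i + n i * n i + k) L) hMW
    (fun i k L a _ _ hL => hL.attachStep _ (hes i).mat (hcD i) a) hn.rng_map h1
    (fun i => 2 + (N i + n i * n i + n i) * (1 + wtBound (n i) (D i)))
    ((PB.const 2).add (((hN.add (hnB.mul hnB)).add hnB).mul ((PB.const 1).add hwB)))
    (fun i k L hk hL => size_wts_le (hD0 i)
      (hL.mono (Nat.add_le_add_left (by simpa using hk) _)))
    (fun E g k L a _ _ hLW wk ha hL' => attachStep (fun j => hD0 (g j))
      ((hD.reindex g).trans (wk (id F)).size_bound) (wk hn) hL' hLW (wk hr) (wk hv) (wk hx) (wk hc)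
      ha (fun j => (hes (g j)).mat) fun j => hcD (g j))

theorem weightedTrees {D : ι → ℕ} {x : ∀ i, Fin (n i) → Fin (n i) → ℚ} {y : ∀ i, Fin (n i) → ℚ}
    (hD0 : ∀ i, D i ≠ 0) (hD : PB (fun i => (D i).size) fun i => (F i).size)
    (hn : Poly F fun i => rng (n i)) (hx : Poly F fun i => mat (x i))
    (hy : Poly F fun i => vec fun a => atom (y i a)) (hr : Poly F fun i => nat (r i))
    (hI : ∀ i, ElimBounds (D i) (r i) (x i) (y i) 0 (x i, y i, [])) :
    Poly F fun i => wts (weightedTrees (List.finRange (n i)) (r i) (x i) (y i)) := by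
  have hel := (elimAll hD0 hD hn hx hy hr hI).snd.snd
  have hB := fun i => (hI i).elimAll
  have hnB := hn.n_bound
  have hwB := PB.wtBound hn.size_bound hD
  have h0 : Poly F fun i => wts [((1 : ℚ), (_root_.id : Fin (n i) → Fin (n i)))] :=
    ((const _ 1).pair (fn_tab hn fun _ _ _ _ hj => hj)).pair (nil F)
  have hNle : ∀ i k, k ≤ n i → 1 + k * (n i * n i + n i) ≤ 1 + n i * (n i * n i + n i) :=
    fun i k hk => Nat.add_le_add_left (Nat.mul_le_mul_right _ hk) 1
  exact foldl (α := fun i => ElimRec (Fin (n i)) ℚ)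
    (σ := fun i => List (ℚ × (Fin (n i) → Fin (n i))))
    (fun i => (PCTSP.elimAll (List.finRange (n i)) (r i) (x i) (y i)).2.2)
    (fun i => PCTSP.undoElim (List.finRange (n i)) (r i)) (fun i => [(1, _root_.id)])
    (fun _ => elimRec) (fun _ => wts)
    -- The bound on `k` belongs to the invariant because the estimate for the number of trees must
    -- be uniform over all rounds.
    (fun i k L => k ≤ n i ∧ Weights (D i) (1 + k * (n i * n i + n i)) L)
    (fun i => ⟨Nat.zero_le _, by simp, by simp, by simp, by simp⟩)
    (fun i k L e hk he hL => ⟨Nat.lt_of_lt_of_le hk (hB i).length, by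
      have := hL.2.undoElim (r := r i) (hI i).integral.val ((hB i).small e he)
      rwa [add_assoc, ← Nat.succ_mul] at this⟩)
    hel h0
    (fun i => 2 + (1 + n i * (n i * n i + n i)) * (1 + wtBound (n i) (D i)))
    ((PB.const 2).add (((PB.const 1).add (hnB.mul ((hnB.mul hnB).add hnB))).mul
      ((PB.const 1).add hwB)))
    (fun i k L hk hL => size_wts_le (hD0 i) (hL.2.mono (hNle i k hL.1)))
    (fun E g k L e _ he hL wk he' hL' => undoElim (N := fun j =>
        1 + n (g j) * (n (g j) * n (g j) + n (g j))) (y₀ := fun j => y (g j)) (fun j => hD0 (g j))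
      ((hD.reindex g).trans (wk (id F)).size_bound)
      ((((PB.const 1).add (hnB.mul ((hnB.mul hnB).add hnB))).reindex g).trans
        (wk (id F)).size_bound)
      (wk hn) hL' (fun j => (hL j).2.mono (hNle _ _ (hL j).1)) (wk hr) he'
      (fun j => (hB (g j)).small _ (he j)) fun j => (hI (g j)).integral.val)

theorem distinct (hn : Poly F fun i => rng (n i)) (hL : Poly F fun i => wts (L i)) :
    Poly F fun i => ofList ((distinct (L i)).map fn) :=
  foldl (α := fun i => ℚ × (Fin (n i) → Fin (n i))) (σ := fun i => List (Fin (n i) → Fin (n i)))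
    L (fun i s q => s.insert q.2) (fun _ => []) (fun _ => wt) (fun _ s => ofList (s.map fn))
    (fun i k s => s.length ≤ k) (fun _ => le_rfl)
    (fun i k s q _ _ hs => by
      by_cases h : q.2 ∈ s
      · rw [List.insert_of_mem h]; omega
      · rw [List.insert_of_not_mem h, List.length_cons]; omega)
    hL (nil F)
    (fun i => 2 + (L i).length * (1 + (2 + n i * (1 + (rng (n i)).size))))
    ((PB.const 2).add ((hL.size_bound.of_le fun i =>
        (List.length_map wt).ge.trans (length_le_size ((L i).map wt))).mul ((PB.const 1).add ((PB.const 2).add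
          (hn.n_bound.mul ((PB.const 1).add hn.size_bound))))))
    (fun i k s hk hs => size_ofList_le (by simpa using hs.trans hk) fun d hd => by
      obtain ⟨T, -, rfl⟩ := List.mem_map.1 hd
      exact size_fn_le T)
    (fun E g k s q _ _ _ wk hq hs => by
      refine (ite (P := fun j => (q j).2 ∈ s j) ((PolyDec.list_exists s (fun _ => fn)
        (P := fun j T => T = (q j).2) hs fun E' g' T _ wk' hT =>
          PolyDec.fn_eq (wk' (wk hn)) hT (wk' hq.snd)).congr fun j => by simp) hs
        (hq.snd.pair hs)).congr fun j => ?_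
      by_cases h : (q j).2 ∈ s j
      · rw [if_pos h, List.insert_of_mem h]
      · rw [if_neg h, List.insert_of_not_mem h]; rfl)

theorem encodeTree {T : ∀ i, Fin (n i) → Fin (n i)} (hn : Poly F fun i => rng (n i))
    (hr : Poly F fun i => nat (r i)) (hT : Poly F fun i => fn (T i)) :
    Poly F fun i => encodeTree (toSub (r i) (T i)) := by
  classical
  have h1 : Poly F fun i => vec fun v => atom (if v ∈ (toSub (r i) (T i)).verts then 1 else 0) :=
    tab hn fun _ _ _ wk hj => (PolyDec.inT (wk hr) (wk hT) hj).toPoly.congr fun _ => by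
      congr
  have h2 : Poly F fun i => mat fun u w => if (toSub (r i) (T i)).Adj u w then 1 else 0 :=
    tab₂ hn fun _ _ _ _ wk hu hw => ((PolyDec.fin_eq hu hw).not.and
      ((PolyDec.inT (wk hr) (wk hT) hu).and ((PolyDec.inT (wk hr) (wk hT) hw).and
        ((PolyDec.fin_eq (apply_fn (wk hT) hw) hu).or
          (PolyDec.fin_eq (apply_fn (wk hT) hu) hw))))).toPoly.congr fun _ => by
            congr
  refine (h1.pair h2).congr fun i => ?_
  rw [PCTSP.encodeTree]
  congr!

/-- The numbers below the length of a list. -/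
theorem rng_of_vec {v : ∀ i, Fin (n i) → Data} (hn : Poly F fun i => nat (n i))
    (hv : Poly F fun i => vec (v i)) : Poly F fun i => rng (n i) := by
  have hlen : PB (fun i => n i) fun i => (F i).size := hv.size_bound.of_le fun i =>
    List.length_ofFn.ge.trans (length_le_size (List.ofFn (v i)))
  -- The number `n` is written in binary and cannot drive a loop by itself; the vector supplies the
  -- `n` rounds. Counting down makes the list come out in increasing order.
  have h1 := foldl (F := F) (α := fun _ => Data) (σ := fun _ => ℕ × List ℕ)
    (fun i => List.ofFn (v i)) (fun i s _ => (s.1 - 1, (s.1 - 1) :: s.2)) (fun i => (n i, []))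
    (fun _ d => d) (fun _ s => .pair (nat s.1) (ofList (s.2.map nat)))
    (fun i k s => s.1 = n i - k ∧ s.2 = List.range' (n i - k) k)
    (fun i => by simp)
    (fun i k s a hk _ hs => by
      simp only [List.length_ofFn] at hk
      refine ⟨by simp only [hs.1]; omega, ?_⟩
      have e : n i - k - 1 + 1 = n i - k := by omega
      simp only [hs.1, hs.2]
      rw [show n i - (k + 1) = n i - k - 1 by omega, List.range'_succ, e])
    (hv.congr fun i => by rw [List.map_id'' fun _ => rfl]; rfl) (hn.pair (nil F))
    (fun i => 1 + (nat (n i)).size + (2 + n i * (1 + (nat (n i)).size)))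
    (((PB.const 1).add hn.size_bound).add ((PB.const 2).add (hlen.mul ((PB.const 1).add
      hn.size_bound))))
    (fun i k s hk hs => by
      simp only [List.length_ofFn] at hk
      have h1 := size_nat_mono (show s.1 ≤ n i by omega)
      have h2 : (ofList (s.2.map nat)).size ≤ 2 + n i * (1 + (nat (n i)).size) := by
        refine size_ofList_le (by simpa [hs.2] using hk) fun d hd => ?_
        obtain ⟨m, hm, rfl⟩ := List.mem_map.1 hd
        rw [hs.2, List.mem_range'_1] at hm
        exact size_nat_mono (by omega)
      simp only [size]
      omega)
    (fun E g k s a hk _ hs wk _ hs' => by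
      have h1 : Poly E fun j => nat ((s j).1 - 1) := (hs'.fst.sub (const _ 1)).congr fun j => by
        have h1 := hk j
        simp only [List.length_ofFn] at h1
        have h2 := (hs j).1
        rw [nat, Nat.cast_sub (by omega)]
        simp
      exact h1.pair (h1.pair hs'.snd))
  refine h1.snd.congr fun i => ?_
  have key : ∀ (l : List Data) (k : ℕ), k + l.length ≤ n i →
      l.foldl (fun (s : ℕ × List ℕ) _ => (s.1 - 1, (s.1 - 1) :: s.2))
        (n i - k, List.range' (n i - k) k) =
      (n i - (k + l.length), List.range' (n i - (k + l.length)) (k + l.length)) := by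
    intro l
    induction l with
    | nil => intro k _; rfl
    | cons a l ih =>
      intro k hk
      simp only [List.length_cons] at hk
      have := ih (k + 1) (by omega)
      rw [List.length_cons, List.foldl_cons, Nat.add_comm l.length, ← Nat.add_assoc, ← this]
      have e : n i - k - 1 + 1 = n i - k := by omega
      rw [show n i - (k + 1) = n i - k - 1 by omega, List.range'_succ, e]
  have := key (List.ofFn (v i)) 0 (by simp)
  simp only [Nat.sub_zero, List.range'_zero, zero_add, List.length_ofFn, Nat.sub_self] at this
  rw [this, rng, vec_eq_map, ← List.range_eq_range', ← List.map_coe_finRange_eq_range,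
    List.map_map]
  rfl

end Poly

end Machine

/-! ### The program for feasible instances -/

namespace PCTSP

open Machine Data

/-- A feasible instance. -/
abbrev Instance : Type :=
  {p : Σ n : ℕ, Fin n × (Sym2 (Fin n) → ℚ) × (Fin n → ℚ) //
    IsFeasible p.2.1 p.2.2.1 p.2.2.2}

theorem poly_weightedTrees : Poly
    (fun i : Instance => encodeInput i.1.2.1 i.1.2.2.1 i.1.2.2.2) fun i =>
      ofList ((distinct (weightedTrees (List.finRange i.1.1) i.1.2.1 (toMatrix i.1.2.2.1)
        i.1.2.2.2)).map fun T => .pair (encodeTree (toSub i.1.2.1 T))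
          (atom (treeWeight i.1.2.1 (weightedTrees (List.finRange i.1.1) i.1.2.1
            (toMatrix i.1.2.2.1) i.1.2.2.2) (toSub i.1.2.1 T)))) := by
  classical
  have h0 := Poly.id fun i : Instance => encodeInput i.1.2.1 i.1.2.2.1 i.1.2.2.2
  have hn0 : Poly _ fun i : Instance => nat i.1.1 := h0.fst
  have hr : Poly _ fun i : Instance => nat i.1.2.1 := h0.snd.fst
  have hx : Poly _ fun i : Instance => mat (toMatrix i.1.2.2.1) := h0.snd.snd.fst
  have hy : Poly _ fun i : Instance => vec fun a => atom (i.1.2.2.2 a) := h0.snd.snd.snd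
  have hn := Poly.rng_of_vec hn0 hy
  -- The product of the denominators of all input entries has polynomially many bits.
  set D : Instance → ℕ := fun i =>
    (Data.pair (mat (toMatrix i.1.2.2.1)) (vec fun a => atom (i.1.2.2.2 a))).dens with hD
  have hDB := (hx.pair hy).size_bound.of_le fun i => size_dens_le _
  have hL := Poly.weightedTrees (D := D) (fun i => dens_ne_zero _) hDB hn hx hy hr fun i => by
    have hf := i.2.feas
    have h0 := fun u => (i.2.vertex_mem u).1
    exact ⟨⟨.nil, hf, fun u hu => absurd hu (not_lt.2 (h0 u)), i.2.root_eq,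
      fun u => (i.2.vertex_mem u).2⟩, hf.integral h0
        (fun a b => (den_dvd_dens_mat _ a b).trans (Dvd.intro _ rfl))
        (fun a => (den_dvd_dens_vec _ a).trans (Dvd.intro_left _ rfl)), fun a => .inl rfl,
        le_rfl, by simp⟩
  set L : ∀ i : Instance, List (ℚ × (Fin i.1.1 → Fin i.1.1)) := fun i =>
    weightedTrees (List.finRange i.1.1) i.1.2.1 (toMatrix i.1.2.2.1) i.1.2.2.2 with hLdef
  have hvalid : ∀ i : Instance, ∀ q ∈ L i, Valid i.1.2.1 q.2 := fun i =>
    (weightedTrees_spec (l := List.finRange i.1.1) (by simp) (by simp) i.2.feas i.2.root_eq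
      (fun u => (i.2.vertex_mem u).1) fun u => (i.2.vertex_mem u).2).dom.valid
  refine Machine.Poly.map (fun i => distinct (L i)) (fun _ => fn) (fun i T =>
    .pair (encodeTree (toSub i.1.2.1 T)) (atom (treeWeight i.1.2.1 (L i) (toSub i.1.2.1 T))))
    (Poly.distinct hn hL) fun E g T hT wk hT' => ?_
  refine (Poly.encodeTree (wk hn) (wk hr) hT').pair ?_
  -- The weight of a subgraph is found by comparing parent functions, which is legitimate because
  -- valid ones are determined by their subgraphs.
  refine (Poly.wsum (φ := fun j T' => if T' = T j then 1 else 0) (wk hL)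
    fun E' g' T' wk' hT'' => Poly.ite_atom (PolyDec.fn_eq (wk' (wk hn)) hT'' (wk' hT'))
      (Machine.Poly.const _ 1) (Machine.Poly.const _ 0)).congr fun j => ?_
  congr 1
  obtain ⟨p, hp, hpT⟩ := ((distinct_spec (L (g j))).2 _).1 (hT j)
  refine wsum_congr fun q hq => ?_
  refine if_congr ⟨fun h => by rw [h], fun h => ?_⟩ rfl rfl
  rw [← hpT] at h ⊢
  exact (hvalid _ q hq).toSub_injective (hvalid _ p hp) h

theorem encodesWeightedTrees {n : ℕ} {r : Fin n} {L : List (ℚ × (Fin n → Fin n))}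
    (hL : ∀ q ∈ L, Valid r q.2) : EncodesWeightedTrees
      (ofList ((distinct L).map fun T => .pair (encodeTree (toSub r T))
        (atom (treeWeight r L (toSub r T))))) (treeSet r L) (treeWeight r L) := by
  classical
  obtain ⟨h1, h2⟩ := distinct_spec L
  refine ⟨(distinct L).map (toSub r), h1.map_on fun T hT T' hT' e => ?_, fun H => ?_, ?_⟩
  · obtain ⟨q, hq, rfl⟩ := (h2 _).1 hT
    obtain ⟨q', hq', rfl⟩ := (h2 _).1 hT'
    exact (hL q hq).toSub_injective (hL q' hq') e
  · rw [treeSet, List.mem_toFinset, List.mem_map, List.mem_map]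
    constructor
    · rintro ⟨T, hT, rfl⟩
      obtain ⟨q, hq, rfl⟩ := (h2 _).1 hT
      exact ⟨q, hq, rfl⟩
    · rintro ⟨q, hq, rfl⟩
      exact ⟨q.2, (h2 _).2 ⟨q, hq, rfl⟩, rfl⟩
  · rw [List.map_map]
    rfl

end PCTSP

theorem lemma12 :
    -- every feasible solution has a decomposition into weighted trees ...
    (∀ (V : Type*) [Fintype V] [DecidableEq V] (r : V) (x : Sym2 V → ℝ) (y : V → ℝ),
      PCTSP.IsFeasible r x y →
      ∃ (𝒯 : Finset (⊤ : SimpleGraph V).Subgraph) (μ : (⊤ : SimpleGraph V).Subgraph → ℝ),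
        PCTSP.IsTreePartition r x y 𝒯 μ) ∧
    -- ... and one program computes such a decomposition from any rational feasible solution,
    -- in time polynomial in the number of bits of the input
    (∃ (A : Machine.Code) (p : Polynomial ℕ),
      ∀ (n : ℕ) (r : Fin n) (x : Sym2 (Fin n) → ℚ) (y : Fin n → ℚ),
        PCTSP.IsFeasible r x y →
        ∃ (out : Machine.Data) (t : ℕ) (𝒯 : Finset (⊤ : SimpleGraph (Fin n)).Subgraph)
          (μ : (⊤ : SimpleGraph (Fin n)).Subgraph → ℚ),
          Machine.Runs A (PCTSP.encodeInput r x y) out t ∧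
          t ≤ p.eval (PCTSP.encodeInput r x y).size ∧
          PCTSP.EncodesWeightedTrees out 𝒯 μ ∧
          PCTSP.IsTreePartition r x y 𝒯 μ) := by
  -- For existence any enumeration of the vertices will do.
  refine ⟨fun V _ _ r x y h => ⟨_, _, h.isTreePartition (l := Finset.univ.toList) (by simp)
    (by simp)⟩, ?_⟩
  obtain ⟨A, t, hA, hb⟩ := PCTSP.poly_weightedTrees
  obtain ⟨p, hp⟩ := hb.exists_polynomial
  refine ⟨A, p, fun n r x y h => ⟨_, _, _, _, hA ⟨⟨n, r, x, y⟩, h⟩, hp ⟨⟨n, r, x, y⟩, h⟩,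
    PCTSP.encodesWeightedTrees ?_, h.isTreePartition (by simp) (by simp)⟩⟩
  exact (PCTSP.weightedTrees_spec (by simp) (by simp) h.feas h.root_eq
    (fun u => (h.vertex_mem u).1) fun u => (h.vertex_mem u).2).dom.valid
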